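/- **Setting.** For strings $x,y$ let $\operatorname{ED}(x,y)$ be the least number of insertions, deletions and substitutions that transform $x$ into $y$. Fix integers $L,i_{\max}\ge 1$ and put $\epsilon=200^{-(L+i_{\max}+1)}$, $\epsilon'=200^{-(L+i_{\max}+2)}$, $n_{\min}=(1000/\epsilon'^{10})^{4^{L+2}/\epsilon'^2}$, $\epsilon_i=100^{i+1}\epsilon$, $\tau_{\max}=1000/\epsilon^2$. For every level $\ell\ge 0$ let $\alpha_\ell=2^{(20000\cdot 200^{2(\ell+i_{\max}+1)})^{\ell}}$ (so $\alpha_L=2^{(20000/\epsilon^2)^L}$), and put $c_L=100\,\alpha_{L-1}$, $\beta_L=c_L^{\tau_{\max}+2}$. Given $A,B\in\Sigma^n$ and $\Delta\in[n^{1-\epsilon'},n]$, let $d=\lfloor\sqrt n\rfloor$ and $\gamma=\max\{1,\lfloor\Delta d/n\rfloor\}$. The windows are substrings of length $d$: $\mathcal A$ consists of the $\lfloor n/d\rfloor$ consecutive windows of $A$ starting at $0,d,2d,\dots$, and $\mathcal B$ of the windows of $B$ starting at $0,\gamma,2\gamma,\dots$ and at $n-d$. Write $s(\cdot)$ for starting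 positions and $t=|\mathcal A|+|\mathcal B|$. For $\mathcal E:\mathcal A\times\mathcal B\to\mathbb N$, put $\mathcal E(a,\bot)=d$ and $$\operatorname{ED}(\mathcal E)=\min_{\mu}\Big(2\sum_{a\in\mathcal A}\mathcal E(a,\mu(a))+2\sum_{a}\big|s(\mu(a))+d-s(\mu(a.\mathrm{next}))\big|+2\,(n\bmod d)\Big),$$ where $\mu$ ranges over the monotone mappings $\mathcal A\to\mathcal B\cup\{\bot\}$, and the second sum is over the mapped windows $a$ that are followed by another mapped window, the first of which is $a.\mathrm{next}$. (The last term vanishes if $n$ is a perfect square.) **Algorithms.** All of them run on a unit-cost random access machine; calls of $\textsc{Main}$ for one pair of windows (in either order) and one $\Delta_{query}$ are made only once and then remembered. Let $b=\lceil t^\epsilon\rceil$, $\rho=t^{1/i_{\max}}$, let $\operatorname{snap}(m)$ be the largest power of $b$ that is at most $m$, and $\operatorname{snap}(0)=0$. Let $\mathcal I$ consist, for each of the lengths $1,b,\dots,b^{1/\epsilon}$, of consecutive disjoint intervals of windows of this length covering $\mathcal A$ and $\mathcal B$; $7I$ is the interval of $7$ times the length of $I$ centered at $I$, truncated at the ends.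 * $\textsc{Query}$ at depth $i\in\{0,\dots,i_{\max}\}$ with live windows $\mathcal L$ and parameter $\Delta_{query}$. If $i=i_{\max}$, it returns all pairs $(x,y)\in\mathcal L^2$ for which $\textsc{Main}(x,y,\Delta_{query},L-1)\le c_L\Delta_{query}$. Otherwise it does the following $\lceil t^{\epsilon_{i+1}}\rho\rceil$ times and returns the union of the pairs found. It draws $x\in\mathcal L$ and $\tau\in\{1,\dots,\tau_{\max}\}$ uniformly and lets $C$ be the set of $y\in\mathcal L$ with $\textsc{Main}(x,y,\Delta_{query},L-1)\le c_L^{\tau}\Delta_{query}$. If $\operatorname{snap}|C|/\operatorname{snap}|\mathcal L|>\rho^{-1}$, all pairs in $C\times C$ are found. Otherwise, it calls itself at depth $i+1$ with live windows the union of the sets $\mathcal L\cap 7I$ over those $I\in\mathcal I$ for which $\mathcal L\cap 7I\neq\emptyset$ and $\frac{\operatorname{snap}|C\cap 7I|}{\operatorname{snap}|\mathcal L\cap 7I|}\cdot\frac{\operatorname{snap}|\mathcal L|}{\operatorname{snap}|C|}\ge\rho$. If $\mathcal L=\emptyset$, nothing is found. * $\textsc{AggregateEstimates}$ starts with $\mathcal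 E\equiv d$. For every $\Delta_{query}\in\{\gamma,2\gamma,4\gamma,\dots,d\}$ (the $2^k\gamma<d$, and $d$) it runs $\textsc{Query}$ at depth $0$ with all windows live, and replaces $\mathcal E(a,b)$ by $\min(\mathcal E(a,b),\beta_L\Delta_{query})$ for each pair $(a,b)\in\mathcal A\times\mathcal B$ found. It returns $\mathcal E$. * $\textsc{Main}(A,B,\Delta,0)$ computes $\operatorname{ED}(A,B)$ by the quadratic dynamic program. For $L\ge1$, $\textsc{Main}(A,B,\Delta,L)$ forms the windows and intervals, runs $\textsc{AggregateEstimates}$ and returns $\operatorname{ED}(\mathcal E)$, computed by dynamic programming. A call $\textsc{Main}(x,y,\Delta_{query},L-1)$ *succeeds* if its value lies in $[\operatorname{ED}(x,y),\ \alpha_{L-1}(\operatorname{ED}(x,y)+\Delta_{query})]$. **Statement.** $\textsc{Main}(A,B,\Delta,0)$ returns $\operatorname{ED}(A,B)$ in $O(n^2)$ time. For all $L,i_{\max}\ge1$, all $n\ge n_{\min}$, all $\Delta\in[n^{1-\epsilon'},n]$ and all $A,B\in\Sigma^n$: 1. $\textsc{AggregateEstimates}$ makes at most $n^{1/2+2/i_{\max}}$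 queries to $\textsc{Main}(\cdot,\cdot,\cdot,L-1)$ and otherwise runs in time at most $n^{1+2/i_{\max}}$, however the queries are answered. Assuming that all of its calls succeed, with probability at least $1-e^{-t^{\epsilon'}}$ it returns an estimate $\mathcal E$ with $$\operatorname{ED}(A,B)\le\operatorname{ED}(\mathcal E)\le\alpha_L(\operatorname{ED}(A,B)+\Delta).$$ (Precisely: if the new queries are answered independently of the rest, according to arbitrary laws that depend only on the query, then the probability that all calls succeed and this fails is at most $e^{-t^{\epsilon'}}$.) 2. $\textsc{Main}(A,B,\Delta,L)$ makes at most $n^{1/2+2/i_{\max}}$ queries to $\textsc{Main}(\cdot,\cdot,\cdot,L-1)$ and otherwise runs in time at most $n^{1+2/i_{\max}}$. With probability at least $1-e^{-t^{\epsilon'/2}}$, all the recursive calls succeed, they all run efficiently (the bounds of the first sentence of this item hold for them with $d$ in place of $n$, or, if $L=1$, they take $O(d^2)$ time), and the value $\widehat{\operatorname{ED}}(A,B)$ returned satisfies $$\operatorname{ED}(A,B)\le\widehat{\operatorname{ED}}(A,B)\le\alpha_L(\operatorname{ED}(A,B)+\Delta).$$ -/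

import Mathlib

open scoped ENNReal

namespace EditApprox

/-! ### Edit distance -/

section EditDistance

variable {α : Type*}

/-- One edit: a single insertion, deletion or substitution of a character. -/
inductive Edit : List α → List α → Prop
  | insertion (u v : List α) (a : α) : Edit (u ++ v) (u ++ a :: v)
  | deletion (u v : List α) (a : α) : Edit (u ++ a :: v) (u ++ v)
  | substitution (u v : List α) (a b : α) : Edit (u ++ a :: v) (u ++ b :: v)

/-- `EditPath k A B`: the string `A` can be transformed into `B` by `k` edits. -/
inductive EditPath : ℕ → List α → List α → Prop
  | refl (A : List α) : EditPath 0 A A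
  | step {k : ℕ} {A B C : List α} : Edit A B → EditPath k B C → EditPath (k + 1) A C

/-- The edit distance `ED(A, B)`: the least number of edits that transform `A` into `B`. -/
noncomputable def editDist (A B : List α) : ℕ := sInf {k | EditPath k A B}

end EditDistance

/-! ### The parameters that depend only on the recursion level `L` and on `imax` -/

/-- `1 / ε`, where `ε = 1 / 200 ^ (L + imax + 1)`. -/
def invEps (L imax : ℕ) : ℕ := 200 ^ (L + imax + 1)

/-- `ε = 1 / 200 ^ (L + imax + 1)`. -/
noncomputable def eps (L imax : ℕ) : ℝ := 1 / (200 : ℝ) ^ (L + imax + 1)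

/-- `ε' = 1 / 200 ^ (L + imax + 2)`. -/
noncomputable def eps' (L imax : ℕ) : ℝ := 1 / (200 : ℝ) ^ (L + imax + 2)

/-- `ε_i = 100 ^ (i + 1) ε`. -/
noncomputable def epsLevel (L imax i : ℕ) : ℝ := 100 ^ (i + 1) * eps L imax

/-- `n_min = (1000 / ε' ^ 10) ^ (4 ^ (L + 2) / ε' ^ 2)`. -/
noncomputable def nMin (L imax : ℕ) : ℝ :=
  (1000 / eps' L imax ^ 10) ^ ((4 : ℝ) ^ (L + 2) / eps' L imax ^ 2)

/-- The approximation factor `α_L = 2 ^ ((20000 / ε ^ 2) ^ L)`. -/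
def alpha (L imax : ℕ) : ℕ := 2 ^ ((20000 * invEps L imax ^ 2) ^ L)

/-- The expansion rate `c_L = 100 α_{L-1}`. -/
def expansion (L imax : ℕ) : ℕ := 100 * alpha (L - 1) imax

/-- The number `τ_max = 1000 / ε ^ 2` of distance thresholds. -/
def tauMax (L imax : ℕ) : ℕ := 1000 * invEps L imax ^ 2

/-- `β_L = c_L ^ (τ_max + 2)`. -/
def beta (L imax : ℕ) : ℕ := expansion L imax ^ (tauMax L imax + 2)

/-! ### Windows -/

/-- A window: `Sum.inl k` is the `k`-th window of `A`, `Sum.inr j` the `j`-th window of `B`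
(both counted from `0`). -/
abbrev Win : Type := ℕ ⊕ ℕ

/-- What the algorithms know about an instance: the recursion level `L`, the depth `imax`, the
length `n` of the two strings, and the spacing `γ` of the windows of `B`. -/
structure Inst where
  L : ℕ
  imax : ℕ
  n : ℕ
  γ : ℕ

namespace Inst

variable (X : Inst)

/-- The window width `d = √n` (rounded down). -/
def d : ℕ := Nat.sqrt X.n

/-- The number of windows of `A`; they start at `0, d, 2d, …` (strings indexed from `0`). The last
`n % d` characters of `A` (none if `n` is a perfect square) lie in no window. -/
def numA : ℕ := X.n / X.d

/-- The starting position of the `j`-th window of `B`; the starting positions are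
`0, γ, 2γ, …, n - d`. -/
def startB (j : ℕ) : ℕ := min (j * X.γ) (X.n - X.d)

/-- The number `⌈(n - d) / γ⌉ + 1` of windows of `B`. -/
def numB : ℕ := (X.n - X.d + X.γ - 1) / X.γ + 1

/-- The total number of windows. -/
def t : ℕ := X.numA + X.numB

/-- All windows of `A` and of `B`. -/
def windows : List Win :=
  (List.range X.numA).map Sum.inl ++ (List.range X.numB).map Sum.inr

/-- The contents of a window, a string of length `d`. -/
def word {α : Type*} (A B : List α) : Win → List α
  | Sum.inl k => (A.drop (k * X.d)).take X.d
  | Sum.inr j => (B.drop (X.startB j)).take X.d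

/-! ### Mappings between window sets -/

/-- A mapping from the windows of `A` to the windows of `B` together with `⊥ = none`. -/
abbrev Mapping : Type := Fin X.numA → Option (Fin X.numB)

/-- Monotone mappings. -/
def IsMonotone (μ : X.Mapping) : Prop :=
  ∀ k k' j j', k ≤ k' → μ k = some j → μ k' = some j' → X.startB j ≤ X.startB j'

/-- The windows of `B` that are values of `μ`, in the order of the windows of `A` mapped to them. -/
def images (μ : X.Mapping) : List ℕ := (List.ofFn μ).reduceOption.map Fin.val

/-- `|s(b) + d - s(b')|` for two windows `b`, `b'` of `B`. -/
def gap (j j' : ℕ) : ℕ := Nat.dist (X.startB j + X.d) (X.startB j')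

/-- The cost `ED_𝓔(μ)` of a mapping `μ` with respect to an estimate `𝓔` of the distances between
windows: twice the sum of the estimates (`d` for an unmapped window), plus twice the sum of
`|s(μ(a)) + d - s(μ(a.next))|` over consecutive mapped windows `a`, `a.next`. The characters of `A`
that lie in no window count like those of an unmapped window. -/
def mapCost (E : ℕ → ℕ → ℕ) (μ : X.Mapping) : ℕ :=
  2 * (∑ k : Fin X.numA, match μ k with
    | none => X.d
    | some j => E k j) +
  2 * (List.zipWith X.gap (X.images μ) (X.images μ).tail).sum +
  2 * (X.n % X.d)

/-- `ED(𝓔)`: the least cost of a monotone mapping with respect to the estimate `𝓔`. -/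
noncomputable def edOf (E : ℕ → ℕ → ℕ) : ℕ :=
  sInf {c | ∃ μ : X.Mapping, X.IsMonotone μ ∧ X.mapCost E μ = c}

end Inst

/-- The instance on which level `L` works, for strings of length `n` and additive error `Δ`:
the spacing is `γ = max {1, Δ d / n}` (rounded down). -/
noncomputable def inst (imax L n : ℕ) (Δ : ℝ) : Inst :=
  ⟨L, imax, n, max 1 ⌊Δ * (Nat.sqrt n : ℝ) / (n : ℝ)⌋₊⟩

/-! ### Randomized programs with step counting and recursive calls -/

/-- A query to the next lower level of the main algorithm: two windows and an additive error. -/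
structure Query where
  x : Win
  y : Win
  Δ : ℕ

/-- What comes back from a recursive call: the estimate, and (for the record only, programs see
only the estimate) the number of steps and of recursive calls that were spent on it. -/
structure Reply where
  value : ℕ
  steps : ℕ
  queries : ℕ

/-- Randomized programs with result in `α`. `tick k p` performs `k` elementary steps and goes on
with `p`; `draw m f` draws a uniformly random element `j` of `{0, …, m}` and goes on with `f j`;
`call q f` makes the query `q` and goes on with `f v`, where `v` is the estimate returned.
Elementary steps are those of a unit-cost random access machine: an arithmetic operation or a
comparison, a read or a write of an array entry, moving one list entry. Constants that depend only
on `L` and `imax` are part of the program. -/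
inductive Prog (α : Type) : Type
  | ret (a : α) : Prog α
  | tick (k : ℕ) (p : Prog α) : Prog α
  | draw (m : ℕ) (f : Fin (m + 1) → Prog α) : Prog α
  | call (q : Query) (f : ℕ → Prog α) : Prog α

namespace Prog

/-- Sequential composition. -/
def bind {α β : Type} : Prog α → (α → Prog β) → Prog β
  | ret a, g => g a
  | tick k p, g => tick k (bind p g)
  | draw m f, g => draw m (fun j => bind (f j) g)
  | call q f, g => call q (fun v => bind (f v) g)

instance : Monad Prog where
  pure := Prog.ret
  bind := Prog.bind

/-- Spend `k` elementary steps. -/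
def spend (k : ℕ) : Prog Unit := tick k (ret ())

/-- Draw a uniformly random element of `{0, …, m}`. -/
def uniform (m : ℕ) : Prog (Fin (m + 1)) := draw m ret

/-- Make a query to the next lower level of the main algorithm. -/
def ask (q : Query) : Prog ℕ := call q ret

/-- The sublist of those entries of a list that pass a test. -/
def filterList {β : Type} (test : β → Prog Bool) : List β → Prog (List β)
  | [] => pure []
  | x :: xs => do
    let keep ← test x
    let rest ← filterList test xs
    spend 1
    pure (if keep then x :: rest else rest)

end Prog

/-- The hash table of computed window distances, which also records the recursive calls made. -/
abbrev Log : Type := List (Query × Reply)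

/-- The outcome of running a program: its result, the number of its own elementary steps (those
inside the recursive calls are not included), the number of its queries (repeated ones included),
and the table of the recursive calls made. -/
structure Outcome (α : Type) where
  value : α
  steps : ℕ
  queries : ℕ
  log : Log

/-- Add `s` steps and `q` queries to an outcome. -/
def Outcome.add {α : Type} (s q : ℕ) (r : Outcome α) : Outcome α :=
  ⟨r.value, r.steps + s, r.queries + q, r.log⟩

/-- The reply obtained by a caller. -/
def Outcome.reply (r : Outcome ℕ) : Reply := ⟨r.value, r.steps, r.queries⟩

/-- Look up a query in the table, up to exchanging the two windows. -/
def Log.find (l : Log) (q : Query) : Option Reply :=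
  (List.find? (fun e : Query × Reply => decide
    (e.1.Δ = q.Δ ∧ ((e.1.x = q.x ∧ e.1.y = q.y) ∨ (e.1.x = q.y ∧ e.1.y = q.x)))) l).map Prod.snd

/-- The law of the outcome of a program, when new queries are answered at random by `K` (with fresh
randomness for each of them) and queries that were made before get the answer in the table. A draw
and a query count as one step each. -/
noncomputable def exec {α : Type} (K : Query → PMF Reply) : Prog α → Log → PMF (Outcome α)
  | .ret a, l => PMF.pure ⟨a, 0, 0, l⟩
  | .tick k p, l => (exec K p l).map (Outcome.add k 0)
  | .draw m f, l =>
      (PMF.uniformOfFintype (Fin (m + 1))).bind fun j => (exec K (f j) l).map (Outcome.add 1 0)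
  | .call q f, l =>
      match Log.find l q with
      | some r => (exec K (f r.value) l).map (Outcome.add 1 1)
      | none => (K q).bind fun r => (exec K (f r.value) ((q, r) :: l)).map (Outcome.add 1 1)

/-! ### The query algorithm -/

/-- An interval of windows of `A` (`right = false`) or of `B` (`right = true`): the windows with
index at least `lo` and less than `lo + len`, as far as they exist. -/
structure Interval where
  right : Bool
  lo : ℕ
  len : ℕ

/-- Membership in `7 I`, the interval of seven times the length of `I` centered at `I` and
truncated at the ends. -/
def Interval.seven (J : Interval) : Win → Bool
  | Sum.inl k => !J.right && decide (J.lo ≤ k + 3 * J.len ∧ k < J.lo + 4 * J.len)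
  | Sum.inr j => J.right && decide (J.lo ≤ j + 3 * J.len ∧ j < J.lo + 4 * J.len)

namespace Inst

variable (X : Inst)

/-- `t ^ ε`, rounded up to an integer. -/
noncomputable def base : ℕ := ⌈(X.t : ℝ) ^ eps X.L X.imax⌉₊

/-- The density threshold `ρ = t ^ (1 / imax)`. -/
noncomputable def rho : ℝ := (X.t : ℝ) ^ (1 / (X.imax : ℝ))

/-- The list `𝓘` of intervals: for each of the lengths `1, t ^ ε, t ^ (2 ε), …, t`, consecutive
disjoint intervals of this length that cover the windows of `A`, and the same for `B`. -/
noncomputable def intervals : List Interval :=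
  (List.range (invEps X.L X.imax + 1)).flatMap fun e =>
    (List.range ((X.numA + X.base ^ e - 1) / X.base ^ e)).map
        (fun i => ⟨false, i * X.base ^ e, X.base ^ e⟩) ++
    (List.range ((X.numB + X.base ^ e - 1) / X.base ^ e)).map
        (fun i => ⟨true, i * X.base ^ e, X.base ^ e⟩)

/-- `snap ℓ`: the largest power of `t ^ ε` that is at most `ℓ`; `snap 0 = 0`. It is found by
successive multiplications. -/
noncomputable def snap (ℓ : ℕ) : Prog ℕ := do
  Prog.spend (Nat.log X.base ℓ + 1)
  pure (if ℓ = 0 then 0 else X.base ^ Nat.log X.base ℓ)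

/-- `SampleClique`: choose a random live window `x` and a random threshold `τ ∈ {1, …, τ_max}`,
and collect all live windows whose estimated distance from `x` is at most `Δ c_L ^ τ`. -/
noncomputable def sampleClique (live : List Win) (Δ : ℕ) : Prog (List Win) :=
  match live with
  | [] => pure []
  | w :: ws => do
    let j ← Prog.uniform ws.length
    let x := (w :: ws).get j
    let τ ← Prog.uniform (tauMax X.L X.imax - 1)
    Prog.spend (τ + 1)
    Prog.filterList (fun y => do
      let v ← Prog.ask ⟨x, y, Δ⟩
      Prog.spend 1
      pure (decide (v ≤ Δ * expansion X.L X.imax ^ ((τ : ℕ) + 1)))) (w :: ws)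

open scoped Classical in
/-- Is the relative density of the clique `C` on `7 I` at least `ρ`? The windows of `C` and of the
set of live windows that lie in `7 I` are counted one by one. -/
noncomputable def isDense (C live : List Win) (J : Interval) : Prog Bool := do
  Prog.spend (C.length + live.length + 1)
  let cJ ← X.snap (C.countP J.seven)
  let lJ ← X.snap (live.countP J.seven)
  let c ← X.snap C.length
  let l ← X.snap live.length
  Prog.spend 1
  pure (live.any J.seven &&
    decide (X.rho ≤ ((cJ : ℝ) / (lJ : ℝ)) / ((c : ℝ) / (l : ℝ))))

open scoped Classical in
/-- `DenseInterval`: the next set of live windows, that is all live windows in the sets `7 I` on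
which the clique is dense; `none` if the clique is big, that is if its global density exceeds
`ρ⁻¹`. -/
noncomputable def denseInterval (ints : List Interval) (C live : List Win) :
    Prog (Option (List Win)) := do
  let c ← X.snap C.length
  let l ← X.snap live.length
  Prog.spend 1
  if X.rho⁻¹ < (c : ℝ) / (l : ℝ) then pure none
  else do
    let dense ← Prog.filterList (X.isDense C live) ints
    Prog.spend (live.length * (dense.length + 1))
    pure (some (live.filter fun w => dense.any fun J => J.seven w))

/-- `Query`, at depth `imax - r`, with live windows `live` and target distance `Δ`. The result is
the list of the edges found. -/
noncomputable def query (ints : List Interval) (Δ : ℕ) :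
    ℕ → List Win → Prog (List (Win × Win))
  | 0, live =>
      (live.product live).foldlM (fun E p => do
        let v ← Prog.ask ⟨p.1, p.2, Δ⟩
        Prog.spend 1
        pure (if v ≤ Δ * expansion X.L X.imax then p :: E else E)) []
  | r + 1, live =>
      (List.range ⌈(X.t : ℝ) ^ epsLevel X.L X.imax (X.imax - r) * X.rho⌉₊).foldlM (fun E _ => do
        let C ← X.sampleClique live Δ
        let next ← X.denseInterval ints C live
        match next with
        | none => do
          Prog.spend (C.length * C.length + 1)
          pure (C.product C ++ E)
        | some live' => do
          let E' ← query ints Δ r live'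
          Prog.spend (E'.length + 1)
          pure (E' ++ E)) []

/-! ### Aggregating the estimates, and the main algorithm -/

/-- The target distances `γ, 2 γ, 4 γ, …, d` (all `2 ^ k γ` that are less than `d`, and `d`). -/
def thresholds : List ℕ :=
  (List.range (Nat.clog 2 ((X.d + X.γ - 1) / X.γ) + 1)).map fun k => min (2 ^ k * X.γ) X.d

/-- Enter an edge found with target distance `Δ` into the table of estimates. -/
def record (E : ℕ → ℕ → ℕ) (Δ : ℕ) : Win × Win → ℕ → ℕ → ℕ
  | (Sum.inl k, Sum.inr j) =>
      Function.update E k (Function.update (E k) j (min (E k j) (beta X.L X.imax * Δ)))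
  | _ => E

/-- `AggregateEstimates`: compute an estimate of the distances between the windows of `A` and
those of `B`. -/
noncomputable def aggregateEstimates (ints : List Interval) : Prog (ℕ → ℕ → ℕ) := do
  Prog.spend (X.numA * X.numB)
  X.thresholds.foldlM (fun E Δ => do
    Prog.spend 1
    let edges ← X.query ints Δ X.imax X.windows
    edges.foldlM (fun E p => do
      Prog.spend 1
      pure (X.record E Δ p)) E) (fun _ _ => X.d)

/-- One row of `EDfromEstimates`. `F j` is the least cost of a monotone mapping of the first `k`
windows of `A` whose last mapped window goes to the `j`-th window of `B` (`⊤` if there is none);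
the new row is the same for `k + 1`. When the row is processed from left to right, `far` is the
least cost with the preceding mapped window more than `s` places to the left of `j`, so that there
is no overlap; the `s + 1` other places are inspected one by one. -/
noncomputable def rowStep (E : ℕ → ℕ → ℕ) (F : ℕ → ℕ∞) (k : ℕ) : Prog (ℕ → ℕ∞) := do
  let s := X.d / X.γ + 1
  let res ← (List.range X.numB).foldlM (fun (st : ℕ∞ × (ℕ → ℕ∞)) j => do
    Prog.spend (s + 2)
    let far : ℕ∞ := if s < j then
        min (st.1 + ((2 * (X.startB j - X.startB (j - 1)) : ℕ) : ℕ∞))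
          (F (j - s - 1) + ((2 * X.gap (j - s - 1) j : ℕ) : ℕ∞))
      else ⊤
    let near : ℕ∞ := ((List.range (s + 1)).filter (fun h => decide (h ≤ j))).foldl
      (fun m h => min m (F (j - h) + ((2 * X.gap (j - h) j : ℕ) : ℕ∞))) ⊤
    let v : ℕ∞ := min (F j + ((2 * X.d : ℕ) : ℕ∞))
      (((2 * E k j : ℕ) : ℕ∞) + min ((2 * X.d * k : ℕ) : ℕ∞) (min far near))
    pure (far, Function.update st.2 j v)) (⊤, fun _ => ⊤)
  pure res.2

/-- `EDfromEstimates`: compute `ED(𝓔)` by dynamic programming. -/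
noncomputable def edFromEstimates (E : ℕ → ℕ → ℕ) : Prog ℕ := do
  Prog.spend X.numB
  let F ← (List.range X.numA).foldlM (fun F k => X.rowStep E F k) (fun _ => ⊤)
  Prog.spend (X.numB + 1)
  let m : ℕ∞ := (List.range X.numB).foldl (fun m j => min m (F j))
    ((2 * X.d * X.numA : ℕ) : ℕ∞)
  pure (m.toNat + 2 * (X.n % X.d))

/-- One level `L ≥ 1` of `Main`: set up the windows and the intervals, aggregate the estimates, and
return the distance computed from them. -/
noncomputable def mainProg : Prog ℕ := do
  Prog.spend X.t
  Prog.spend X.intervals.length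
  let E ← X.aggregateEstimates X.intervals
  X.edFromEstimates E

end Inst

section Main

variable {α : Type*} [DecidableEq α]

/-- The distances of the suffixes of a string from the empty string. -/
def firstRow : List α → List ℕ
  | [] => [0]
  | _ :: bs => (bs.length + 1) :: firstRow bs

/-- From the list of the distances of a string `u` from all suffixes of `B` to the list of those
of `a u`. -/
def nextRow (a : α) : List α → List ℕ → Prog (List ℕ)
  | [], old => do
    Prog.spend 1
    pure [old.headD 0 + 1]
  | b :: bs, old => do
    let new ← nextRow a bs old.tail
    Prog.spend 1
    pure (min (min (old.headD 0 + 1) (new.headD 0 + 1))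
      (old.tail.headD 0 + if a = b then 0 else 1) :: new)

/-- The table rows of the quadratic dynamic program for the edit distance. -/
def editRows (B : List α) : List α → Prog (List ℕ)
  | [] => do
    Prog.spend (B.length + 1)
    pure (firstRow B)
  | a :: as => do
    let row ← editRows B as
    nextRow a B row

/-- The quadratic dynamic program for the edit distance. -/
def editProg (A B : List α) : Prog ℕ := do
  let row ← editRows B A
  Prog.spend 1
  pure (row.headD 0)

/-- The law of the outcome of `Main(A, B, Δ, L)`: level `0` runs the quadratic algorithm, level
`L + 1` runs its program, whose queries are answered by independent runs of level `L`. -/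
noncomputable def mainAlg (imax : ℕ) : ℕ → List α → List α → ℝ → PMF (Outcome ℕ)
  | 0, A, B, _ => exec (fun _ => PMF.pure ⟨0, 0, 0⟩) (editProg A B) []
  | L + 1, A, B, Δ =>
      let X := inst imax (L + 1) A.length Δ
      exec (fun q => (mainAlg imax L (X.word A B q.x) (X.word A B q.y) (q.Δ : ℝ)).map Outcome.reply)
        X.mainProg []

end Main

/-- A recursive call of level `L` succeeds: the estimate returned lies in
`[ED(x, y), α_{L-1} (ED(x, y) + Δ)]`. -/
def Inst.CallSucceeds (X : Inst) {α : Type*} (A B : List α) (e : Query × Reply) : Prop :=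
  editDist (X.word A B e.1.x) (X.word A B e.1.y) ≤ e.2.value ∧
  e.2.value ≤ alpha (X.L - 1) X.imax *
    (editDist (X.word A B e.1.x) (X.word A B e.1.y) + e.1.Δ)

/-- The bounds on the work of level `L` on strings of length `n`, recursive calls not included: at
most `n ^ (1/2 + 2/imax)` queries and `n ^ (1 + 2/imax)` steps. -/
def RunsEfficiently (imax n steps queries : ℕ) : Prop :=
  (queries : ℝ) ≤ (n : ℝ) ^ (1 / 2 + 2 / (imax : ℝ)) ∧
  (steps : ℝ) ≤ (n : ℝ) ^ (1 + 2 / (imax : ℝ))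

end EditApprox

/-!
**Determinism and randomness.** A program is a tree, and both its cost and its result are analysed
on the tree, apart from the law of the answers. `Prog.Runs` bounds the steps and queries for all
draws and all answers, and `Prog.worst` is the expectation against an adversary who picks any answer
that a successful call may give. The adversary dominates every law of the answers on the event
that all calls succeed (`mean_exec_le_worst`), so that the arbitrary laws and the recursion need no
separate analysis.

**What has to be found.** An optimal alignment cuts `B` into pieces aligned to the windows of `A`.
Rounding the pieces to windows of `B` gives a strictly monotone partial matching between close
windows (`Inst.nonempty_matching`), and `ED(𝓔)` is small as soon as the estimates along the
matching are (`Inst.edOf_le_of_matching`). Conversely a mapping describes a way of transforming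
`A` into `B`, so that `ED(𝓔)` is never too small (`Inst.editDist_le_edOf`). Hence it suffices that
for each target distance `D` the query misses few edges of the matching of length at most `D`; each
edge missed costs at most `d`.

**Why a query finds them.** Fix live windows and an element of the matching. The balls of radius
`D c_L ^ τ` around its window in `A` grow with `τ`. Every count of live windows that the algorithm
makes is rounded to a power of `b`, so by pigeonhole some radius is stable: the counts for `τ` and
for `τ + 2` agree (`Inst.exists_stable_radius`). A clique sampled at `τ + 1` from a center in
the stable ball is squeezed between these two balls, hence passes the same density tests. If the
ball is big, its at least `N / (ρ b)` elements, where `N` is the number of live windows, are centers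
that find the edge. Otherwise take for both windows of the edge the longest interval on which the
ball is dense; on the parent interval it is not. The other elements of the matching with the
same radius, scales and ball size in the same two intervals are companions: a center in the ball of
a companion keeps alive both windows of the edge. Few companions contain a given center in their
balls, by the sparsity on the parent interval, so many companions provide many centers. And few
elements have few companions: the pairs of intervals form a staircase, since the matching is
monotone (`card_sparse_cells_le`). So up to few exceptions every element is hit by a sample with
probability `1 / ρ`, up to powers of `t ^ ε` (`Inst.exists_few_exceptions`). The number of rounds
grows so fast with the depth that what one depth misses is negligible at the depth above it
(`Inst.worst_query_le`), and independent blocks of rounds at depth `0` amplify the probability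
(`Inst.worst_query_windows_le`).

**Running time.** Dense intervals hold few live windows: from one depth to the next the number of
live windows shrinks by a factor of almost `ρ`, which pays for the `ρ` recursive calls
(`Inst.runs_query`). All other factors are powers of `t ^ ε`, for which the exponent `2 / imax` has
room.

**Recursion.** A call fails with probability at most `exp (-size ^ 16)`, by induction on the level,
and the union bound over the calls (`mean_exec_bad_call_le`) leaves a failure probability below
`exp (-t ^ (ε' / 2))`.
-/

namespace EditApprox

/-! ### Expectations, adversarial semantics and budgets of programs -/

/-- The expectation of a `ℝ≥0∞`-valued function under a probability mass function. -/
noncomputable def mean {β : Type*} (p : PMF β) (φ : β → ℝ≥0∞) : ℝ≥0∞ := ∑' b, p b * φ b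

section Mean

variable {β γ : Type*}

lemma mean_pure (b : β) (φ : β → ℝ≥0∞) : mean (PMF.pure b) φ = φ b := by
  unfold mean
  rw [tsum_eq_single b]
  · simp
  · intro c hc; simp [PMF.pure_apply, hc]

lemma mean_bind (p : PMF β) (f : β → PMF γ) (φ : γ → ℝ≥0∞) :
    mean (p.bind f) φ = mean p fun b => mean (f b) φ := by
  unfold mean
  simp_rw [PMF.bind_apply, ← ENNReal.tsum_mul_right, ← ENNReal.tsum_mul_left]
  rw [ENNReal.tsum_comm]
  simp_rw [mul_assoc]

lemma mean_map (p : PMF β) (f : β → γ) (φ : γ → ℝ≥0∞) :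
    mean (p.map f) φ = mean p (φ ∘ f) := by
  rw [PMF.map, mean_bind]
  congr 1; funext b; simp [mean_pure]

lemma mean_mono (p : PMF β) {φ ψ : β → ℝ≥0∞} (h : ∀ b ∈ p.support, φ b ≤ ψ b) :
    mean p φ ≤ mean p ψ := by
  refine ENNReal.tsum_le_tsum fun b => ?_
  by_cases hb : p b = 0
  · simp [hb]
  · exact mul_le_mul_right (h b (by simpa [PMF.mem_support_iff] using hb)) _

lemma mean_add (p : PMF β) (φ ψ : β → ℝ≥0∞) :
    mean p (fun b => φ b + ψ b) = mean p φ + mean p ψ := by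
  unfold mean
  simp_rw [mul_add]
  exact ENNReal.tsum_add

lemma mean_const (p : PMF β) (c : ℝ≥0∞) : mean p (fun _ => c) = c := by
  unfold mean
  rw [ENNReal.tsum_mul_right, p.tsum_coe, one_mul]

lemma mean_uniform (m : ℕ) (φ : Fin (m + 1) → ℝ≥0∞) :
    mean (PMF.uniformOfFintype (Fin (m + 1))) φ = (∑ j, φ j) / ((m : ℝ≥0∞) + 1) := by
  unfold mean
  rw [tsum_fintype]
  simp only [PMF.uniformOfFintype_apply, Fintype.card_fin]
  rw [← Finset.mul_sum, ENNReal.div_eq_inv_mul]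
  push_cast; rfl

open scoped Classical in
lemma toOuterMeasure_eq_mean (p : PMF β) (s : Set β) :
    p.toOuterMeasure s = mean p (fun b => if b ∈ s then 1 else 0) := by
  unfold mean
  rw [PMF.toOuterMeasure_apply]
  congr 1; funext b
  by_cases hb : b ∈ s <;> simp [hb]

open scoped Classical in
/-- To bound the probability of an event from below, bound its complement from above. -/
lemma le_toOuterMeasure (p : PMF β) (s : Set β) (x : ℝ) (hx : 0 ≤ x)
    (h : mean p (fun b => if b ∈ s then 0 else 1) ≤ ENNReal.ofReal x) :
    ENNReal.ofReal (1 - x) ≤ p.toOuterMeasure s := by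
  rw [toOuterMeasure_eq_mean]
  have h1 : mean p (fun b => if b ∈ s then (1 : ℝ≥0∞) else 0) +
      mean p (fun b => if b ∈ s then (0 : ℝ≥0∞) else 1) = 1 := by
    rw [← mean_add]
    refine Eq.trans ?_ (mean_const p 1)
    congr 1; funext b; by_cases hb : b ∈ s <;> simp [hb]
  rw [ENNReal.ofReal_sub _ hx, ENNReal.ofReal_one]
  refine tsub_le_iff_right.2 ?_
  calc (1 : ℝ≥0∞) = _ := h1.symm
    _ ≤ _ := by gcongr

end Mean

namespace Prog

variable {β γ : Type}

@[simp] lemma bind_eq (p : Prog β) (g : β → Prog γ) : p >>= g = p.bind g := rfl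
@[simp] lemma pure_eq (b : β) : (pure b : Prog β) = ret b := rfl

/-! #### Adversarial semantics -/

/-- The expectation of `φ` when every call is answered by an adversary, who may use any answer
that is allowed by `ok`, and who knows the history of the run but not the draws to come. -/
noncomputable def worst (ok : Query → ℕ → Prop) (φ : β → ℝ≥0∞) : Prog β → ℝ≥0∞
  | ret a => φ a
  | tick _ p => worst ok φ p
  | draw m f => (∑ j, worst ok φ (f j)) / ((m : ℝ≥0∞) + 1)
  | call q f => ⨆ v, ⨆ _ : ok q v, worst ok φ (f v)

/-- `Yields ok Q p`: every result of `p`, for all draws and all answers allowed by `ok`,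
satisfies `Q`. -/
def Yields (ok : Query → ℕ → Prop) (Q : β → Prop) : Prog β → Prop
  | ret a => Q a
  | tick _ p => Yields ok Q p
  | draw _ f => ∀ j, Yields ok Q (f j)
  | call q f => ∀ v, ok q v → Yields ok Q (f v)

/-- `Runs P Q p s q`: whatever the draws and the answers are, `p` performs at most `s` steps and
makes at most `q` queries, all of which satisfy `P`, and its result satisfies `Q`. -/
def Runs (P : Query → Prop) (Q : β → Prop) : Prog β → ℝ → ℝ → Prop
  | ret a, s, q => 0 ≤ s ∧ 0 ≤ q ∧ Q a
  | tick k p, s, q => Runs P Q p (s - k) q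
  | draw _ f, s, q => ∀ j, Runs P Q (f j) (s - 1) q
  | call x f, s, q => P x ∧ ∀ v, Runs P Q (f v) (s - 1) (q - 1)

variable {ok : Query → ℕ → Prop} {P : Query → Prop}

@[simp] lemma worst_ret (φ : β → ℝ≥0∞) (a : β) : worst ok φ (ret a) = φ a := rfl
@[simp] lemma worst_spend (φ : Unit → ℝ≥0∞) (k : ℕ) : worst ok φ (spend k) = φ () := rfl

lemma worst_bind (φ : γ → ℝ≥0∞) (p : Prog β) (g : β → Prog γ) :
    worst ok φ (p.bind g) = worst ok (fun b => worst ok φ (g b)) p := by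
  induction p with
  | ret a => rfl
  | tick k p ih => exact ih
  | draw m f ih => simp only [bind, worst, ih]
  | call q f ih => simp only [bind, worst, ih]

lemma worst_mono_of_yields {Q : β → Prop} {φ ψ : β → ℝ≥0∞} (h : ∀ b, Q b → φ b ≤ ψ b)
    (p : Prog β) (hp : Yields ok Q p) : worst ok φ p ≤ worst ok ψ p := by
  induction p with
  | ret a => exact h a hp
  | tick k p ih => exact ih hp
  | draw m f ih =>
    simp only [worst]
    exact ENNReal.div_le_div_right (Finset.sum_le_sum fun j _ => ih j (hp j)) _
  | call q f ih =>
    simp only [worst]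
    exact iSup_mono fun v => iSup_mono fun hv => ih v (hp v hv)

lemma yields_true (p : Prog β) : Yields ok (fun _ => True) p := by
  induction p with
  | ret a => trivial
  | tick k p ih => exact ih
  | draw m f ih => exact ih
  | call q f ih => exact fun v _ => ih v

lemma worst_mono {φ ψ : β → ℝ≥0∞} (h : ∀ b, φ b ≤ ψ b) (p : Prog β) :
    worst ok φ p ≤ worst ok ψ p :=
  worst_mono_of_yields (fun b _ => h b) p (yields_true p)

lemma worst_const_le (p : Prog β) (c : ℝ≥0∞) : worst ok (fun _ => c) p ≤ c := by
  induction p with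
  | ret a => exact le_rfl
  | tick k p ih => exact ih
  | draw m f ih =>
    simp only [worst]
    refine ENNReal.div_le_of_le_mul ?_
    calc _ ≤ ∑ _j : Fin (m + 1), c := Finset.sum_le_sum fun j _ => ih j
      _ = _ := by simp [mul_comm]
  | call q f ih => exact iSup_le fun v => iSup_le fun _ => ih v

/-- A bound that holds for every possible result bounds the expectation. -/
lemma worst_le_of_yields {Q : β → Prop} {φ : β → ℝ≥0∞} {c : ℝ≥0∞} (h : ∀ b, Q b → φ b ≤ c)
    {p : Prog β} (hp : Yields ok Q p) : worst ok φ p ≤ c :=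
  (worst_mono_of_yields h p hp).trans (worst_const_le p c)

lemma worst_add_le (φ ψ : β → ℝ≥0∞) (p : Prog β) :
    worst ok (fun b => φ b + ψ b) p ≤ worst ok φ p + worst ok ψ p := by
  induction p with
  | ret a => exact le_rfl
  | tick k p ih => exact ih
  | draw m f ih =>
    simp only [worst]
    rw [← ENNReal.add_div, ← Finset.sum_add_distrib]
    exact ENNReal.div_le_div_right (Finset.sum_le_sum fun j _ => ih j) _
  | call q f ih =>
    simp only [worst]
    refine iSup_le fun v => iSup_le fun hv => (ih v).trans ?_
    gcongr
    · exact le_iSup₂_of_le v hv le_rfl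
    · exact le_iSup₂_of_le v hv le_rfl

lemma worst_const_mul_le (c : ℝ≥0∞) (φ : β → ℝ≥0∞) (p : Prog β) :
    worst ok (fun b => c * φ b) p ≤ c * worst ok φ p := by
  induction p with
  | ret a => exact le_rfl
  | tick k p ih => exact ih
  | draw m f ih =>
    simp only [worst]
    rw [← mul_div_assoc, Finset.mul_sum]
    exact ENNReal.div_le_div_right (Finset.sum_le_sum fun j _ => ih j) _
  | call q f ih =>
    simp only [worst]
    refine iSup_le fun v => iSup_le fun hv => (ih v).trans ?_
    gcongr
    exact le_iSup₂_of_le v hv le_rfl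

lemma worst_sum_le {ι : Type*} (s : Finset ι) (φ : ι → β → ℝ≥0∞) (p : Prog β) :
    worst ok (fun b => ∑ i ∈ s, φ i b) p ≤ ∑ i ∈ s, worst ok (φ i) p := by
  classical
  induction s using Finset.induction_on with
  | empty => simpa using worst_const_le p 0
  | insert i s hi ih =>
    simp only [Finset.sum_insert hi]
    exact (worst_add_le _ _ p).trans (by gcongr)

/-! #### Results -/

lemma Yields.mono {Q Q' : β → Prop} (h : ∀ b, Q b → Q' b) {p : Prog β} (hp : Yields ok Q p) :
    Yields ok Q' p := by
  induction p with
  | ret a => exact h a hp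
  | tick k p ih => exact ih hp
  | draw m f ih => exact fun j => ih j (hp j)
  | call q f ih => exact fun v hv => ih v (hp v hv)

lemma Yields.bind {Q : β → Prop} {Q' : γ → Prop} {p : Prog β} {g : β → Prog γ}
    (hp : Yields ok Q p) (hg : ∀ b, Q b → Yields ok Q' (g b)) : Yields ok Q' (p.bind g) := by
  induction p with
  | ret a => exact hg a hp
  | tick k p ih => exact ih hp
  | draw m f ih => exact fun j => ih j (hp j)
  | call q f ih => exact fun v hv => ih v (hp v hv)

lemma Yields.foldlM {σ ι : Type} {I : σ → Prop} {f : σ → ι → Prog σ} (l : List ι)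
    (h : ∀ s, ∀ x ∈ l, I s → Yields ok I (f s x)) (s : σ) (hs : I s) :
    Yields ok I (l.foldlM f s) := by
  induction l generalizing s with
  | nil => exact hs
  | cons x l ih =>
    rw [List.foldlM_cons]
    exact (h s x (by simp) hs).bind fun s' hs' =>
      ih (fun s y hy => h s y (List.mem_cons_of_mem _ hy)) s' hs'

/-- Filtering with a test whose positive answers imply `A` and which accepts everything that
satisfies `B`. -/
lemma Yields.filterList {test : β → Prog Bool} {A B : β → Prop} (l : List β)
    (h : ∀ x ∈ l, Yields ok (fun r => (r = true → A x) ∧ (B x → r = true)) (test x)) :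
    Yields ok (fun r => r.Sublist l ∧ (∀ x ∈ r, A x) ∧ ∀ x ∈ l, B x → x ∈ r)
      (filterList test l) := by
  induction l with
  | nil => simp [Prog.filterList, Yields]
  | cons x l ih =>
    rw [Prog.filterList]
    refine (h x (by simp)).bind fun keep hk => ?_
    refine (ih fun y hy => h y (List.mem_cons_of_mem _ hy)).bind fun rest hr => ?_
    change Yields ok _ (ret _)
    obtain ⟨h1, h2, h3⟩ := hr
    cases keep with
    | true =>
      refine ⟨h1.cons_cons x, ?_, ?_⟩
      · simpa using ⟨hk.1 rfl, h2⟩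
      · intro y hy hB
        rcases List.mem_cons.1 hy with rfl | hy
        · simp
        · simp [h3 y hy hB]
    | false =>
      refine ⟨h1.cons x, by simpa using h2, ?_⟩
      intro y hy hB
      rcases List.mem_cons.1 hy with rfl | hy
      · simpa using hk.2 hB
      · simp [h3 y hy hB]

/-! #### Budgets -/

lemma Runs.nonneg {Q : β → Prop} {p : Prog β} {s q : ℝ} (h : Runs P Q p s q) :
    0 ≤ s ∧ 0 ≤ q := by
  induction p generalizing s q with
  | ret a => exact ⟨h.1, h.2.1⟩
  | tick k p ih =>
    have := ih h
    have hk : (0 : ℝ) ≤ k := k.cast_nonneg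
    exact ⟨by linarith, this.2⟩
  | draw m f ih => have := ih 0 (h 0); exact ⟨by linarith, this.2⟩
  | call x f ih => have := ih 0 (h.2 0); exact ⟨by linarith, by linarith⟩

lemma Runs.mono {Q Q' : β → Prop} {p : Prog β} {s q s' q' : ℝ} (h : Runs P Q p s q)
    (hQ : ∀ b, Q b → Q' b) (hs : s ≤ s') (hq : q ≤ q') : Runs P Q' p s' q' := by
  induction p generalizing s q s' q' with
  | ret a => exact ⟨h.1.trans hs, h.2.1.trans hq, hQ a h.2.2⟩
  | tick k p ih => exact ih h (by linarith) hq
  | draw m f ih => exact fun j => ih j (h j) (by linarith) hq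
  | call x f ih => exact ⟨h.1, fun v => ih v (h.2 v) (by linarith) (by linarith)⟩

lemma Runs.bind {Q : β → Prop} {Q' : γ → Prop} {p : Prog β} {g : β → Prog γ} {s q s' q' : ℝ}
    (hp : Runs P Q p s q) (hg : ∀ b, Q b → Runs P Q' (g b) s' q') :
    Runs P Q' (p.bind g) (s + s') (q + q') := by
  induction p generalizing s q with
  | ret a => exact (hg a hp.2.2).mono (fun _ h => h) (by linarith [hp.1]) (by linarith [hp.2.1])
  | tick k p ih => exact (ih hp).mono (fun _ h => h) (by linarith) le_rfl
  | draw m f ih => exact fun j => (ih j (hp j)).mono (fun _ h => h) (by linarith) le_rfl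
  | call x f ih =>
    exact ⟨hp.1, fun v => (ih v (hp.2 v)).mono (fun _ h => h) (by linarith) (by linarith)⟩

lemma Runs.ret {Q : β → Prop} {b : β} (h : Q b) : Runs P Q (ret b) 0 0 := ⟨le_rfl, le_rfl, h⟩

lemma Runs.spend (k : ℕ) : Runs P (fun _ => True) (spend k) k 0 :=
  ⟨by simp, le_rfl, trivial⟩

lemma Runs.uniform (m : ℕ) : Runs P (fun _ => True) (uniform m) 1 0 :=
  fun _ => ⟨by simp, le_rfl, trivial⟩

lemma Runs.ask {x : Query} (hx : P x) : Runs P (fun _ => True) (ask x) 1 1 :=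
  ⟨hx, fun _ => ⟨by simp, by simp, trivial⟩⟩

/-- Budgets of a loop: `I i` is the invariant after `i` rounds. -/
lemma Runs.foldlM {σ ι : Type} {f : σ → ι → Prog σ} {a c : ℝ} (l : List ι) (I : ℕ → σ → Prop)
    (h : ∀ i (hi : i < l.length) s, I i s → Runs P (I (i + 1)) (f s l[i]) a c)
    (s : σ) (hs : I 0 s) :
    Runs P (I l.length) (l.foldlM f s) (l.length * a) (l.length * c) := by
  induction l generalizing s I with
  | nil => simpa using Runs.ret hs
  | cons x l ih =>
    rw [List.foldlM_cons]
    have h1 := h 0 (by simp) s hs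
    have h2 := fun s' (hs' : I 1 s') => ih (fun i => I (i + 1))
      (fun i hi s hs => h (i + 1) (Nat.succ_lt_succ hi) s hs) s' hs'
    refine (h1.bind h2).mono (fun _ h => h) ?_ ?_ <;> simp <;> linarith

lemma Runs.filterList {test : β → Prog Bool} {a c : ℝ} (l : List β)
    (h : ∀ x ∈ l, Runs P (fun _ => True) (test x) a c) :
    Runs P (fun r => r.Sublist l) (filterList test l) (l.length * (a + 1)) (l.length * c) := by
  induction l with
  | nil =>
    exact (Runs.ret (Q := fun r : List β => r.Sublist []) (List.Sublist.refl [])).mono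
      (fun _ h => h) (by simp) (by simp)
  | cons x l ih =>
    rw [Prog.filterList]
    have h2 := ih fun y hy => h y (List.mem_cons_of_mem _ hy)
    refine ((h x (by simp)).bind fun keep _ => h2.bind fun rest hr =>
      (Runs.spend 1).bind (Q' := fun r : List β => r.Sublist (x :: l)) (s' := 0) (q' := 0)
        fun _ _ =>
        Runs.ret ?_).mono (fun _ h => h) ?_ ?_
    · cases keep
      · exact hr.cons x
      · exact hr.cons_cons x
    · simp; linarith
    · simp; linarith

end Prog

/-! ### From executions to the adversarial semantics and to budgets -/

section Exec

variable {β : Type}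

lemma exec_log_extends (K : Query → PMF Reply) (p : Prog β) (l : Log) (r : Outcome β)
    (hr : r ∈ (exec K p l).support) : ∃ l', r.log = l' ++ l := by
  induction p generalizing l r with
  | ret a =>
    simp only [exec, PMF.mem_support_pure_iff] at hr
    exact ⟨[], by simp [hr]⟩
  | tick k p ih =>
    simp only [exec, PMF.mem_support_map_iff] at hr
    obtain ⟨r', h1, rfl⟩ := hr
    exact ih l r' h1
  | draw m f ih =>
    simp only [exec, PMF.mem_support_bind_iff, PMF.mem_support_map_iff] at hr
    obtain ⟨j, -, r', h1, rfl⟩ := hr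
    exact ih j l r' h1
  | call q f ih =>
    rw [exec] at hr
    split at hr
    · simp only [PMF.mem_support_map_iff] at hr
      obtain ⟨r', h1, rfl⟩ := hr
      exact ih _ l r' h1
    · simp only [PMF.mem_support_bind_iff, PMF.mem_support_map_iff] at hr
      obtain ⟨e, -, r', h1, rfl⟩ := hr
      obtain ⟨l', hl'⟩ := ih _ _ r' h1
      exact ⟨l' ++ [(q, e)], by simpa [Outcome.add] using hl'⟩

/-- The same query, up to exchanging the two windows. -/
def Query.Same (q q' : Query) : Prop :=
  q'.Δ = q.Δ ∧ ((q'.x = q.x ∧ q'.y = q.y) ∨ (q'.x = q.y ∧ q'.y = q.x))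

lemma Log.find_eq_some {l : Log} {q : Query} {r : Reply} (h : Log.find l q = some r) :
    ∃ e ∈ l, e.2 = r ∧ Query.Same q e.1 := by
  unfold Log.find at h
  rw [Option.map_eq_some_iff] at h
  obtain ⟨e, he, rfl⟩ := h
  exact ⟨e, List.mem_of_find?_eq_some he, rfl, by simpa [Query.Same] using List.find?_some he⟩

open scoped Classical in
/-- The adversary is at least as bad as answers drawn at random, on the event that all calls
made are allowed. -/
lemma mean_exec_le_worst {ok : Query → ℕ → Prop} {good : Query × Reply → Prop}
    (hgood : ∀ e, good e → ∀ q, Query.Same q e.1 → ok q e.2.value)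
    (K : Query → PMF Reply) (φ : β → ℝ≥0∞) (p : Prog β) (l : Log) :
    mean (exec K p l) (fun r => if ∀ e ∈ r.log, good e then φ r.value else 0) ≤
      p.worst ok φ := by
  induction p generalizing l with
  | ret a =>
    simp only [exec, mean_pure, Prog.worst]
    split_ifs <;> simp
  | tick k p ih =>
    simp only [exec, mean_map, Prog.worst]
    exact ih l
  | draw m f ih =>
    simp only [exec, mean_bind, mean_map, Prog.worst, mean_uniform]
    exact ENNReal.div_le_div_right (Finset.sum_le_sum fun j _ => ih j l) _
  | call q f ih =>
    have key : ∀ (v : Reply) (l' : Log) (e : Query × Reply), e ∈ l' → e.2 = v →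
        Query.Same q e.1 →
        mean (exec K (f v.value) l') (fun r => if ∀ e ∈ r.log, good e then φ r.value else 0) ≤
          (Prog.call q f).worst ok φ := by
      intro v l' e he hv hs
      by_cases hg : good e
      · refine (ih v.value l').trans ?_
        simp only [Prog.worst]
        exact le_iSup₂_of_le v.value (hv ▸ hgood e hg q hs) le_rfl
      · refine (mean_mono _ (ψ := fun _ => 0) fun r hr => ?_).trans
          ((mean_const _ _).le.trans zero_le)
        obtain ⟨l'', hl''⟩ := exec_log_extends K _ _ r hr
        rw [if_neg]
        intro hall
        exact hg (hall e (by rw [hl'']; simp [he]))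
    rw [exec]
    split
    · rename_i v hv
      rw [mean_map]
      obtain ⟨e, he, h1, h2⟩ := Log.find_eq_some hv
      exact key v l e he h1 h2
    · rw [mean_bind]
      refine (mean_mono _ (ψ := fun _ => (Prog.call q f).worst ok φ) fun v _ => ?_).trans
        (mean_const _ _).le
      rw [mean_map]
      exact key v ((q, v) :: l) (q, v) (by simp) rfl ⟨rfl, Or.inl ⟨rfl, rfl⟩⟩

lemma exec_of_runs {P : Query → Prop} {Q : β → Prop} (K : Query → PMF Reply) (p : Prog β)
    {s q : ℝ} (h : p.Runs P Q s q) (l : Log) (r : Outcome β) (hr : r ∈ (exec K p l).support) :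
    (r.steps : ℝ) ≤ s ∧ (r.queries : ℝ) ≤ q ∧ Q r.value ∧
      ∀ e ∈ r.log, e ∈ l ∨ P e.1 ∧ e.2 ∈ (K e.1).support := by
  induction p generalizing l r s q with
  | ret a =>
    simp only [exec, PMF.mem_support_pure_iff] at hr
    subst hr
    exact ⟨by simpa using h.1, by simpa using h.2.1, h.2.2, fun e he => Or.inl he⟩
  | tick k p ih =>
    simp only [exec, PMF.mem_support_map_iff] at hr
    obtain ⟨r', h1, rfl⟩ := hr
    obtain ⟨a, b, c, d⟩ := ih h l r' h1
    refine ⟨?_, by simpa [Outcome.add] using b, c, d⟩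
    simp only [Outcome.add]; push_cast; linarith
  | draw m f ih =>
    simp only [exec, PMF.mem_support_bind_iff, PMF.mem_support_map_iff] at hr
    obtain ⟨j, -, r', h1, rfl⟩ := hr
    obtain ⟨a, b, c, d⟩ := ih j (h j) l r' h1
    refine ⟨?_, by simpa [Outcome.add] using b, c, d⟩
    simp only [Outcome.add]; push_cast; linarith
  | call x f ih =>
    rw [exec] at hr
    split at hr
    · simp only [PMF.mem_support_map_iff] at hr
      obtain ⟨r', h1, rfl⟩ := hr
      obtain ⟨a, b, c, d⟩ := ih _ (h.2 _) l r' h1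
      refine ⟨?_, ?_, c, d⟩ <;> simp only [Outcome.add] <;> push_cast <;> linarith
    · simp only [PMF.mem_support_bind_iff, PMF.mem_support_map_iff] at hr
      obtain ⟨e, he, r', h1, rfl⟩ := hr
      obtain ⟨a, b, c, d⟩ := ih _ (h.2 _) _ r' h1
      refine ⟨?_, ?_, c, ?_⟩
      · simp only [Outcome.add]; push_cast; linarith
      · simp only [Outcome.add]; push_cast; linarith
      · intro e' he'
        rcases d e' he' with h2 | h2
        · rcases List.mem_cons.1 h2 with rfl | h2
          · exact Or.inr ⟨h.1, he⟩
          · exact Or.inl h2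
        · exact Or.inr h2

open scoped Classical in
/-- Union bound over the recursive calls that a program makes. -/
lemma mean_exec_bad_call_le {P : Query → Prop} {Q : β → Prop} (K : Query → PMF Reply)
    (good : Query × Reply → Prop) (δ : ℝ) (hδ : 0 ≤ δ)
    (hK : ∀ q, P q → mean (K q) (fun r => if good (q, r) then 0 else 1) ≤ ENNReal.ofReal δ)
    (p : Prog β) {s q : ℝ} (h : p.Runs P Q s q) (l : Log) (hl : ∀ e ∈ l, good e) :
    mean (exec K p l) (fun r => if ∀ e ∈ r.log, good e then 0 else 1) ≤
      ENNReal.ofReal (q * δ) := by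
  induction p generalizing l s q with
  | ret a => simp only [exec, mean_pure]; rw [if_pos hl]; exact zero_le
  | tick k p ih => simp only [exec, mean_map]; exact ih h l hl
  | draw m f ih =>
    simp only [exec, mean_bind, mean_map]
    exact (mean_mono _ (ψ := fun _ => ENNReal.ofReal (q * δ))
      fun j _ => ih j (h j) l hl).trans (mean_const _ _).le
  | call x f ih =>
    have hq1 : (0 : ℝ) ≤ q - 1 := (h.2 0).nonneg.2
    rw [exec]
    split
    · rw [mean_map]
      refine (ih _ (h.2 _) l hl).trans (ENNReal.ofReal_le_ofReal ?_)
      nlinarith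
    · rw [mean_bind]
      have : ∀ v ∈ (K x).support,
          mean ((exec K (f v.value) ((x, v) :: l)).map (Outcome.add 1 1))
            (fun r => if ∀ e ∈ r.log, good e then (0 : ℝ≥0∞) else 1) ≤
          (if good (x, v) then 0 else 1) + ENNReal.ofReal ((q - 1) * δ) := by
        intro v _
        rw [mean_map]
        by_cases hg : good (x, v)
        · rw [if_pos hg, zero_add]
          refine ih _ (h.2 _) _ ?_
          intro e he
          rcases List.mem_cons.1 he with rfl | he
          · exact hg
          · exact hl e he
        · rw [if_neg hg]
          refine (mean_mono _ (ψ := fun _ => 1) fun r _ => ?_).trans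
            ((mean_const _ _).le.trans le_self_add)
          simp only [Function.comp]
          split_ifs <;> simp
      refine (mean_mono _ this).trans ?_
      rw [mean_add, mean_const]
      refine (add_le_add_left (hK x h.1) _).trans ?_
      rw [← ENNReal.ofReal_add hδ (mul_nonneg hq1 hδ)]
      exact ENNReal.ofReal_le_ofReal (by linarith)

end Exec

/-! ### Edit distance and alignments -/

section EditDistance

variable {α : Type*}

/-- `Align k A B`: the strings `A` and `B` can be aligned from left to right at cost `k`, where a
deleted, an inserted and a substituted character cost one each. -/
inductive Align : ℕ → List α → List α → Prop
  | nil : Align 0 [] []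
  | del {k : ℕ} {A B : List α} (a : α) : Align k A B → Align (k + 1) (a :: A) B
  | ins {k : ℕ} {A B : List α} (b : α) : Align k A B → Align (k + 1) A (b :: B)
  | sub {k : ℕ} {A B : List α} (a b : α) : Align k A B → Align (k + 1) (a :: A) (b :: B)
  | keep {k : ℕ} {A B : List α} (a : α) : Align k A B → Align k (a :: A) (a :: B)

lemma Edit.cons {A B : List α} (h : Edit A B) (x : α) : Edit (x :: A) (x :: B) := by
  cases h with
  | insertion u v a => exact Edit.insertion (x :: u) v a
  | deletion u v a => exact Edit.deletion (x :: u) v a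
  | substitution u v a b => exact Edit.substitution (x :: u) v a b

lemma EditPath.cons {k : ℕ} {A B : List α} (h : EditPath k A B) (x : α) :
    EditPath k (x :: A) (x :: B) := by
  induction h with
  | refl A => exact EditPath.refl _
  | step e _ ih => exact EditPath.step (e.cons x) ih

lemma EditPath.trans {k l : ℕ} {A B C : List α} (h : EditPath k A B) (h' : EditPath l B C) :
    EditPath (k + l) A C := by
  induction h with
  | refl A => simpa using h'
  | step e _ ih =>
    have := EditPath.step e (ih h')
    rwa [show ∀ a b : ℕ, a + 1 + b = a + b + 1 by intros; ring]

lemma Align.editPath {k : ℕ} {A B : List α} (h : Align k A B) : EditPath k A B := by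
  induction h with
  | nil => exact EditPath.refl _
  | del a _ ih => exact EditPath.step (Edit.deletion [] _ a) ih
  | @ins k A B b _ ih => exact EditPath.step (Edit.insertion [] A b) (ih.cons b)
  | @sub k A B a b _ ih => exact EditPath.step (Edit.substitution [] A a b) (ih.cons b)
  | keep a _ ih => exact ih.cons a

lemma Align.refl (A : List α) : Align 0 A A := by
  induction A with
  | nil => exact Align.nil
  | cons a A ih => exact ih.keep a

/-- Cheap alignments may be changed in a suffix of the left string. -/
lemma Align.context {X Y : List α}
    (base : ∀ k C, Align k Y C → ∃ k' ≤ k + 1, Align k' X C) (u : List α) (k : ℕ) (C : List α)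
    (h : Align k (u ++ Y) C) : ∃ k' ≤ k + 1, Align k' (u ++ X) C := by
  induction u generalizing k C with
  | nil => exact base k C h
  | cons x u ihu =>
    generalize hZ : x :: u ++ Y = Z at h
    induction h with
    | nil => simp at hZ
    | @del k A B a h' ih =>
      simp only [List.cons_append, List.cons.injEq] at hZ
      obtain ⟨rfl, rfl⟩ := hZ
      obtain ⟨k', hk, h2⟩ := ihu _ _ h'
      exact ⟨k' + 1, by omega, h2.del x⟩
    | @ins k A B b h' ih =>
      obtain ⟨k', hk, h2⟩ := ih hZ
      exact ⟨k' + 1, by omega, h2.ins b⟩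
    | @sub k A B a b h' ih =>
      simp only [List.cons_append, List.cons.injEq] at hZ
      obtain ⟨rfl, rfl⟩ := hZ
      obtain ⟨k', hk, h2⟩ := ihu _ _ h'
      exact ⟨k' + 1, by omega, h2.sub x b⟩
    | @keep k A B a h' ih =>
      simp only [List.cons_append, List.cons.injEq] at hZ
      obtain ⟨rfl, rfl⟩ := hZ
      obtain ⟨k', hk, h2⟩ := ihu _ _ h'
      exact ⟨k', hk, h2.keep x⟩

lemma Align.tail {k : ℕ} {a : α} {v C : List α} (h : Align k (a :: v) C) :
    ∃ k' ≤ k + 1, Align k' v C := by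
  generalize hZ : a :: v = Z at h
  induction h with
  | nil => simp at hZ
  | @del k A B a h' ih =>
    obtain ⟨rfl, rfl⟩ := List.cons.inj hZ
    exact ⟨k, by omega, h'⟩
  | @ins k A B b h' ih =>
    obtain ⟨k', hk, h2⟩ := ih hZ
    exact ⟨k' + 1, by omega, h2.ins b⟩
  | @sub k A B a b h' ih =>
    obtain ⟨rfl, rfl⟩ := List.cons.inj hZ
    exact ⟨k + 1, by omega, h'.ins b⟩
  | @keep k A B a h' ih =>
    obtain ⟨rfl, rfl⟩ := List.cons.inj hZ
    exact ⟨k + 1, le_rfl, h'.ins _⟩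

lemma Align.change_head {k : ℕ} {b : α} {v C : List α} (h : Align k (b :: v) C) (a : α) :
    ∃ k' ≤ k + 1, Align k' (a :: v) C := by
  generalize hZ : b :: v = Z at h
  induction h with
  | nil => simp at hZ
  | @del k A B _ h' ih =>
    obtain ⟨rfl, rfl⟩ := List.cons.inj hZ
    exact ⟨k + 1, by omega, h'.del a⟩
  | @ins k A B b h' ih =>
    obtain ⟨k', hk, h2⟩ := ih hZ
    exact ⟨k' + 1, by omega, h2.ins b⟩
  | @sub k A B _ b h' ih =>
    obtain ⟨rfl, rfl⟩ := List.cons.inj hZ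
    exact ⟨k + 1, by omega, h'.sub a b⟩
  | @keep k A B _ h' ih =>
    obtain ⟨rfl, rfl⟩ := List.cons.inj hZ
    exact ⟨k + 1, le_rfl, h'.sub a _⟩

lemma EditPath.align {k : ℕ} {A C : List α} (h : EditPath k A C) : ∃ k' ≤ k, Align k' A C := by
  induction h with
  | refl A => exact ⟨0, le_rfl, Align.refl A⟩
  | @step k A B C e _ ih =>
    obtain ⟨k', hk, h⟩ := ih
    obtain ⟨k'', hk', h'⟩ : ∃ k'' ≤ k' + 1, Align k'' A C := by
      cases e with
      | insertion u v a => exact Align.context (fun k C h => h.tail) u _ _ h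
      | deletion u v a => exact Align.context (fun k C h => ⟨k + 1, le_rfl, h.del a⟩) u _ _ h
      | substitution u v a b => exact Align.context (fun k C h => h.change_head a) u _ _ h
    exact ⟨k'', by omega, h'⟩

lemma Align.editDist_le {k : ℕ} {A B : List α} (h : Align k A B) : editDist A B ≤ k :=
  Nat.sInf_le h.editPath

lemma align_nil_right (A : List α) : Align A.length A [] := by
  induction A with
  | nil => exact Align.nil
  | cons a A ih => exact ih.del a

lemma align_nil_left (B : List α) : Align B.length [] B := by
  induction B with
  | nil => exact Align.nil
  | cons a A ih => exact ih.ins a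

lemma Align.append {k l : ℕ} {u v u' v' : List α} (h : Align k u v) (h' : Align l u' v') :
    Align (k + l) (u ++ u') (v ++ v') := by
  induction h with
  | nil => simpa using h'
  | del a _ ih => rw [add_right_comm]; exact ih.del a
  | ins a _ ih => rw [add_right_comm]; exact ih.ins a
  | sub a b _ ih => rw [add_right_comm]; exact ih.sub a b
  | keep a _ ih => exact ih.keep a

lemma Align.symm {k : ℕ} {A B : List α} (h : Align k A B) : Align k B A := by
  induction h with
  | nil => exact .nil
  | del a _ ih => exact ih.ins a
  | ins a _ ih => exact ih.del a
  | sub a b _ ih => exact ih.sub b a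
  | keep a _ ih => exact ih.keep a

lemma align_editDist (A B : List α) : Align (editDist A B) A B := by
  have hne : {k | EditPath k A B}.Nonempty :=
    ⟨_, (by simpa using (align_nil_right A).append (align_nil_left B) :
      Align (A.length + B.length) A B).editPath⟩
  obtain ⟨k, hk, h⟩ := EditPath.align (Nat.sInf_mem hne)
  have : k = editDist A B := le_antisymm hk h.editDist_le
  exact this ▸ h

lemma Align.length_le {k : ℕ} {A B : List α} (h : Align k A B) : A.length ≤ B.length + k := by
  induction h with
  | nil => simp
  | del a _ ih => simp; omega
  | ins a _ ih => simp; omega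
  | sub a b _ ih => simp; omega
  | keep a _ ih => simp; omega

lemma Align.split {k : ℕ} {u u' B : List α} (h : Align k (u ++ u') B) :
    ∃ v v' k₁ k₂, B = v ++ v' ∧ k = k₁ + k₂ ∧ Align k₁ u v ∧ Align k₂ u' v' := by
  generalize hZ : u ++ u' = Z at h
  induction h generalizing u with
  | nil =>
    obtain ⟨rfl, rfl⟩ := List.append_eq_nil_iff.1 hZ
    exact ⟨[], [], 0, 0, rfl, rfl, .nil, .nil⟩
  | @del k A B a h' ih =>
    cases u with
    | nil =>
      simp only [List.nil_append] at hZ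
      subst hZ
      exact ⟨[], _, 0, k + 1, rfl, by simp, .nil, h'.del a⟩
    | cons x u =>
      obtain ⟨rfl, h2⟩ := List.cons.inj hZ
      obtain ⟨v, v', k₁, k₂, rfl, rfl, h3, h4⟩ := ih h2
      exact ⟨v, v', k₁ + 1, k₂, rfl, by ring, h3.del x, h4⟩
  | @ins k A B b h' ih =>
    obtain ⟨v, v', k₁, k₂, rfl, rfl, h3, h4⟩ := ih hZ
    exact ⟨b :: v, v', k₁ + 1, k₂, rfl, by ring, h3.ins b, h4⟩
  | @sub k A B a b h' ih =>
    cases u with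
    | nil =>
      simp only [List.nil_append] at hZ
      subst hZ
      exact ⟨[], _, 0, k + 1, rfl, by simp, .nil, h'.sub a b⟩
    | cons x u =>
      obtain ⟨rfl, h2⟩ := List.cons.inj hZ
      obtain ⟨v, v', k₁, k₂, rfl, rfl, h3, h4⟩ := ih h2
      exact ⟨b :: v, v', k₁ + 1, k₂, rfl, by ring, h3.sub x b, h4⟩
  | @keep k A B a h' ih =>
    cases u with
    | nil =>
      simp only [List.nil_append] at hZ
      subst hZ
      exact ⟨[], _, 0, k, rfl, by simp, .nil, h'.keep a⟩
    | cons x u =>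
      obtain ⟨rfl, h2⟩ := List.cons.inj hZ
      obtain ⟨v, v', k₁, k₂, rfl, rfl, h3, h4⟩ := ih h2
      exact ⟨x :: v, v', k₁, k₂, rfl, rfl, h3.keep x, h4⟩

lemma editDist_comm (A B : List α) : editDist A B = editDist B A :=
  le_antisymm (align_editDist B A).symm.editDist_le (align_editDist A B).symm.editDist_le

lemma editDist_triangle (A B C : List α) : editDist A C ≤ editDist A B + editDist B C :=
  Nat.sInf_le ((align_editDist A B).editPath.trans (align_editDist B C).editPath)

@[simp] lemma editDist_self (A : List α) : editDist A A = 0 :=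
  Nat.le_zero.1 (Align.refl A).editDist_le

lemma editDist_append_le (u v u' v' : List α) :
    editDist (u ++ u') (v ++ v') ≤ editDist u v + editDist u' v' :=
  ((align_editDist u v).append (align_editDist u' v')).editDist_le

lemma editDist_nil_right_le (A : List α) : editDist A [] ≤ A.length :=
  (align_nil_right A).editDist_le

@[simp] lemma editDist_nil_right (A : List α) : editDist A [] = A.length :=
  le_antisymm (editDist_nil_right_le A) (by simpa using (align_editDist A []).length_le)

@[simp] lemma editDist_nil_left (A : List α) : editDist [] A = A.length := by
  rw [editDist_comm, editDist_nil_right]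

lemma length_le_add_editDist (A B : List α) : A.length ≤ B.length + editDist A B :=
  (align_editDist A B).length_le

lemma exists_split (u u' B : List α) :
    ∃ v v', B = v ++ v' ∧ editDist u v + editDist u' v' ≤ editDist (u ++ u') B := by
  obtain ⟨v, v', k₁, k₂, h, hk, h1, h2⟩ := (align_editDist (u ++ u') B).split
  exact ⟨v, v', h, by rw [hk]; exact add_le_add h1.editDist_le h2.editDist_le⟩

lemma editDist_cons_cons [DecidableEq α] (a b : α) (A B : List α) :
    editDist (a :: A) (b :: B) =
      min (min (editDist A (b :: B) + 1) (editDist (a :: A) B + 1))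
        (editDist A B + if a = b then 0 else 1) := by
  apply le_antisymm
  · refine le_min (le_min ?_ ?_) ?_
    · exact ((align_editDist A (b :: B)).del a).editDist_le
    · exact ((align_editDist (a :: A) B).ins b).editDist_le
    · split_ifs with h
      · subst h; exact ((align_editDist A B).keep a).editDist_le
      · exact ((align_editDist A B).sub a b).editDist_le
  · have h := align_editDist (a :: A) (b :: B)
    generalize editDist (a :: A) (b :: B) = k at h
    cases h with
    | del _ h => exact (min_le_left _ _).trans ((min_le_left _ _).trans
        (Nat.succ_le_succ h.editDist_le))
    | ins _ h => exact (min_le_left _ _).trans ((min_le_right _ _).trans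
        (Nat.succ_le_succ h.editDist_le))
    | sub _ _ h =>
      refine (min_le_right _ _).trans ?_
      have := h.editDist_le
      split_ifs <;> omega
    | keep _ h =>
      refine (min_le_right _ _).trans ?_
      simpa using h.editDist_le

/-- The substring of `B` from position `a` (inclusive) to position `b` (exclusive); it is empty if
`b ≤ a`. -/
def slice (B : List α) (a b : ℕ) : List α := (B.drop a).take (b - a)

lemma slice_append (B : List α) {a b c : ℕ} (hab : a ≤ b) (hbc : b ≤ c) :
    slice B a b ++ slice B b c = slice B a c := by
  unfold slice
  have h1 : B.drop b = (B.drop a).drop (b - a) := by rw [List.drop_drop]; congr 1; omega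
  rw [h1, show c - a = (b - a) + (c - b) by omega, List.take_add]

lemma slice_length_le (B : List α) (a b : ℕ) : (slice B a b).length ≤ b - a := by
  simp [slice]

lemma slice_length (B : List α) {a b : ℕ} (hb : b ≤ B.length) :
    (slice B a b).length = b - a := by
  simp [slice]; omega

lemma slice_of_le (B : List α) {a b : ℕ} (h : b ≤ a) : slice B a b = [] := by
  simp [slice, h]

lemma editDist_append_left_le (u v : List α) : editDist (u ++ v) v ≤ u.length := by
  simpa using editDist_append_le u [] v v

lemma editDist_append_right_le (u v : List α) : editDist (u ++ v) u ≤ v.length := by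
  simpa using editDist_append_le u u v []

lemma editDist_slice_left (B : List α) {a c : ℕ} (h : a ≤ c) (b : ℕ) :
    editDist (slice B a b) (slice B c b) ≤ c - a := by
  rcases le_total b a with hb | hb
  · rw [slice_of_le B hb, slice_of_le B (hb.trans h)]; simp
  rcases le_total c b with hc | hc
  · rw [← slice_append B h hc]
    exact (editDist_append_left_le _ _).trans (slice_length_le B a c)
  · rw [slice_of_le B hc]
    simp only [editDist_nil_right]
    exact (slice_length_le B a b).trans (by omega)

lemma editDist_slice_right (B : List α) {b e : ℕ} (h : b ≤ e) (c : ℕ) :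
    editDist (slice B c e) (slice B c b) ≤ e - b := by
  rcases le_total c b with hc | hc
  · rw [← slice_append B hc h]
    exact (editDist_append_right_le _ _).trans (slice_length_le B b e)
  · rw [slice_of_le B hc]
    simp only [editDist_nil_right]
    exact (slice_length_le B c e).trans (by omega)

lemma editDist_slice_slice (B : List α) (a b c e : ℕ) :
    editDist (slice B a b) (slice B c e) ≤ Nat.dist a c + Nat.dist b e := by
  refine (editDist_triangle _ (slice B c b) _).trans (add_le_add ?_ ?_)
  · rcases le_total a c with h | h
    · rw [Nat.dist_eq_sub_of_le h]; exact editDist_slice_left B h b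
    · rw [Nat.dist_eq_sub_of_le_right h, editDist_comm]; exact editDist_slice_left B h b
  · rcases le_total b e with h | h
    · rw [Nat.dist_eq_sub_of_le h, editDist_comm]; exact editDist_slice_right B h c
    · rw [Nat.dist_eq_sub_of_le_right h]; exact editDist_slice_right B h c

end EditDistance

/-! ### The quadratic dynamic program -/

section Quadratic

variable {α : Type*}

/-- The distances of `A` from all suffixes of `B`. -/
noncomputable def suffixDists (A : List α) : List α → List ℕ
  | [] => [editDist A []]
  | b :: B => editDist A (b :: B) :: suffixDists A B

lemma suffixDists_headD (A B : List α) : (suffixDists A B).headD 0 = editDist A B := by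
  cases B <;> simp [suffixDists]

lemma firstRow_eq (B : List α) : firstRow B = suffixDists [] B := by
  induction B with
  | nil => simp [firstRow, suffixDists]
  | cons b B ih => simp [firstRow, suffixDists, ih]

variable [DecidableEq α]

lemma runs_nextRow (a : α) (A B : List α) :
    (nextRow a B (suffixDists A B)).Runs (fun _ => False)
      (fun r => r = suffixDists (a :: A) B) (B.length + 1) 0 := by
  induction B with
  | nil =>
    refine ((Prog.Runs.spend 1).bind fun _ _ => Prog.Runs.ret ?_).mono (fun _ h => h)
      (by simp) (by simp)
    simp [suffixDists]
  | cons b B ih =>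
    rw [suffixDists, nextRow]
    refine ((ih.bind fun new hnew => (Prog.Runs.spend 1).bind fun _ _ => Prog.Runs.ret
      (Q := fun r => r = suffixDists (a :: A) (b :: B)) ?_)).mono (fun _ h => h)
      (by simp) (by simp)
    rw [hnew, suffixDists_headD, suffixDists, List.tail_cons, suffixDists, suffixDists_headD,
      editDist_cons_cons, suffixDists_headD]

lemma runs_editRows (A B : List α) :
    (editRows B A).Runs (fun _ => False) (fun r => r = suffixDists A B)
      ((A.length + 1) * (B.length + 1)) 0 := by
  induction A with
  | nil =>
    refine ((Prog.Runs.spend _).bind fun _ _ => Prog.Runs.ret ?_).mono (fun _ h => h)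
      (by simp) (by simp)
    exact firstRow_eq B
  | cons a A ih =>
    refine (ih.bind (s' := B.length + 1) (q' := 0) fun row hrow => ?_).mono
      (fun _ h => h) ?_ (by simp)
    · rw [hrow]; exact runs_nextRow a A B
    · simp; linarith

lemma runs_editProg (A B : List α) :
    (editProg A B).Runs (fun _ => False) (fun v => v = editDist A B)
      ((A.length + 1) * (B.length + 1) + 1) 0 := by
  refine ((runs_editRows A B).bind fun row hrow => (Prog.Runs.spend 1).bind fun _ _ =>
    Prog.Runs.ret (Q := fun v => v = editDist A B) ?_).mono (fun _ h => h) (by simp) (by simp)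
  rw [hrow, suffixDists_headD]

/-- Level `0` is exact and takes quadratic time. -/
lemma mainAlg_zero (imax n : ℕ) (hn : 1 ≤ n) (Δ : ℝ) (A B : List α) (hA : A.length = n)
    (hB : B.length = n) (r : Outcome ℕ) (hr : r ∈ (mainAlg imax 0 A B Δ).support) :
    r.value = editDist A B ∧ r.steps ≤ 5 * n ^ 2 ∧ r.queries = 0 := by
  obtain ⟨h1, h2, h3, -⟩ := exec_of_runs _ _ (runs_editProg A B) [] r (by simpa [mainAlg] using hr)
  refine ⟨h3, ?_, ?_⟩
  · rw [hA, hB] at h1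
    have : r.steps ≤ (n + 1) * (n + 1) + 1 := by exact_mod_cast h1
    nlinarith
  · have : r.queries ≤ 0 := by exact_mod_cast h2
    omega

end Quadratic

/-! ### Windows and mappings -/

namespace Inst

variable (X : Inst)

lemma d_le : X.d ≤ X.n := Nat.sqrt_le_self _

lemma numA_mul_d : X.numA * X.d + X.n % X.d = X.n := by
  unfold numA; rw [mul_comm]; exact Nat.div_add_mod _ _

lemma startB_le (j : ℕ) : X.startB j ≤ X.n - X.d := min_le_right _ _

lemma startB_mono {j j' : ℕ} (h : j ≤ j') : X.startB j ≤ X.startB j' :=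
  min_le_min_right _ (Nat.mul_le_mul_right _ h)

lemma le_numB_sub_one_mul (hγ : 1 ≤ X.γ) : X.n - X.d ≤ (X.numB - 1) * X.γ := by
  unfold numB
  rw [Nat.add_sub_cancel]
  have := Nat.lt_div_mul_add (a := X.n - X.d + X.γ - 1) (b := X.γ) hγ
  omega

lemma numB_sub_two_mul_lt (hγ : 1 ≤ X.γ) {j : ℕ} (hj : j + 1 < X.numB) :
    j * X.γ < X.n - X.d := by
  unfold numB at hj
  have h1 : j + 1 ≤ (X.n - X.d + X.γ - 1) / X.γ := by omega
  have h2 := (Nat.le_div_iff_mul_le hγ).1 h1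
  have : (j + 1) * X.γ = j * X.γ + X.γ := by ring
  omega

lemma startB_of_lt (hγ : 1 ≤ X.γ) {j : ℕ} (hj : j + 1 < X.numB) : X.startB j = j * X.γ :=
  min_eq_left (X.numB_sub_two_mul_lt hγ hj).le

lemma startB_strictMono (hγ : 1 ≤ X.γ) {j j' : ℕ} (h : j < j') (hj' : j' < X.numB) :
    X.startB j < X.startB j' := by
  rw [X.startB_of_lt hγ (by omega : j + 1 < X.numB)]
  refine lt_min ?_ (X.numB_sub_two_mul_lt hγ (by omega))
  exact Nat.mul_lt_mul_of_pos_right h hγ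

lemma startB_le_startB_iff (hγ : 1 ≤ X.γ) {j j' : ℕ} (hj : j < X.numB) :
    X.startB j ≤ X.startB j' ↔ j ≤ j' := by
  refine ⟨fun h => ?_, X.startB_mono⟩
  by_contra! hlt
  exact absurd h (not_le.2 (X.startB_strictMono hγ hlt hj))

lemma startB_min (hγ : 1 ≤ X.γ) (j : ℕ) : X.startB (min j (X.numB - 1)) = X.startB j := by
  rcases le_total j (X.numB - 1) with h | h
  · rw [min_eq_left h]
  · rw [min_eq_right h]
    have h1 := X.le_numB_sub_one_mul hγ
    have h2 := Nat.mul_le_mul_right X.γ h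
    unfold startB
    omega

lemma numB_pos : 0 < X.numB := Nat.succ_pos _

section Words

variable {α : Type*} (A B : List α)

lemma word_inl (k : ℕ) : X.word A B (Sum.inl k) = slice A (k * X.d) (k * X.d + X.d) := by
  simp [word, slice]

lemma word_inr (j : ℕ) :
    X.word A B (Sum.inr j) = slice B (X.startB j) (X.startB j + X.d) := by
  simp [word, slice]

lemma mem_windows {w : Win} :
    w ∈ X.windows ↔ (∃ k < X.numA, w = Sum.inl k) ∨ ∃ j < X.numB, w = Sum.inr j := by
  simp [windows, eq_comm]

lemma windows_nodup : X.windows.Nodup := by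
  unfold windows
  refine List.Nodup.append (List.nodup_range.map Sum.inl_injective)
    (List.nodup_range.map Sum.inr_injective) ?_
  intro w h1 h2
  simp at h1 h2
  obtain ⟨k, -, rfl⟩ := h1
  simp at h2

lemma windows_length : X.windows.length = X.t := by simp [windows, t]

lemma word_length (hA : A.length = X.n) (hB : B.length = X.n) {w : Win} (hw : w ∈ X.windows) :
    (X.word A B w).length = X.d := by
  rcases X.mem_windows.1 hw with ⟨k, hk, rfl⟩ | ⟨j, -, rfl⟩
  · rw [word_inl, slice_length]
    · omega
    · have h1 := X.numA_mul_d
      have h2 : (k + 1) * X.d ≤ X.numA * X.d := Nat.mul_le_mul_right _ hk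
      have h3 : (k + 1) * X.d = k * X.d + X.d := by ring
      omega
  · rw [word_inr, slice_length]
    · omega
    · have h1 := X.startB_le j
      have h2 := X.d_le
      omega

end Words

/-! #### Mappings as functions on the natural numbers -/

/-- The sum of the gaps between consecutive windows of a list. -/
def gapSum (l : List ℕ) : ℕ := (List.zipWith X.gap l l.tail).sum

/-- The windows of `B` to which `f` maps the first `K` windows of `A`. -/
def imgs (f : ℕ → Option ℕ) (K : ℕ) : List ℕ := (List.range K).filterMap f

/-- The total estimate of the first `K` windows of `A` under `f`; an unmapped window counts `d`. -/
def estSum (E : ℕ → ℕ → ℕ) (f : ℕ → Option ℕ) (K : ℕ) : ℕ :=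
  ∑ k ∈ Finset.range K, match f k with
    | none => X.d
    | some j => E k j

/-- `f` is a monotone mapping of the first `K` windows of `A` to the windows of `B`. -/
structure Monotone (f : ℕ → Option ℕ) (K : ℕ) : Prop where
  lt : ∀ k < K, ∀ j, f k = some j → j < X.numB
  mono : ∀ k k' j j', k ≤ k' → k' < K → f k = some j → f k' = some j' → j ≤ j'

/-- A mapping, as a function on the natural numbers. -/
def ofMapping (μ : X.Mapping) (k : ℕ) : Option ℕ :=
  if h : k < X.numA then (μ ⟨k, h⟩).map Fin.val else none

lemma images_eq (μ : X.Mapping) : X.images μ = imgs (X.ofMapping μ) X.numA := by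
  unfold images imgs List.reduceOption
  rw [List.map_filterMap, List.ofFn_eq_map, List.filterMap_map, ← List.map_coe_finRange_eq_range,
    List.filterMap_map]
  refine List.filterMap_congr fun k _ => ?_
  simp [ofMapping]

lemma mapCost_eq (E : ℕ → ℕ → ℕ) (μ : X.Mapping) :
    X.mapCost E μ = 2 * X.estSum E (X.ofMapping μ) X.numA +
      2 * X.gapSum (imgs (X.ofMapping μ) X.numA) + 2 * (X.n % X.d) := by
  unfold mapCost
  rw [images_eq, estSum, Finset.sum_range]
  refine congrArg (fun s => 2 * s + _ + _) (Finset.sum_congr rfl fun k _ => ?_)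
  simp only [ofMapping, k.2, dif_pos, Fin.eta]
  cases μ k <;> rfl

lemma monotone_ofMapping (hγ : 1 ≤ X.γ) {μ : X.Mapping} (h : X.IsMonotone μ) :
    X.Monotone (X.ofMapping μ) X.numA := by
  refine ⟨fun k hk j hj => ?_, fun k k' j j' hkk' hk' hj hj' => ?_⟩
  · simp only [ofMapping, hk, dif_pos, Option.map_eq_some_iff] at hj
    obtain ⟨i, -, rfl⟩ := hj
    exact i.2
  · simp only [ofMapping, hk', lt_of_le_of_lt hkk' hk', dif_pos, Option.map_eq_some_iff] at hj hj'
    obtain ⟨i, hi, rfl⟩ := hj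
    obtain ⟨i', hi', rfl⟩ := hj'
    exact (X.startB_le_startB_iff hγ i.2).1 (h _ _ i i' (by simpa using hkk') hi hi')

lemma exists_mapping {f : ℕ → Option ℕ} (hf : X.Monotone f X.numA) :
    ∃ μ : X.Mapping, X.IsMonotone μ ∧ ∀ k < X.numA, X.ofMapping μ k = f k := by
  refine ⟨fun k => (f k).bind fun j => if h : j < X.numB then some ⟨j, h⟩ else none, ?_, ?_⟩
  · intro k k' j j' hkk' hj hj'
    simp only [Option.bind_eq_some_iff] at hj hj'
    obtain ⟨i, hi, h1⟩ := hj
    obtain ⟨i', hi', h1'⟩ := hj'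
    split_ifs at h1 h1' with h2 h2'
    simp only [Option.some.injEq] at h1 h1'
    subst h1 h1'
    exact X.startB_mono (hf.mono k k' i i' hkk' k'.2 hi hi')
  · intro k hk
    simp only [ofMapping, hk, dif_pos]
    cases h : f k with
    | none => simp
    | some j => simp [hf.lt k hk j h]

lemma imgs_congr {f g : ℕ → Option ℕ} {K : ℕ} (h : ∀ k < K, f k = g k) :
    imgs f K = imgs g K :=
  List.filterMap_congr fun k hk => h k (by simpa using hk)

lemma estSum_congr (E : ℕ → ℕ → ℕ) {f g : ℕ → Option ℕ} {K : ℕ} (h : ∀ k < K, f k = g k) :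
    X.estSum E f K = X.estSum E g K :=
  Finset.sum_congr rfl fun k hk => by rw [h k (by simpa using hk)]

lemma edOf_le (E : ℕ → ℕ → ℕ) {f : ℕ → Option ℕ} (hf : X.Monotone f X.numA) :
    X.edOf E ≤ 2 * X.estSum E f X.numA + 2 * X.gapSum (imgs f X.numA) + 2 * (X.n % X.d) := by
  obtain ⟨μ, h1, h2⟩ := X.exists_mapping hf
  refine Nat.sInf_le ⟨μ, h1, ?_⟩
  rw [mapCost_eq, imgs_congr h2, X.estSum_congr E h2]

lemma exists_edOf_eq (hγ : 1 ≤ X.γ) (E : ℕ → ℕ → ℕ) :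
    ∃ f, X.Monotone f X.numA ∧ X.edOf E =
      2 * X.estSum E f X.numA + 2 * X.gapSum (imgs f X.numA) + 2 * (X.n % X.d) := by
  have hne : {c | ∃ μ : X.Mapping, X.IsMonotone μ ∧ X.mapCost E μ = c}.Nonempty :=
    ⟨_, fun _ => none, fun k k' j j' _ h => by simp at h, rfl⟩
  obtain ⟨μ, h1, h2⟩ := Nat.sInf_mem hne
  exact ⟨_, X.monotone_ofMapping hγ h1, by rw [← mapCost_eq]; exact h2.symm⟩

lemma imgs_succ_none {f : ℕ → Option ℕ} {K : ℕ} (h : f K = none) :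
    imgs f (K + 1) = imgs f K := by
  simp [imgs, List.range_succ, List.filterMap_append, h]

lemma imgs_succ_some {f : ℕ → Option ℕ} {K j : ℕ} (h : f K = some j) :
    imgs f (K + 1) = imgs f K ++ [j] := by
  simp [imgs, List.range_succ, List.filterMap_append, h]

lemma mem_imgs {f : ℕ → Option ℕ} {K j : ℕ} : j ∈ imgs f K ↔ ∃ k < K, f k = some j := by
  simp [imgs]

lemma estSum_succ_none (E : ℕ → ℕ → ℕ) {f : ℕ → Option ℕ} {K : ℕ} (h : f K = none) :
    X.estSum E f (K + 1) = X.estSum E f K + X.d := by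
  simp [estSum, Finset.sum_range_succ, h]

lemma estSum_succ_some (E : ℕ → ℕ → ℕ) {f : ℕ → Option ℕ} {K j : ℕ} (h : f K = some j) :
    X.estSum E f (K + 1) = X.estSum E f K + E K j := by
  simp [estSum, Finset.sum_range_succ, h]

@[simp] lemma gapSum_nil : X.gapSum [] = 0 := rfl
@[simp] lemma gapSum_singleton (j : ℕ) : X.gapSum [j] = 0 := rfl
@[simp] lemma gapSum_cons_cons (i j : ℕ) (l : List ℕ) :
    X.gapSum (i :: j :: l) = X.gap i j + X.gapSum (j :: l) := by
  simp [gapSum]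

lemma gapSum_concat (l : List ℕ) (i j : ℕ) :
    X.gapSum (l ++ [i] ++ [j]) = X.gapSum (l ++ [i]) + X.gap i j := by
  induction l with
  | nil => simp
  | cons a l ih =>
    cases l with
    | nil => simp
    | cons b l =>
      simp only [List.cons_append, gapSum_cons_cons] at ih ⊢
      rw [ih, add_assoc]


/-! #### The cost of a mapping is at least the edit distance -/

section LowerBound

variable {α : Type*} {A B : List α} {E : ℕ → ℕ → ℕ} {f : ℕ → Option ℕ}

/-- A prefix of a mapping shows how to transform a prefix of `A` into the prefix of `B` that ends
with the last mapped window. Here `m` counts the mapped windows and `s` is the starting position of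
the first image; the prefix of `B` before it is inserted. -/
lemma prefix_cost
    (hE : ∀ k < X.numA, ∀ j < X.numB,
      editDist (X.word A B (Sum.inl k)) (X.word A B (Sum.inr j)) ≤ E k j)
    (hf : X.Monotone f X.numA) (K : ℕ) (hK : K ≤ X.numA) :
    (imgs f K = [] ∧ X.estSum E f K = K * X.d) ∨
    ∃ l i s m, imgs f K = l ++ [i] ∧ i < X.numB ∧
      editDist (slice A 0 (K * X.d)) (slice B 0 (X.startB i + X.d)) ≤
        X.estSum E f K + X.gapSum (imgs f K) + s ∧
      s + X.d * m ≤ X.startB i + X.d + X.gapSum (imgs f K) ∧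
      (K - m) * X.d ≤ X.estSum E f K ∧ m ≤ K := by
  induction K with
  | zero => left; simp [imgs, estSum]
  | succ K ih =>
    have hAstep : slice A 0 ((K + 1) * X.d) =
        slice A 0 (K * X.d) ++ X.word A B (Sum.inl K) := by
      rw [word_inl, slice_append A (Nat.zero_le _) (by omega)]; congr 1; ring
    cases hfK : f K with
    | none =>
      rw [imgs_succ_none hfK, X.estSum_succ_none E hfK]
      rcases ih (by omega) with ⟨h1, h2⟩ | ⟨l, i, s, m, h1, h2, h3, h4, h5, h6⟩
      · left; exact ⟨h1, by rw [h2]; ring⟩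
      · right
        refine ⟨l, i, s, m, h1, h2, ?_, h4, ?_, by omega⟩
        · rw [hAstep]
          have h7 := editDist_append_le (slice A 0 (K * X.d)) (slice B 0 (X.startB i + X.d))
            (X.word A B (Sum.inl K)) []
          have h8 : (X.word A B (Sum.inl K)).length ≤ X.d := by
            rw [word_inl]; exact (slice_length_le _ _ _).trans (by omega)
          simp only [List.append_nil, editDist_nil_right] at h7
          linarith
        · rw [show K + 1 - m = (K - m) + 1 by omega, add_mul]; linarith
    | some j =>
      have hj := hf.lt K (by omega) j hfK
      rw [imgs_succ_some hfK, X.estSum_succ_some E hfK]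
      have hBstep : slice B 0 (X.startB j + X.d) =
          slice B 0 (X.startB j) ++ X.word A B (Sum.inr j) := by
        rw [word_inr, slice_append B (Nat.zero_le _) (by omega)]
      have hEK := hE K (by omega) j hj
      right
      rcases ih (by omega) with ⟨h1, h2⟩ | ⟨l, i, s, m, h1, h2, h3, h4, h5, h6⟩
      · refine ⟨[], j, X.startB j, 1, by rw [h1], hj, ?_, by rw [h1]; simp, ?_, by omega⟩
        · rw [hAstep, hBstep, h1, h2]
          have h7 := editDist_append_le (slice A 0 (K * X.d)) (slice B 0 (X.startB j))
            (X.word A B (Sum.inl K)) (X.word A B (Sum.inr j))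
          have h8 : editDist (slice A 0 (K * X.d)) (slice B 0 (X.startB j)) ≤
              K * X.d + X.startB j := by
            refine (editDist_triangle _ [] _).trans ?_
            rw [editDist_nil_right, editDist_nil_left]
            exact add_le_add (slice_length_le _ _ _) (slice_length_le _ _ _)
          simp
          linarith
        · rw [h2, Nat.add_sub_cancel]; omega
      · refine ⟨l ++ [i], j, s, m + 1, by rw [h1], hj, ?_, ?_, ?_, by omega⟩
        · rw [hAstep, hBstep, h1, gapSum_concat]
          rw [h1] at h3
          have h7 := editDist_append_le (slice A 0 (K * X.d)) (slice B 0 (X.startB j))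
            (X.word A B (Sum.inl K)) (X.word A B (Sum.inr j))
          have h8 := editDist_triangle (slice A 0 (K * X.d)) (slice B 0 (X.startB i + X.d))
            (slice B 0 (X.startB j))
          have h9 := editDist_slice_slice B 0 (X.startB i + X.d) 0 (X.startB j)
          simp only [Nat.dist_self, zero_add] at h9
          unfold gap
          linarith
        · rw [h1, gapSum_concat]
          rw [h1] at h4
          unfold gap Nat.dist
          rw [mul_add]
          omega
        · rw [show K + 1 - (m + 1) = K - m by omega]; omega

/-- If the estimates are not too small then the cost of a mapping is at least the edit distance.
The characters of `B` outside of the images are inserted; they are as many as the characters of `A`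
in unmapped windows, up to the gaps, since both strings have the same length. -/
lemma editDist_le_cost (hA : A.length = X.n) (hB : B.length = X.n)
    (hE : ∀ k < X.numA, ∀ j < X.numB,
      editDist (X.word A B (Sum.inl k)) (X.word A B (Sum.inr j)) ≤ E k j)
    (hf : X.Monotone f X.numA) :
    editDist A B ≤
      2 * X.estSum E f X.numA + 2 * X.gapSum (imgs f X.numA) + 2 * (X.n % X.d) := by
  have hn := X.numA_mul_d
  rcases X.prefix_cost (A := A) hE hf X.numA le_rfl with
    ⟨h1, h2⟩ | ⟨l, i, s, m, h1, h2, h3, h4, h5, h6⟩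
  · rw [h2]
    have := editDist_triangle A [] B
    simp only [editDist_nil_left, editDist_nil_right] at this
    omega
  · have hA' : slice A 0 (X.numA * X.d) ++ slice A (X.numA * X.d) X.n = A := by
      rw [slice_append A (Nat.zero_le _) (by omega)]; simp [slice, ← hA]
    have hiB : X.startB i + X.d ≤ X.n := by
      have h1 := X.startB_le i
      have h2 := X.d_le
      omega
    have hB' : slice B 0 (X.startB i + X.d) ++ slice B (X.startB i + X.d) X.n = B := by
      rw [slice_append B (Nat.zero_le _) hiB]; simp [slice, ← hB]
    have h7 := editDist_append_le (slice A 0 (X.numA * X.d)) (slice B 0 (X.startB i + X.d))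
      (slice A (X.numA * X.d) X.n) (slice B (X.startB i + X.d) X.n)
    rw [hA', hB'] at h7
    have h8 := editDist_triangle (slice A (X.numA * X.d) X.n) [] (slice B (X.startB i + X.d) X.n)
    rw [editDist_nil_right, editDist_nil_left] at h8
    have h9 := slice_length_le A (X.numA * X.d) X.n
    have h10 := slice_length_le B (X.startB i + X.d) X.n
    rw [Nat.sub_mul, mul_comm m] at h5
    omega

lemma editDist_le_edOf (hγ : 1 ≤ X.γ) (hA : A.length = X.n) (hB : B.length = X.n)
    (hE : ∀ k < X.numA, ∀ j < X.numB,
      editDist (X.word A B (Sum.inl k)) (X.word A B (Sum.inr j)) ≤ E k j) :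
    editDist A B ≤ X.edOf E := by
  obtain ⟨f, hf, h⟩ := X.exists_edOf_eq hγ E
  rw [h]
  exact X.editDist_le_cost hA hB hE hf

end LowerBound

end Inst

/-! ### The mapping induced by an optimal alignment -/

namespace Inst

variable (X : Inst)

section Matching

variable {α : Type*} {A B : List α}

/-- An optimal alignment cuts `B` into pieces aligned to the windows of `A`. -/
lemma exists_cuts (A B : List α) (K : ℕ) :
    ∃ p : ℕ → ℕ, (∀ k < K, p k ≤ p (k + 1)) ∧ p K ≤ B.length ∧
      ∑ k ∈ Finset.range K, editDist (X.word A B (Sum.inl k)) (slice B (p k) (p (k + 1))) +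
        editDist (A.drop (K * X.d)) (B.drop (p K)) ≤ editDist A B := by
  induction K with
  | zero => exact ⟨fun _ => 0, by simp, by simp, by simp⟩
  | succ K ih =>
    obtain ⟨p, h1, h2, h3⟩ := ih
    have hA : A.drop (K * X.d) = X.word A B (Sum.inl K) ++ A.drop ((K + 1) * X.d) := by
      rw [word, add_mul, one_mul, ← List.drop_drop, List.take_append_drop]
    obtain ⟨v, v', hv, h4⟩ := exists_split (X.word A B (Sum.inl K)) (A.drop ((K + 1) * X.d))
      (B.drop (p K))
    rw [← hA] at h4
    have hlen : v.length + v'.length = B.length - p K := by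
      rw [← List.length_append, ← hv, List.length_drop]
    have hv1 : slice B (p K) (p K + v.length) = v := by
      rw [slice, hv]; simp
    have hv2 : B.drop (p K + v.length) = v' := by
      rw [← List.drop_drop, hv]; simp
    refine ⟨fun k => if k ≤ K then p k else p K + v.length, ?_, ?_, ?_⟩
    · intro k hk
      rcases Nat.lt_succ_iff_lt_or_eq.1 hk with hk | rfl
      · simpa [hk.le, Nat.succ_le_of_lt hk] using h1 k hk
      · simp
    · simp; omega
    · rw [Finset.sum_range_succ]
      have : ∑ k ∈ Finset.range K, editDist (X.word A B (Sum.inl k))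
          (slice B (if k ≤ K then p k else p K + v.length)
            (if k + 1 ≤ K then p (k + 1) else p K + v.length)) =
          ∑ k ∈ Finset.range K, editDist (X.word A B (Sum.inl k))
            (slice B (p k) (p (k + 1))) := by
        refine Finset.sum_congr rfl fun k hk => ?_
        have hk := Finset.mem_range.1 hk
        rw [if_pos hk.le, if_pos (Nat.succ_le_of_lt hk)]
      simp only [this, le_refl, if_true, Nat.not_succ_le_self, if_false, hv1, hv2]
      omega

/-- A matching of windows of `A` with windows of `B` along an optimal alignment. The window `k` is
matched, for `k ∈ S`, with the window `m k`; the alignment spends `cost k` on window `k`. -/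
structure Matching (A B : List α) where
  S : Finset ℕ
  m : ℕ → ℕ
  cost : ℕ → ℕ
  lt_numA : ∀ k ∈ S, k < X.numA
  lt_numB : ∀ k ∈ S, m k < X.numB
  strictMono : StrictMonoOn m S
  sum_cost : ∑ k ∈ Finset.range X.numA, cost k ≤ editDist A B
  unmatched : ∀ k < X.numA, k ∉ S → X.d ≤ 4 * cost k
  close : ∀ k ∈ S,
    editDist (X.word A B (Sum.inl k)) (X.word A B (Sum.inr (m k))) ≤ 4 * cost k + 2 * X.γ
  gaps : X.gapSum (imgs (fun k => if k ∈ S then some (m k) else none) X.numA) ≤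
    2 * ∑ k ∈ Finset.range X.numA, (5 * cost k + X.γ)

/-- Match each window of `A` of which less than a quarter is edited with a window of `B` that
starts shortly before its piece of `B`. -/
lemma nonempty_matching (hγ : 1 ≤ X.γ) (hγd : 2 * X.γ ≤ X.d)
    (hA : A.length = X.n) (hB : B.length = X.n) : Nonempty (X.Matching A B) := by
  obtain ⟨p, hp, hpn, hsum⟩ := X.exists_cuts A B X.numA
  have hp' : ∀ j ≤ X.numA, ∀ i ≤ j, p i ≤ p j := by
    intro j hj i hij
    induction j, hij using Nat.le_induction with
    | base => exact le_rfl
    | succ j hij ih => exact (ih (by omega)).trans (hp j (by omega))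
  set cost : ℕ → ℕ := fun k =>
    editDist (X.word A B (Sum.inl k)) (slice B (p k) (p (k + 1))) with hcost
  have hdn := X.d_le
  have hlen : ∀ k < X.numA, X.d ≤ p (k + 1) - p k + cost k ∧ p (k + 1) - p k ≤ X.d + cost k := by
    intro k hk
    have h1 := X.word_length A B hA hB (X.mem_windows.2 (Or.inl ⟨k, hk, rfl⟩))
    have h2 := slice_length B (a := p k) (b := p (k + 1))
      ((hp' X.numA le_rfl (k + 1) (by omega)).trans hpn)
    have h3 := length_le_add_editDist (X.word A B (Sum.inl k)) (slice B (p k) (p (k + 1)))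
    have h4 := length_le_add_editDist (slice B (p k) (p (k + 1))) (X.word A B (Sum.inl k))
    rw [editDist_comm] at h4
    rw [h1, h2] at h3 h4
    exact ⟨h3, h4⟩
  -- the piece of such a window is longer than `3 d / 4`, hence, by `2 γ ≤ d`, longer than `γ` plus
  -- the cost of any other such window; so different pieces get different windows of `B`
  set S : Finset ℕ := (Finset.range X.numA).filter fun k => 4 * cost k < X.d with hS
  have memS : ∀ k, k ∈ S ↔ k < X.numA ∧ 4 * cost k < X.d := by simp [hS]
  set m : ℕ → ℕ := fun k => min (p k / X.γ) (X.numB - 1) with hm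
  -- the start of the window `m k` is close to `p k`
  have near : ∀ k ∈ S, X.startB (m k) ≤ p k ∧ p k ≤ X.startB (m k) + X.γ + cost k := by
    intro k hk
    rw [memS] at hk
    have h1 : X.startB (m k) = min (p k / X.γ * X.γ) (X.n - X.d) := X.startB_min hγ _
    have h2 := Nat.div_mul_le_self (p k) X.γ
    have h3 := Nat.lt_div_mul_add (a := p k) (b := X.γ) hγ
    have h4 := (hlen k hk.1).1
    have h5 := (hp' X.numA le_rfl (k + 1) (by omega)).trans hpn
    have h6 := hp k hk.1
    omega
  set Φ : ℕ → ℕ := fun k => ∑ l ∈ Finset.range k, (5 * cost l + X.γ) with hΦ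
  have hΦs : ∀ k, Φ (k + 1) = Φ k + (5 * cost k + X.γ) := fun k => Finset.sum_range_succ _ _
  have hΦm : ∀ i j, i ≤ j → Φ i ≤ Φ j := fun i j hij =>
    Finset.sum_le_sum_of_subset (Finset.range_mono hij)
  -- `i` is the last matched window among the first `K`; the inequality between `p K` and
  -- `p (i + 1)` bounds the lengths of the pieces of the unmatched windows after `i`
  have gaps : ∀ K ≤ X.numA,
      imgs (fun k => if k ∈ S then some (m k) else none) K = [] ∨
      ∃ l i, imgs (fun k => if k ∈ S then some (m k) else none) K = l ++ [m i] ∧ i ∈ S ∧ i < K ∧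
        p K + Φ (i + 1) ≤ p (i + 1) + Φ K ∧
        X.gapSum (imgs (fun k => if k ∈ S then some (m k) else none) K) ≤ Φ i + Φ (i + 1) := by
    intro K hK
    induction K with
    | zero => left; simp [imgs]
    | succ K ih =>
      by_cases hKS : K ∈ S
      · right
        have h1 : (fun k => if k ∈ S then some (m k) else none) K = some (m K) := by simp [hKS]
        rw [imgs_succ_some h1]
        rcases ih (by omega) with h | ⟨l, i, h2, h3, h4, h5, h6⟩
        · exact ⟨[], K, by rw [h], hKS, by omega, by omega, by rw [h]; simp⟩
        · refine ⟨l ++ [m i], K, by rw [h2], hKS, by omega, by omega, ?_⟩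
          rw [h2, gapSum_concat, ← h2]
          have h7 := near i h3
          have h8 := near K hKS
          have h9 := hlen i (by omega)
          have h10 := hp' K (by omega) (i + 1) (by omega)
          have h11 := hp i (by omega)
          have h12 := hΦm (i + 1) K (by omega)
          have h13 := hΦs i
          have h14 := hΦs K
          unfold gap Nat.dist
          omega
      · have h1 : (fun k => if k ∈ S then some (m k) else none) K = none := by simp [hKS]
        rw [imgs_succ_none h1]
        rcases ih (by omega) with h | ⟨l, i, h2, h3, h4, h5, h6⟩
        · left; exact h
        · right
          refine ⟨l, i, h2, h3, by omega, ?_, h6⟩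
          have h7 := hlen K (by omega)
          have h8 := hp K (by omega)
          have h9 := hΦs K
          have h10 : X.d ≤ 4 * cost K := by
            rw [memS] at hKS; by_contra h; exact hKS ⟨by omega, by omega⟩
          omega
  refine ⟨⟨S, m, cost, fun k hk => ((memS k).1 hk).1, fun k _ => ?_, ?_, ?_, ?_, ?_, ?_⟩⟩
  · have := X.numB_pos
    simp only [hm]; omega
  · intro k hk k' hk' hkk'
    have h1 := near k hk
    have h2 := near k' hk'
    have hk1 := (memS k).1 hk
    have hk2 := (memS k').1 hk'
    have h3 := hlen k hk1.1
    have h4 := hp' k' (by omega) (k + 1) (by omega)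
    have h5 : X.startB (m k) < X.startB (m k') := by omega
    by_contra! h
    exact absurd (X.startB_mono h) (not_le.2 h5)
  · exact le_trans (Nat.le_add_right _ _) hsum
  · intro k hk hkS
    rw [memS] at hkS; by_contra h; exact hkS ⟨hk, by omega⟩
  · intro k hk
    have h1 := near k hk
    have h2 := hlen k ((memS k).1 hk).1
    have h3 := hp k ((memS k).1 hk).1
    have h4 := editDist_triangle (X.word A B (Sum.inl k)) (slice B (p k) (p (k + 1)))
      (X.word A B (Sum.inr (m k)))
    have h5 := editDist_slice_slice B (p k) (p (k + 1)) (X.startB (m k)) (X.startB (m k) + X.d)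
    rw [← word_inr X A B] at h5
    simp only [Nat.dist] at h5
    change editDist _ _ ≤ cost k + _ at h4
    omega
  · rcases gaps X.numA le_rfl with h | ⟨l, i, h2, h3, h4, h5, h6⟩
    · rw [h]; simp
    · refine h6.trans ?_
      have h7 := hΦm i X.numA h4.le
      have h8 := hΦm (i + 1) X.numA h4
      change _ ≤ 2 * Φ X.numA
      omega

/-- The value of the estimate is controlled by the estimates of the matched windows. -/
lemma edOf_le_of_matching (M : X.Matching A B) (E : ℕ → ℕ → ℕ) (W : ℕ)
    (hW : ∑ k ∈ M.S, E k (M.m k) ≤ W) :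
    X.edOf E ≤ 2 * W + 28 * editDist A B + 4 * (X.numA * X.γ) + 2 * (X.n % X.d) := by
  set f : ℕ → Option ℕ := fun k => if k ∈ M.S then some (M.m k) else none with hf
  have hfS : ∀ k j, f k = some j → k ∈ M.S ∧ M.m k = j := by
    intro k j h
    by_cases hk : k ∈ M.S
    · simp only [hf, hk, if_true, Option.some.injEq] at h
      exact ⟨hk, h⟩
    · simp [hf, hk] at h
  have hmono : X.Monotone f X.numA := by
    refine ⟨fun k _ j h => ?_, fun k k' j j' hkk' _ h h' => ?_⟩
    · obtain ⟨hk, rfl⟩ := hfS k j h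
      exact M.lt_numB k hk
    · obtain ⟨hk, rfl⟩ := hfS k j h
      obtain ⟨hk', rfl⟩ := hfS k' j' h'
      exact M.strictMono.monotoneOn hk hk' hkk'
  have h1 := X.edOf_le E hmono
  have h2 := M.gaps
  change X.gapSum (imgs f X.numA) ≤ _ at h2
  rw [Finset.sum_add_distrib, ← Finset.mul_sum, Finset.sum_const, Finset.card_range,
    smul_eq_mul] at h2
  have h3 := M.sum_cost
  have h4 : X.estSum E f X.numA ≤
      W + 4 * ∑ k ∈ Finset.range X.numA, M.cost k := by
    have h5 : ∑ k ∈ Finset.range X.numA, (if k ∈ M.S then E k (M.m k) else 0) =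
        ∑ k ∈ M.S, E k (M.m k) := by
      rw [← Finset.sum_filter]
      congr 1
      ext k
      simpa using fun hk => M.lt_numA k hk
    refine le_trans ?_ (add_le_add_left (h5.le.trans hW) _)
    rw [Finset.mul_sum, ← Finset.sum_add_distrib]
    refine Finset.sum_le_sum fun k hk => ?_
    by_cases hkS : k ∈ M.S
    · simp [hf, hkS]
    · simpa [hf, hkS] using M.unmatched k (Finset.mem_range.1 hk) hkS
  omega

lemma edOf_le_trivial (E : ℕ → ℕ → ℕ) : X.edOf E ≤ 2 * X.n := by
  have hmono : X.Monotone (fun _ => none) X.numA :=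
    ⟨fun k _ j h => by simp at h, fun k k' j j' _ _ h => by simp at h⟩
  have h1 := X.edOf_le E hmono
  have h2 : imgs (fun _ => none) X.numA = [] := by simp [imgs]
  have h3 : X.estSum E (fun _ => none) X.numA = X.numA * X.d := by simp [estSum]
  have h4 := X.numA_mul_d
  rw [h2, h3] at h1
  simp only [gapSum_nil] at h1
  omega

end Matching

end Inst

/-! ### The dynamic program for the value of the estimate -/

namespace Inst

variable (X : Inst) (E : ℕ → ℕ → ℕ)

/-- One step of the recursion of the dynamic program. -/
noncomputable def nextCost (F : ℕ → ℕ∞) (k j : ℕ) : ℕ∞ :=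
  min (F j + ((2 * X.d : ℕ) : ℕ∞)) (((2 * E k j : ℕ) : ℕ∞) + min ((2 * X.d * k : ℕ) : ℕ∞)
    ((Finset.range (j + 1)).inf fun i => F i + ((2 * X.gap i j : ℕ) : ℕ∞)))

/-- The least cost of a monotone mapping of the first `K` windows of `A` whose last mapped window
goes to the `j`-th window of `B`. -/
noncomputable def bestCost : ℕ → ℕ → ℕ∞
  | 0 => fun _ => ⊤
  | K + 1 => X.nextCost E (bestCost K) K

lemma foldl_min {ι : Type*} [DecidableEq ι] (g : ι → ℕ∞) (l : List ι) (c : ℕ∞) :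
    l.foldl (fun m h => min m (g h)) c = c ⊓ l.toFinset.inf g := by
  induction l generalizing c with
  | nil => simp
  | cons x l ih => simp only [List.foldl_cons, ih, List.toFinset_cons, Finset.inf_insert,
      inf_assoc]

lemma inf_add (s : Finset ℕ) (g : ℕ → ℕ∞) (c : ℕ∞) :
    s.inf g + c = s.inf fun i => g i + c :=
  Finset.apply_inf_eq_inf_comp_of_linearOrder (fun x : ℕ∞ => x + c)
    (fun _ _ h => add_le_add_left h c) (by simp)

/-- Windows that are more than `d / γ + 1` places apart do not overlap. -/
lemma gap_of_far (hγ : 1 ≤ X.γ) {i j : ℕ} (hij : i + (X.d / X.γ + 1) < j) (hj : j < X.numB) :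
    X.gap i j = X.startB j - (X.startB i + X.d) ∧ X.startB i + X.d ≤ X.startB j := by
  have h1 : X.startB i + X.d ≤ X.startB j := by
    obtain ⟨j, rfl⟩ : ∃ j', j = j' + 1 :=
      ⟨j - 1, (Nat.succ_pred_eq_of_pos (Nat.zero_lt_of_lt hij)).symm⟩
    have h2 : (i + X.d / X.γ + 1) * X.γ ≤ X.startB (j + 1) := by
      refine le_trans ?_ (X.startB_mono (Nat.le_succ j))
      rw [X.startB_of_lt hγ hj]
      exact Nat.mul_le_mul_right _ (by omega)
    have h3 : X.startB i ≤ i * X.γ := min_le_left _ _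
    have h4 := Nat.lt_div_mul_add (a := X.d) (b := X.γ) hγ
    have h5 : (i + X.d / X.γ + 1) * X.γ = i * X.γ + X.d / X.γ * X.γ + X.γ := by ring
    omega
  exact ⟨by rw [gap, Nat.dist_eq_sub_of_le h1], h1⟩

variable {P : Query → Prop}

lemma runs_rowStep (hγ : 1 ≤ X.γ) (F : ℕ → ℕ∞) (k : ℕ) :
    (X.rowStep E F k).Runs P (fun F' => ∀ j < X.numB, F' j = X.nextCost E F k j)
      (X.numB * (X.d / X.γ + 1 + 2 : ℕ)) 0 := by
  set s := X.d / X.γ + 1 with hs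
  have hs0 : (0 : ℤ) ≤ (X.d : ℤ) / (X.γ : ℤ) := by positivity
  let far : ℕ → ℕ∞ := fun j => (Finset.range (j - s)).inf fun i =>
    F i + ((2 * X.gap i j : ℕ) : ℕ∞)
  let I : ℕ → ℕ∞ × (ℕ → ℕ∞) → Prop := fun i st =>
    st.1 = (if i = 0 then ⊤ else far (i - 1)) ∧ ∀ j < i, st.2 j = X.nextCost E F k j
  rw [rowStep]
  refine ((Prog.Runs.foldlM (List.range X.numB) I
    (a := (s + 2 : ℕ)) (c := 0) ?_ _ ?_).bind fun st hst =>
      Prog.Runs.ret (Q := fun F' : ℕ → ℕ∞ => ∀ j < X.numB, F' j = X.nextCost E F k j) ?_).mono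
      (fun _ h => h) ?_ ?_
  · intro j hj st hst
    simp only [List.length_range] at hj
    simp only [List.getElem_range]
    refine ((Prog.Runs.spend _).bind fun _ _ =>
      Prog.Runs.ret (Q := I (j + 1)) ?_).mono (fun _ h => h) (by simp [← hs]) (by simp)
    have hfar : (if s < j then
        min (st.1 + ((2 * (X.startB j - X.startB (j - 1)) : ℕ) : ℕ∞))
          (F (j - s - 1) + ((2 * X.gap (j - s - 1) j : ℕ) : ℕ∞))
      else ⊤) = far j := by
      split_ifs with h
      · rw [hst.1, if_neg (by omega)]
        have h1 : j - s = (j - s - 1) + 1 := by omega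
        simp only [far]
        rw [inf_add, h1, Finset.range_add_one, Finset.inf_insert, inf_comm,
          show j - s - 1 + 1 - 1 = j - s - 1 by omega,
          show j - 1 - s = j - s - 1 by omega]
        congr 1
        refine Finset.inf_congr rfl fun i hi => ?_
        rw [Finset.mem_range] at hi
        have h2 := X.gap_of_far hγ (i := i) (j := j) (by omega) hj
        have h3 := X.gap_of_far hγ (i := i) (j := j - 1) (by omega) (by omega)
        have h4 := X.startB_mono (show j - 1 ≤ j by omega)
        rw [add_assoc, ← Nat.cast_add]
        congr 2
        omega
      · simp [far, show j - s = 0 by omega]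
    have hnear : ((List.range (s + 1)).filter (fun h => decide (h ≤ j))).foldl
        (fun m h => min m (F (j - h) + ((2 * X.gap (j - h) j : ℕ) : ℕ∞))) ⊤ ⊓ far j =
        (Finset.range (j + 1)).inf fun i => F i + ((2 * X.gap i j : ℕ) : ℕ∞) := by
      rw [foldl_min (fun h => F (j - h) + ((2 * X.gap (j - h) j : ℕ) : ℕ∞)), top_inf_eq]
      apply le_antisymm
      · refine Finset.le_inf fun i hi => ?_
        rw [Finset.mem_range] at hi
        by_cases h : i < j - s
        · exact inf_le_right.trans (Finset.inf_le (Finset.mem_range.2 h))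
        · refine inf_le_left.trans ?_
          have h2 : j - i ∈ ((List.range (s + 1)).filter (fun h => decide (h ≤ j))).toFinset := by
            simp; omega
          refine (Finset.inf_le h2).trans (le_of_eq ?_)
          rw [show j - (j - i) = i by omega]
      · refine le_inf ?_ ?_
        · refine Finset.le_inf fun h _ => ?_
          exact Finset.inf_le (f := fun i => F i + ((2 * X.gap i j : ℕ) : ℕ∞)) (by simp)
        · exact Finset.inf_mono (Finset.range_mono (by omega))
    refine ⟨?_, ?_⟩
    · simpa using hfar
    · intro i hi
      by_cases hij : i = j
      · subst hij
        simp only [Function.update_self]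
        rw [nextCost, ← hnear, inf_comm (a := List.foldl _ _ _), ← hfar]
      · simp only [Function.update_of_ne hij]
        exact hst.2 i (by omega)
  · exact ⟨by simp, by simp⟩
  · simpa using hst.2
  · simp
  · simp

lemma nextCost_congr {F F' : ℕ → ℕ∞} (h : ∀ j < X.numB, F j = F' j) (k : ℕ) {j : ℕ}
    (hj : j < X.numB) : X.nextCost E F k j = X.nextCost E F' k j := by
  unfold nextCost
  rw [h j hj]
  congr 2
  congr 1
  refine Finset.inf_congr rfl fun i hi => ?_
  rw [h i (by have := Finset.mem_range.1 hi; omega)]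

/-- Every monotone mapping costs at least as much as the dynamic program says. -/
lemma bestCost_le {f : ℕ → Option ℕ} (hf : X.Monotone f X.numA) (K : ℕ)
    (hK : K ≤ X.numA) :
    (imgs f K = [] ∧ X.estSum E f K = X.d * K) ∨ ∃ l j, imgs f K = l ++ [j] ∧
      X.bestCost E K j ≤ ((2 * X.estSum E f K + 2 * X.gapSum (imgs f K) : ℕ) : ℕ∞) := by
  induction K with
  | zero => left; simp [imgs, estSum]
  | succ K ih =>
    cases hfK : f K with
    | none =>
      rw [imgs_succ_none hfK, X.estSum_succ_none E hfK]
      rcases ih (by omega) with ⟨h1, h2⟩ | ⟨l, j, h1, h2⟩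
      · left; exact ⟨h1, by rw [h2]; ring⟩
      · right
        refine ⟨l, j, h1, (min_le_left _ _).trans ?_⟩
        refine (add_le_add_left h2 _).trans ?_
        rw [← Nat.cast_add]
        exact Nat.cast_le.2 (by omega)
    | some j =>
      right
      rw [imgs_succ_some hfK, X.estSum_succ_some E hfK]
      rcases ih (by omega) with ⟨h1, h2⟩ | ⟨l, i, h1, h2⟩
      · refine ⟨[], j, by rw [h1], (min_le_right _ _).trans ?_⟩
        refine (add_le_add_right (min_le_left _ _) _).trans ?_
        rw [← Nat.cast_add, h1, h2]
        exact Nat.cast_le.2 (by simp; linarith)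
      · refine ⟨l ++ [i], j, by rw [h1], (min_le_right _ _).trans ?_⟩
        refine (add_le_add_right (min_le_right _ _) _).trans ?_
        have hij : i ≤ j := by
          obtain ⟨k, hk, h3⟩ := mem_imgs.1 (show i ∈ imgs f K by rw [h1]; simp)
          exact hf.mono k K i j hk.le (by omega) h3 hfK
        refine (add_le_add_right (Finset.inf_le (b := i) (by simp; omega)) _).trans ?_
        refine (add_le_add_right (add_le_add_left h2 _) _).trans ?_
        rw [h1, gapSum_concat, ← Nat.cast_add, ← Nat.cast_add]
        exact Nat.cast_le.2 (by omega)

/-- The costs found by the dynamic program are attained. -/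
lemma exists_bestCost (K j c : ℕ) (hj : j < X.numB) (h : X.bestCost E K j = c) :
    ∃ f l, X.Monotone f K ∧ imgs f K = l ++ [j] ∧
      2 * X.estSum E f K + 2 * X.gapSum (imgs f K) = c := by
  induction K generalizing j c with
  | zero => simp [bestCost] at h
  | succ K ih =>
    -- extend a mapping of the first `K` windows
    have ext : ∀ (f : ℕ → Option ℕ) (o : Option ℕ), X.Monotone f K → (∀ i ∈ o, i < X.numB) →
        (∀ i ∈ o, ∀ i' ∈ imgs f K, i' ≤ i) → X.Monotone (Function.update f K o) (K + 1) := by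
      intro f o hf ho hle
      refine ⟨fun k hk i hi => ?_, fun k k' i i' hkk' hk' hi hi' => ?_⟩
      · by_cases hkK : k = K
        · subst hkK; rw [Function.update_self] at hi; exact ho i hi
        · rw [Function.update_of_ne hkK] at hi; exact hf.lt k (by omega) i hi
      · by_cases hkK : k' = K
        · subst hkK
          rw [Function.update_self] at hi'
          by_cases hkK : k = k'
          · subst hkK; rw [Function.update_self] at hi
            rw [hi] at hi'; exact (Option.some.inj hi').le
          · rw [Function.update_of_ne hkK] at hi
            exact hle i' hi' i (mem_imgs.2 ⟨k, by omega, hi⟩)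
        · rw [Function.update_of_ne hkK] at hi'
          rw [Function.update_of_ne (by omega)] at hi
          exact hf.mono k k' i i' hkk' (by omega) hi hi'
    have agree : ∀ (f : ℕ → Option ℕ) (o : Option ℕ), ∀ k < K, Function.update f K o k = f k :=
      fun f o k hk => Function.update_of_ne (by omega) _ _
    change X.nextCost E (X.bestCost E K) K j = c at h
    rw [nextCost] at h
    rcases min_choice (X.bestCost E K j + ((2 * X.d : ℕ) : ℕ∞)) (((2 * E K j : ℕ) : ℕ∞) +
      min ((2 * X.d * K : ℕ) : ℕ∞)
      ((Finset.range (j + 1)).inf fun i =>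
        X.bestCost E K i + ((2 * X.gap i j : ℕ) : ℕ∞))) with h1 | h1
    · rw [h1] at h
      obtain ⟨c', hc'⟩ := ENat.ne_top_iff_exists.1
        (show X.bestCost E K j ≠ ⊤ by intro h2; rw [h2] at h; simp at h)
      obtain ⟨f, l, hf, h3, h4⟩ := ih j c' hj hc'.symm
      rw [← hc', ← Nat.cast_add, Nat.cast_inj] at h
      have h5 : Function.update f K none K = none := Function.update_self _ _ _
      refine ⟨Function.update f K none, l, ext f none hf (by simp) (by simp), ?_, ?_⟩
      · rw [imgs_succ_none h5, imgs_congr (agree f none), h3]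
      · rw [imgs_succ_none h5, imgs_congr (agree f none), X.estSum_succ_none E h5,
          X.estSum_congr E (agree f none)]
        omega
    · rw [h1] at h
      rcases min_choice ((2 * X.d * K : ℕ) : ℕ∞) ((Finset.range (j + 1)).inf fun i =>
        X.bestCost E K i + ((2 * X.gap i j : ℕ) : ℕ∞)) with h2 | h2
      · rw [h2, ← Nat.cast_add, Nat.cast_inj] at h
        have h5 : Function.update (fun _ : ℕ => (none : Option ℕ)) K (some j) K = some j :=
          Function.update_self _ _ _
        have h6 : imgs (fun _ => none) K = [] := by simp [imgs]
        refine ⟨Function.update (fun _ => none) K (some j), [],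
          ext _ _ ⟨fun k _ j h => by simp at h, fun k k' j j' _ _ h => by simp at h⟩
            (by simpa using hj) (by simp [h6]), ?_, ?_⟩
        · rw [imgs_succ_some h5, imgs_congr (agree _ _), h6]
        · rw [imgs_succ_some h5, imgs_congr (agree _ _), h6, X.estSum_succ_some E h5,
            X.estSum_congr E (agree _ _)]
          simp [estSum]
          linarith
      · rw [h2] at h
        obtain ⟨i, hi, h3⟩ := Finset.exists_mem_eq_inf (Finset.range (j + 1)) (by simp)
          (fun i => X.bestCost E K i + ((2 * X.gap i j : ℕ) : ℕ∞))
        rw [h3] at h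
        have hij : i ≤ j := by simpa [Nat.lt_succ_iff] using hi
        obtain ⟨c', hc'⟩ := ENat.ne_top_iff_exists.1
          (show X.bestCost E K i ≠ ⊤ by intro h2; rw [h2] at h; simp at h)
        obtain ⟨f, l, hf, h4, h5⟩ := ih i c' (by omega) hc'.symm
        rw [← hc', ← Nat.cast_add, ← Nat.cast_add, Nat.cast_inj] at h
        have h6 : Function.update f K (some j) K = some j := Function.update_self _ _ _
        refine ⟨Function.update f K (some j), l ++ [i], ext f _ hf (by simpa using hj) ?_, ?_, ?_⟩
        · intro j' hj' i' hi'
          simp only [Option.mem_def, Option.some.injEq] at hj'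
          subst hj'
          refine le_trans ?_ hij
          -- the last image is the largest one
          have h7 : i ∈ imgs f K := by rw [h4]; simp
          clear h h1 h2 h3 hc' h5
          have h8 : (imgs f K).Pairwise (· ≤ ·) := by
            unfold imgs
            rw [List.pairwise_filterMap]
            refine List.Pairwise.imp_of_mem ?_ List.pairwise_lt_range
            intro k k' hk hk' hkk' a ha a' ha'
            exact hf.mono k k' a a' hkk'.le (by simpa using hk') ha ha'
          rw [h4] at h8 hi'
          rcases List.mem_append.1 hi' with h9 | h9
          · exact (List.pairwise_append.1 h8).2.2 i' h9 i (by simp)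
          · simp at h9; exact h9.le
        · rw [imgs_succ_some h6, imgs_congr (agree _ _), h4]
        · rw [imgs_succ_some h6, imgs_congr (agree _ _), h4, gapSum_concat, ← h4,
            X.estSum_succ_some E h6, X.estSum_congr E (agree _ _)]
          omega

lemma edOf_eq (hγ : 1 ≤ X.γ) :
    (X.edOf E : ℕ∞) = min ((2 * X.d * X.numA : ℕ) : ℕ∞)
      ((Finset.range X.numB).inf fun j => X.bestCost E X.numA j) + (2 * (X.n % X.d) : ℕ) := by
  apply le_antisymm
  · rcases min_choice ((2 * X.d * X.numA : ℕ) : ℕ∞)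
      ((Finset.range X.numB).inf fun j => X.bestCost E X.numA j) with h | h
    · rw [h, ← Nat.cast_add]
      refine Nat.cast_le.2 ((X.edOf_le_trivial E).trans ?_)
      have := X.numA_mul_d
      have h2 : X.d * X.numA = X.numA * X.d := mul_comm _ _
      rw [mul_assoc]
      omega
    · rw [h]
      obtain ⟨j, hj, h1⟩ := Finset.exists_mem_eq_inf (Finset.range X.numB)
        (by simpa using X.numB_pos.ne') (fun j => X.bestCost E X.numA j)
      rw [h1]
      by_cases htop : X.bestCost E X.numA j = ⊤
      · simp [htop]
      obtain ⟨c, hc⟩ := ENat.ne_top_iff_exists.1 htop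
      obtain ⟨f, l, hf, -, h2⟩ := X.exists_bestCost E _ j c (by simpa using hj) hc.symm
      rw [← hc, ← Nat.cast_add, ← h2]
      exact Nat.cast_le.2 (X.edOf_le E hf)
  · obtain ⟨f, hf, h⟩ := X.exists_edOf_eq hγ E
    rw [h]
    push_cast
    refine add_le_add_left ?_ _
    rcases X.bestCost_le E hf X.numA le_rfl with ⟨h1, h2⟩ | ⟨l, j, h1, h2⟩
    · refine (min_le_left _ _).trans ?_
      rw [h1, h2]
      push_cast
      simp [mul_assoc]
    · refine (min_le_right _ _).trans ((Finset.inf_le (b := j) ?_).trans ?_)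
      · obtain ⟨k, hk, h3⟩ := mem_imgs.1 (show j ∈ imgs f X.numA by rw [h1]; simp)
        exact Finset.mem_range.2 (hf.lt k hk j h3)
      · exact_mod_cast h2

/-- The dynamic program computes the value of the estimate. -/
lemma runs_edFromEstimates (hγ : 1 ≤ X.γ) :
    (X.edFromEstimates E).Runs P (fun v => v = X.edOf E)
      (X.numA * (X.numB * (X.d / X.γ + 1 + 2 : ℕ)) + 2 * X.numB + 1) 0 := by
  rw [edFromEstimates]
  refine ((Prog.Runs.spend _).bind fun _ _ => (Prog.Runs.foldlM (List.range X.numA)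
    (fun K F => ∀ j < X.numB, F j = X.bestCost E K j)
    (a := X.numB * (X.d / X.γ + 1 + 2 : ℕ)) (c := 0) ?_ _ ?_).bind fun F hF =>
      (Prog.Runs.spend _).bind fun _ _ =>
      Prog.Runs.ret (Q := fun v => v = X.edOf E) ?_).mono (fun _ h => h) ?_ ?_
  · intro K hK F hF
    rw [List.getElem_range]
    refine (X.runs_rowStep E hγ F K).mono (fun F' hF' j hj => ?_) le_rfl le_rfl
    rw [hF' j hj, X.nextCost_congr E hF K hj]; rfl
  · intro j _; rfl
  · simp only [List.length_range] at hF
    have h1 := X.edOf_eq E hγ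
    rw [foldl_min]
    have h2 : (List.range X.numB).toFinset = Finset.range X.numB := by ext; simp
    rw [h2, Finset.inf_congr rfl fun j hj => hF j (Finset.mem_range.1 hj)]
    set c := ((2 * X.d * X.numA : ℕ) : ℕ∞) ⊓
      ((Finset.range X.numB).inf fun j => X.bestCost E X.numA j) with hc
    have h3 : c ≠ ⊤ := ne_top_of_le_ne_top (ENat.natCast_ne_top _) inf_le_left
    obtain ⟨c', hc'⟩ := ENat.ne_top_iff_exists.1 h3
    change (X.edOf E : ℕ∞) = c + _ at h1
    rw [← hc'] at h1 ⊢
    rw [ENat.toNat_natCast]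
    exact_mod_cast h1.symm
  · simp; linarith
  · simp

end Inst

/-! ### Intervals of windows -/

/-- The `i`-th interval of length `s`. -/
def grid (side : Bool) (s i : ℕ) : Interval := ⟨side, i * s, s⟩

lemma grid_seven_inl (s i k : ℕ) :
    (grid false s i).seven (Sum.inl k) = true ↔ i * s ≤ k + 3 * s ∧ k < i * s + 4 * s :=
  decide_eq_true_iff

lemma grid_seven_inr (s i k : ℕ) :
    (grid true s i).seven (Sum.inr k) = true ↔ i * s ≤ k + 3 * s ∧ k < i * s + 4 * s :=
  decide_eq_true_iff

lemma grid_seven_inl_true (s i k : ℕ) : (grid true s i).seven (Sum.inl k) = false := by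
  simp [grid, Interval.seven]

lemma grid_seven_inr_false (s i k : ℕ) : (grid false s i).seven (Sum.inr k) = false := by
  simp [grid, Interval.seven]

/-- A position lies in the sevenfold enlargements of at most seven intervals of a given length;
the intervals may be listed with multiplicity `c`. -/
lemma card_grid_le (M c S k : ℕ) (hc : 0 < c) (hS : 0 < S) :
    ((Finset.range M).filter fun i => i / c * S ≤ k + 3 * S ∧ k < i / c * S + 4 * S).card ≤
      7 * c := by
  have hsub : ((Finset.range M).filter fun i => i / c * S ≤ k + 3 * S ∧ k < i / c * S + 4 * S) ⊆
      Finset.Ico ((k / S - 3) * c) ((k / S + 4) * c) := by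
    intro i hi
    obtain ⟨-, h1, h2⟩ := Finset.mem_filter.1 hi
    have h3 : i / c ≤ (k + 3 * S) / S := (Nat.le_div_iff_mul_le hS).2 h1
    rw [Nat.add_mul_div_right _ _ hS] at h3
    have h4 : k / S < i / c + 4 := by
      rw [Nat.div_lt_iff_lt_mul hS]; linarith
    rw [Finset.mem_Ico, ← Nat.le_div_iff_mul_le hc, ← Nat.div_lt_iff_lt_mul hc]
    generalize i / c = a at *
    generalize k / S = q at *
    omega
  refine (Finset.card_le_card hsub).trans ?_
  rw [Nat.card_Ico, ← Nat.sub_mul]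
  exact Nat.mul_le_mul_right _ (by omega)

lemma countP_range_grid_le (M s : ℕ) (hs : 0 < s) (side : Bool) (w : Win) :
    (List.range M).countP (fun i => (grid side s i).seven w) ≤
      match side, w with
      | false, Sum.inl _ => 7
      | true, Sum.inr _ => 7
      | _, _ => 0 := by
  have key : ∀ k, (List.range M).countP
      (fun i => decide (i * s ≤ k + 3 * s ∧ k < i * s + 4 * s)) ≤ 7 := by
    intro k
    have h := card_grid_le M 1 s k one_pos hs
    rw [List.countP_eq_length_filter]
    simp only [Nat.div_one, mul_one] at h
    refine le_of_eq_of_le ?_ h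
    rw [← List.toFinset_card_of_nodup (List.nodup_range.filter _)]
    congr 1
    ext i
    simp
  rcases side with _ | _ <;> rcases w with k | k
  · simp only [grid, Interval.seven, Bool.not_false, Bool.true_and]
    exact key k
  · simp [grid, Interval.seven]
  · simp [grid, Interval.seven]
  · simp only [grid, Interval.seven, Bool.true_and]
    exact key k

namespace Inst

variable (X : Inst)

lemma intervals_eq : X.intervals = (List.range (invEps X.L X.imax + 1)).flatMap fun e =>
    (List.range ((X.numA + X.base ^ e - 1) / X.base ^ e)).map (grid false (X.base ^ e)) ++
    (List.range ((X.numB + X.base ^ e - 1) / X.base ^ e)).map (grid true (X.base ^ e)) := rfl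

lemma ceil_div_le (x s : ℕ) (hs : 0 < s) : (x + s - 1) / s ≤ x := by
  rw [Nat.div_le_iff_le_mul_add_pred hs]
  have : x ≤ s * x := Nat.le_mul_of_pos_left _ hs
  omega

lemma intervals_length_le (hb : 0 < X.base) :
    X.intervals.length ≤ (invEps X.L X.imax + 1) * X.t := by
  rw [intervals_eq, List.length_flatMap]
  refine (List.sum_le_card_nsmul _ X.t ?_).trans (by simp)
  intro x hx
  obtain ⟨e, -, rfl⟩ := List.mem_map.1 hx
  simp only [List.length_append, List.length_map, List.length_range]
  exact add_le_add (ceil_div_le _ _ (pow_pos hb e)) (ceil_div_le _ _ (pow_pos hb e))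

lemma countP_intervals_le (hb : 0 < X.base) (w : Win) :
    X.intervals.countP (fun J => J.seven w) ≤ 7 * (invEps X.L X.imax + 1) := by
  rw [intervals_eq, List.countP_flatMap]
  refine (List.sum_le_card_nsmul _ 7 ?_).trans (by simp [mul_comm])
  intro x hx
  obtain ⟨e, -, rfl⟩ := List.mem_map.1 hx
  have h1 := countP_range_grid_le ((X.numA + X.base ^ e - 1) / X.base ^ e) _ (pow_pos hb e) false w
  have h2 := countP_range_grid_le ((X.numB + X.base ^ e - 1) / X.base ^ e) _ (pow_pos hb e) true w
  simp only [Function.comp, List.countP_append, List.countP_map]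
  simp only [Function.comp_def]
  rcases w with k | k <;> simp only at h1 h2 <;> omega

lemma sum_countP_le (hb : 0 < X.base) (C : List Win) :
    (X.intervals.map fun J => C.countP J.seven).sum ≤
      7 * (invEps X.L X.imax + 1) * C.length := by
  induction C with
  | nil => simp
  | cons w C ih =>
    have h1 : (X.intervals.map fun J => (w :: C).countP J.seven).sum =
        (X.intervals.map fun J => C.countP J.seven).sum +
          X.intervals.countP (fun J => J.seven w) := by
      generalize X.intervals = l
      induction l with
      | nil => simp
      | cons J l ih =>
        rw [List.map_cons, List.sum_cons, ih, List.countP_cons, List.map_cons, List.sum_cons,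
          List.countP_cons]
        omega
    have h2 := X.countP_intervals_le hb w
    rw [h1, List.length_cons]
    linarith

/-! ### The pure parts of the query algorithm -/

/-- The value of `snap`. -/
noncomputable def sn (ℓ : ℕ) : ℕ := if ℓ = 0 then 0 else X.base ^ Nat.log X.base ℓ

lemma sn_le (ℓ : ℕ) : X.sn ℓ ≤ ℓ := by
  unfold sn
  split_ifs with h
  · omega
  · exact Nat.pow_log_le_self _ h

lemma le_mul_sn (hb : 1 < X.base) (ℓ : ℕ) : ℓ ≤ X.base * X.sn ℓ := by
  unfold sn
  split_ifs with h
  · omega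
  · rw [← pow_succ']
    exact (Nat.lt_pow_succ_log_self hb ℓ).le

lemma sn_pos (hb : 0 < X.base) {ℓ : ℕ} (h : 0 < ℓ) : 0 < X.sn ℓ := by
  unfold sn; rw [if_neg (by omega)]; exact pow_pos hb _

/-- The clique is big. -/
def Big (C live : List Win) : Prop :=
  X.rho⁻¹ < (X.sn C.length : ℝ) / (X.sn live.length : ℝ)

/-- The clique is dense on `7 J`. -/
def Dense (C live : List Win) (J : Interval) : Prop :=
  live.any J.seven = true ∧
    X.rho ≤ ((X.sn (C.countP J.seven) : ℝ) / (X.sn (live.countP J.seven) : ℝ)) /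
      ((X.sn C.length : ℝ) / (X.sn live.length : ℝ))

open scoped Classical in
/-- The set of live windows of the next round. -/
noncomputable def nextLive (C live : List Win) : List Win :=
  live.filter fun w => (X.intervals.filter fun J => decide (X.Dense C live J)).any
    fun J => J.seven w

lemma mem_nextLive {C live : List Win} {w : Win} :
    w ∈ X.nextLive C live ↔
      w ∈ live ∧ ∃ J ∈ X.intervals, X.Dense C live J ∧ J.seven w = true := by
  simp [nextLive]

lemma nextLive_sublist (C live : List Win) : (X.nextLive C live).Sublist live :=
  List.filter_sublist

variable {P : Query → Prop}

lemma runs_snap (ℓ : ℕ) : (X.snap ℓ).Runs P (fun v => v = X.sn ℓ) (ℓ + 1) 0 := by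
  refine ((Prog.Runs.spend _).bind fun _ _ =>
    Prog.Runs.ret (Q := fun v => v = X.sn ℓ) rfl).mono (fun _ h => h) ?_ (by simp)
  have : Nat.log X.base ℓ ≤ ℓ := Nat.log_le_self _ _
  push_cast
  have : (Nat.log X.base ℓ : ℝ) ≤ ℓ := by exact_mod_cast this
  linarith

open scoped Classical in
lemma runs_isDense (C live : List Win) (J : Interval) :
    (X.isDense C live J).Runs P (fun v => v = decide (X.Dense C live J))
      (3 * C.length + 3 * live.length + 6) 0 := by
  rw [isDense]
  refine ((Prog.Runs.spend _).bind fun _ _ => (X.runs_snap _).bind fun cJ hcJ =>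
    (X.runs_snap _).bind fun lJ hlJ => (X.runs_snap _).bind fun c hc =>
    (X.runs_snap _).bind fun l hl => (Prog.Runs.spend _).bind fun _ _ =>
    Prog.Runs.ret (Q := fun v => v = decide (X.Dense C live J)) ?_).mono (fun _ h => h) ?_
    (by simp)
  · subst hcJ hlJ hc hl
    rw [Bool.eq_iff_iff]
    rw [Bool.and_eq_true, decide_eq_true_iff, decide_eq_true_iff]
    rfl
  · have h1 : (C.countP J.seven : ℝ) ≤ C.length := by exact_mod_cast List.countP_le_length
    have h2 : (live.countP J.seven : ℝ) ≤ live.length := by exact_mod_cast List.countP_le_length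
    push_cast
    linarith

end Inst

lemma Prog.Runs.filterList_eq {β : Type} {P : Query → Prop} {test : β → Prog Bool} {f : β → Bool}
    {a c : ℝ} (l : List β) (h : ∀ x ∈ l, (test x).Runs P (fun r => r = f x) a c) :
    (Prog.filterList test l).Runs P (fun r => r = l.filter f) (l.length * (a + 1))
      (l.length * c) := by
  induction l with
  | nil =>
    exact (Prog.Runs.ret (Q := fun r => r = List.filter f []) rfl).mono
      (fun _ h => h) (by simp) (by simp)
  | cons x l ih =>
    rw [Prog.filterList]
    have h2 := ih fun y hy => h y (List.mem_cons_of_mem _ hy)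
    refine ((h x (by simp)).bind fun keep hk => h2.bind fun rest hr =>
      (Prog.Runs.spend 1).bind (Q' := fun r : List β => r = (x :: l).filter f)
        (s' := 0) (q' := 0) fun _ _ => Prog.Runs.ret ?_).mono (fun _ h => h) ?_ ?_
    · subst hk hr
      cases h3 : f x <;> simp [h3]
    · simp; linarith
    · simp; linarith

lemma Prog.Runs.yields {β : Type} {P : Query → Prop} {ok : Query → ℕ → Prop} {Q : β → Prop}
    {p : Prog β} {s q : ℝ} (h : p.Runs P Q s q) : p.Yields ok Q := by
  induction p generalizing s q with
  | ret a => exact h.2.2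
  | tick k p ih => exact ih h
  | draw m f ih => exact fun j => ih j (h j)
  | call x f ih => exact fun v _ => ih v (h.2 v)

namespace Inst

variable (X : Inst) {P : Query → Prop}

open scoped Classical in
lemma runs_denseInterval (C live : List Win) (hC : C.length ≤ live.length) :
    (X.denseInterval X.intervals C live).Runs P
      (fun o => o = if X.Big C live then none else some (X.nextLive C live))
      (10 * (X.intervals.length + 1) * (live.length + 1)) 0 := by
  rw [denseInterval]
  have hC' : (C.length : ℝ) ≤ live.length := by exact_mod_cast hC
  have hI : (0 : ℝ) ≤ X.intervals.length := Nat.cast_nonneg _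
  have hl0 : (0 : ℝ) ≤ live.length := Nat.cast_nonneg _
  refine ((X.runs_snap _).bind fun c hc => (X.runs_snap _).bind fun l hl =>
    (Prog.Runs.spend _).bind
      (s' := 10 * (X.intervals.length + 1) * (live.length + 1) - 2 * live.length - 3) (q' := 0)
      (Q' := fun o => o = if X.Big C live then none else some (X.nextLive C live))
      fun _ _ => ?_).mono (fun _ h => h) ?_ (by simp)
  · subst hc hl
    by_cases hbig : X.Big C live
    · rw [if_pos hbig]
      beta_reduce
      rw [if_pos (show X.rho⁻¹ < _ from hbig)]
      exact (Prog.Runs.ret (Q := fun o => o = none) rfl).mono (fun _ h => h) (by nlinarith) le_rfl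
    · rw [if_neg hbig]
      beta_reduce
      rw [if_neg (show ¬ X.rho⁻¹ < _ from hbig)]
      refine ((Prog.Runs.filterList_eq X.intervals fun J _ => X.runs_isDense C live J).bind
        (s' := live.length * (X.intervals.length + 1)) (q' := 0) fun dense hd => ?_).mono
        (fun _ h => h) ?_ ?_
      · refine ((Prog.Runs.spend _).bind fun _ _ => Prog.Runs.ret ?_).mono (fun _ h => h) ?_
          (by simp)
        · subst hd; rfl
        · have : (dense.length : ℝ) ≤ X.intervals.length := by
            rw [hd]; exact_mod_cast List.length_filter_le _ _
          push_cast
          nlinarith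
      · have h1 : (X.intervals.length : ℝ) * C.length ≤ X.intervals.length * live.length := by
          gcongr
        nlinarith
      · simp
  · push_cast
    linarith

lemma length_filter_any_le (live : List Win) (Js : List Interval) :
    (live.filter fun w => Js.any fun J => J.seven w).length ≤
      (Js.map fun J => live.countP J.seven).sum := by
  induction Js with
  | nil => simp
  | cons J Js ih =>
    rw [List.map_cons, List.sum_cons]
    refine le_trans ?_ (add_le_add_right ih _)
    rw [← List.countP_eq_length_filter, ← List.countP_eq_length_filter]
    clear ih
    induction live with
    | nil => simp
    | cons w l ih =>
      simp only [List.countP_cons, List.any_cons] at ih ⊢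
      cases J.seven w <;> cases (Js.any fun J => J.seven w) <;> simp at ih ⊢ <;> omega

/-- `κ`: the live set shrinks by a factor of at least `ρ / κ` from one depth to the next. -/
noncomputable def shrink : ℝ := 7 * (invEps X.L X.imax + 1) * (X.base : ℝ) ^ 2

/-- The dense intervals hold only few live windows. -/
lemma nextLive_length_le (hb : 1 < X.base) (hρ : 0 < X.rho) (C live : List Win) :
    (X.nextLive C live).length * X.rho ≤ X.shrink * live.length := by
  classical
  set Js := X.intervals.filter fun J => decide (X.Dense C live J) with hJs
  have hb0 : (0 : ℝ) < X.base := by exact_mod_cast (by omega : 0 < X.base)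
  have hshrink : 0 ≤ X.shrink := by unfold shrink; positivity
  -- a dense interval holds a share of the clique that is larger by `ρ` than its share of the live
  -- windows, up to rounding
  have h1 : ∀ J ∈ Js, X.rho * X.sn C.length * (live.countP J.seven : ℝ) ≤
      X.base * live.length * C.countP J.seven ∧ 0 < X.sn C.length := by
    intro J hJ
    obtain ⟨-, hJ⟩ := List.mem_filter.1 hJ
    obtain ⟨hany, hd⟩ := of_decide_eq_true hJ
    set cJ := X.sn (C.countP J.seven)
    set lJ := X.sn (live.countP J.seven) with hlJ
    set c := X.sn C.length
    set l := X.sn live.length with hl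
    have hlJ0 : 0 < lJ := by
      apply X.sn_pos (by omega)
      rw [List.countP_pos_iff]
      simpa using hany
    have hc0 : 0 < c := by
      by_contra h
      have : c = 0 := by omega
      rw [this] at hd
      simp at hd
      linarith
    have hl0 : 0 < l := by
      by_contra h
      have : l = 0 := by omega
      rw [this] at hd
      simp at hd
      linarith
    refine ⟨?_, hc0⟩
    have hc' : (0 : ℝ) < c := by exact_mod_cast hc0
    have hl' : (0 : ℝ) < l := by exact_mod_cast hl0
    have hlJ' : (0 : ℝ) < lJ := by exact_mod_cast hlJ0
    have h2 : X.rho * c * lJ ≤ cJ * l := by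
      rw [le_div_iff₀ (by positivity), le_div_iff₀ hlJ', mul_div_assoc', div_mul_eq_mul_div,
        div_le_iff₀ hl'] at hd
      linarith
    have h3 : (live.countP J.seven : ℝ) ≤ X.base * lJ := by
      exact_mod_cast X.le_mul_sn hb _
    have h4 : (cJ : ℝ) ≤ C.countP J.seven := by exact_mod_cast X.sn_le _
    have h5 : (l : ℝ) ≤ live.length := by exact_mod_cast X.sn_le _
    calc X.rho * c * (live.countP J.seven : ℝ) ≤ X.rho * c * (X.base * lJ) := by gcongr
      _ = X.base * (X.rho * c * lJ) := by ring
      _ ≤ X.base * (cJ * l) := by gcongr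
      _ ≤ X.base * (C.countP J.seven * live.length) := by gcongr
      _ = _ := by ring
  have h2 : ((X.nextLive C live).length : ℝ) ≤ ((Js.map fun J => live.countP J.seven).sum : ℕ) := by
    exact_mod_cast length_filter_any_le live Js
  by_cases hJs0 : Js = []
  · rw [hJs0] at h2
    simp only [List.map_nil, List.sum_nil, Nat.cast_zero] at h2
    have : ((X.nextLive C live).length : ℝ) * X.rho ≤ 0 := by nlinarith
    exact this.trans (by positivity)
  obtain ⟨J0, hJ0⟩ := List.exists_mem_of_ne_nil _ hJs0
  have hc : (0 : ℝ) < X.sn C.length := by exact_mod_cast (h1 J0 hJ0).2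
  -- sum over the dense intervals; each window lies in few of them
  have h3 : X.rho * X.sn C.length * ((Js.map fun J => live.countP J.seven).sum : ℕ) ≤
      X.base * live.length * ((Js.map fun J => C.countP J.seven).sum : ℕ) := by
    clear h2 hJs0 hJ0 hJs
    clear_value Js
    induction Js with
    | nil => simp
    | cons J Js ih =>
      simp only [List.map_cons, List.sum_cons, Nat.cast_add, mul_add]
      exact add_le_add (h1 J (by simp)).1 (ih fun J hJ => h1 J (List.mem_cons_of_mem _ hJ))
  have h4 : (Js.map fun J => C.countP J.seven).sum ≤
      7 * (invEps X.L X.imax + 1) * C.length :=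
    (List.Sublist.sum_le_sum (List.filter_sublist.map _) (by simp)).trans
      (X.sum_countP_le (by omega) C)
  have h5 : (((Js.map fun J => C.countP J.seven).sum : ℕ) : ℝ) ≤
      7 * (invEps X.L X.imax + 1) * C.length := by exact_mod_cast h4
  have h6 : (C.length : ℝ) ≤ X.base * X.sn C.length := by exact_mod_cast X.le_mul_sn hb _
  have h7 : X.sn C.length * ((X.nextLive C live).length * X.rho) ≤
      X.sn C.length * (X.shrink * live.length) := by
    calc _ = X.rho * X.sn C.length * ((X.nextLive C live).length : ℝ) := by ring
      _ ≤ X.rho * X.sn C.length * ((Js.map fun J => live.countP J.seven).sum : ℕ) := by gcongr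
      _ ≤ X.base * live.length * ((Js.map fun J => C.countP J.seven).sum : ℕ) := h3
      _ ≤ X.base * live.length * (7 * (invEps X.L X.imax + 1) * C.length) := by gcongr
      _ ≤ X.base * live.length * (7 * (invEps X.L X.imax + 1) * (X.base * X.sn C.length)) := by
        gcongr
      _ = _ := by unfold shrink; ring
  exact le_of_mul_le_mul_left h7 hc

/-! ### The running time of the query algorithm -/

lemma runs_sampleClique {D : ℕ} (live : List Win)
    (hP : ∀ x ∈ live, ∀ y ∈ live, P ⟨x, y, D⟩) :
    (X.sampleClique live D).Runs P (fun C => C.Sublist live)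
      (3 * live.length + 3 + tauMax X.L X.imax) live.length := by
  rw [sampleClique.eq_def]
  cases live with
  | nil =>
    exact (Prog.Runs.ret (Q := fun C : List Win => C.Sublist []) (List.Sublist.refl _)).mono
      (fun _ h => h) (by positivity) (by simp)
  | cons w ws =>
    refine ((Prog.Runs.uniform _).bind fun j _ => (Prog.Runs.uniform _).bind
      (s' := 3 * (w :: ws).length + tauMax X.L X.imax + 1)
      (q' := (w :: ws).length) (Q' := fun C : List Win => C.Sublist (w :: ws))
      fun τ _ => ?_).mono (fun _ h => h) (by linarith) (by simp)
    refine ((Prog.Runs.spend _).bind fun _ _ =>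
      Prog.Runs.filterList (a := 2) (c := 1) (w :: ws) fun y hy => ?_).mono
        (fun _ h => h) ?_ ?_
    · refine ((Prog.Runs.ask (hP _ (List.get_mem _ _) y hy)).bind fun v _ =>
        (Prog.Runs.spend 1).bind fun _ _ => Prog.Runs.ret trivial).mono (fun _ h => h) ?_ (by simp)
      norm_num
    · have : (τ : ℕ) + 1 ≤ tauMax X.L X.imax + 1 := by have := τ.2; omega
      have : (((τ : ℕ) + 1 : ℕ) : ℝ) ≤ tauMax X.L X.imax + 1 := by exact_mod_cast this
      linarith
    · simp

set_option maxHeartbeats 1000000 in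
/-- The budgets of a query. With `r` further depths to go there are at most `κ ^ (imax - r) ρ ^ r`
live windows. -/
lemma runs_query {D : ℕ} (hb : 1 < X.base) {u c : ℝ} (hu : 1 ≤ u) (hρ : 1 ≤ X.rho)
    (ht : X.rho ^ X.imax = X.t)
    (hN : ∀ r < X.imax, (⌈(X.t : ℝ) ^ epsLevel X.L X.imax (X.imax - r) * X.rho⌉₊ : ℝ) ≤ u * X.rho)
    (hc : tauMax X.L X.imax + 20 * invEps X.L X.imax + 60 ≤ c)
    (hP : ∀ x ∈ X.windows, ∀ y ∈ X.windows, P ⟨x, y, D⟩)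
    (r : ℕ) (hr : r ≤ X.imax) (live : List Win) (hlive : live ⊆ X.windows)
    (hlen : (live.length : ℝ) ≤ X.shrink ^ (X.imax - r) * X.rho ^ r) :
    (X.query X.intervals D r live).Runs P
      (fun E => (E.length : ℝ) ≤ X.t * (X.shrink ^ X.imax) ^ 2 * X.rho ^ (r + 1) * (2 * u) ^ r)
      (c * X.t * (X.shrink ^ X.imax) ^ 2 * X.rho ^ (r + 1) * (4 * u) ^ r)
      ((X.shrink ^ X.imax) ^ 2 * X.rho ^ (r + 1) * (2 * u) ^ r) := by
  set κ := X.shrink with hκ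
  set ρ := X.rho with hρdef
  have hb1 : (1 : ℝ) ≤ X.base := by exact_mod_cast hb.le
  have hκ1 : 1 ≤ κ := by
    rw [hκ, shrink]
    have h1 : (1 : ℝ) ≤ (X.base : ℝ) ^ 2 := one_le_pow₀ hb1
    have h2 : (0 : ℝ) ≤ invEps X.L X.imax := Nat.cast_nonneg _
    nlinarith
  set Kp := κ ^ X.imax with hKp
  have hKp1 : 1 ≤ Kp := one_le_pow₀ hκ1
  have ht1 : (1 : ℝ) ≤ X.t := by rw [← ht]; exact one_le_pow₀ hρ
  have hT0 : (0 : ℝ) ≤ tauMax X.L X.imax := Nat.cast_nonneg _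
  have hE0 : (0 : ℝ) ≤ invEps X.L X.imax := Nat.cast_nonneg _
  have hc1 : 60 ≤ c := by linarith
  have hKp2 : Kp ≤ Kp ^ 2 := by nlinarith
  induction r generalizing live with
  | zero =>
    simp only [Nat.sub_zero, pow_zero, mul_one] at hlen
    rw [query]
    have hL : ((live.product live).length : ℝ) ≤ Kp ^ 2 := by
      rw [show live.product live = live ×ˢ live from rfl, List.length_product]
      push_cast; rw [sq]
      gcongr
    have hKt : Kp ^ 2 ≤ X.t * Kp ^ 2 * ρ := by
      have : 1 ≤ X.t * ρ := one_le_mul_of_one_le_of_one_le ht1 hρ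
      calc Kp ^ 2 ≤ Kp ^ 2 * (X.t * ρ) := le_mul_of_one_le_right (sq_nonneg _) this
        _ = _ := by ring
    refine (Prog.Runs.foldlM (live.product live) (fun i (E : List (Win × Win)) => E.length ≤ i)
      (a := 2) (c := 1) ?_ [] (by simp)).mono ?_ ?_ ?_
    · intro i hi E hE
      have hmem : (live.product live)[i] ∈ live ×ˢ live := List.getElem_mem hi
      have hmem := List.mem_product.1 hmem
      refine ((Prog.Runs.ask (hP _ (hlive hmem.1) _ (hlive hmem.2))).bind fun v _ =>
        (Prog.Runs.spend 1).bind fun _ _ => Prog.Runs.ret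
        (Q := fun E : List (Win × Win) => E.length ≤ i + 1) ?_).mono
        (fun _ h => h) (by norm_num) (by simp)
      split_ifs
      · rw [List.length_cons]; omega
      · omega
    · intro E hE
      have hE' : (E.length : ℝ) ≤ (live.product live).length := by exact_mod_cast hE
      simp only [zero_add, pow_one, pow_zero, mul_one]
      linarith
    · simp only [zero_add, pow_one, pow_zero, mul_one]
      have : 0 ≤ X.t * Kp ^ 2 * ρ := by positivity
      calc _ ≤ Kp ^ 2 * 2 := by gcongr
        _ ≤ (X.t * Kp ^ 2 * ρ) * c := mul_le_mul hKt (by linarith) (by norm_num) this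
        _ = _ := by ring
    · simp only [zero_add, pow_one, pow_zero, mul_one]
      have : Kp ^ 2 ≤ Kp ^ 2 * ρ := le_mul_of_one_le_right (sq_nonneg _) hρ
      linarith
  | succ r ih =>
    have hrρ : ρ ^ (r + 1) ≤ X.t := by rw [← ht]; exact pow_le_pow_right₀ hρ hr
    have hρr1 : 1 ≤ ρ ^ (r + 1) := one_le_pow₀ hρ
    have hℓ : (live.length : ℝ) ≤ Kp * ρ ^ (r + 1) := by
      refine hlen.trans ?_
      gcongr
      exact pow_le_pow_right₀ hκ1 (by omega)
    set Λ := Kp * ρ ^ (r + 1) with hΛ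
    have hΛ1 : 1 ≤ Λ := one_le_mul_of_one_le_of_one_le hKp1 hρr1
    set G := (X.t : ℝ) * Kp ^ 2 * ρ ^ (r + 1) with hG
    have hG1 : 1 ≤ G := one_le_mul_of_one_le_of_one_le
      (one_le_mul_of_one_le_of_one_le ht1 (one_le_pow₀ hKp1)) hρr1
    have htΛ : X.t * Λ ≤ G := by
      rw [hΛ, hG, ← mul_assoc]; gcongr
    have hΛ2 : Λ ^ 2 ≤ G := by
      calc Λ ^ 2 = Kp ^ 2 * ρ ^ (r + 1) * ρ ^ (r + 1) := by rw [hΛ]; ring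
        _ ≤ Kp ^ 2 * ρ ^ (r + 1) * X.t := by gcongr
        _ = G := by rw [hG]; ring
    have h2u : 1 ≤ (2 * u) ^ r := one_le_pow₀ (by linarith)
    have h4u : (2 * u) ^ r ≤ (4 * u) ^ r := pow_le_pow_left₀ (by linarith) (by linarith) _
    rw [query]
    have hN' := hN r (by omega)
    set N := ⌈(X.t : ℝ) ^ epsLevel X.L X.imax (X.imax - r) * ρ⌉₊ with hNdef
    set Edg := G * (2 * u) ^ r with hEdg
    set Stp := c * G * (4 * u) ^ r with hStp
    set Qry := Kp ^ 2 * ρ ^ (r + 1) * (2 * u) ^ r with hQry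
    have hEdg1 : G ≤ Edg := le_mul_of_one_le_right (by positivity) h2u
    refine (Prog.Runs.foldlM (List.range N)
      (fun i (E : List (Win × Win)) => (E.length : ℝ) ≤ i * (2 * Edg))
      (a := c * G + Stp + Edg) (c := Λ + Qry) ?_ [] (by simp)).mono ?_ ?_ ?_
    · intro i hi E hE
      refine ((X.runs_sampleClique live
        fun x hx y hy => hP x (hlive hx) y (hlive hy)).bind
        (s' := 10 * (X.intervals.length + 1) * (live.length + 1) + (G + Stp + Edg + 1))
        (q' := Qry) fun C hC => ?_).mono (fun _ h => h) ?_ ?_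
      · refine ((X.runs_denseInterval C live hC.length_le).bind
          (s' := G + Stp + Edg + 1) (q' := Qry) fun o ho => ?_).mono
          (fun _ h => h) le_rfl (by simp)
        have hCℓ : (C.length : ℝ) ≤ Λ := by
          have : (C.length : ℝ) ≤ live.length := by exact_mod_cast hC.length_le
          linarith
        have hCC : (C.length : ℝ) * C.length ≤ G := by
          refine le_trans ?_ hΛ2
          rw [sq]; gcongr
        have hStp0 : 0 ≤ Stp := by rw [hStp]; positivity
        have hQry0 : 0 ≤ Qry := by rw [hQry]; positivity
        split_ifs at ho with hbig
        · subst ho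
          refine ((Prog.Runs.spend _).bind fun _ _ => Prog.Runs.ret
            (Q := fun E : List (Win × Win) => (E.length : ℝ) ≤ (i + 1 : ℕ) * (2 * Edg)) ?_).mono
            (fun _ h => h) ?_ ?_
          · rw [List.length_append, show C.product C = C ×ˢ C from rfl, List.length_product]
            push_cast
            linarith
          · push_cast; linarith
          · linarith
        · subst ho
          refine ((ih (by omega) (X.nextLive C live)
            (List.Subset.trans (X.nextLive_sublist C live).subset hlive) ?_).bind
            (s' := Edg + 1) (q' := 0) fun E' hE' => ?_).mono (fun _ h => h) ?_ ?_
          · have h1 := X.nextLive_length_le hb (by linarith) C live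
            have h2 : ((X.nextLive C live).length : ℝ) * ρ ≤
                κ ^ (X.imax - r) * ρ ^ r * ρ := by
              refine h1.trans ?_
              calc κ * (live.length : ℝ) ≤ κ * (κ ^ (X.imax - (r + 1)) * ρ ^ (r + 1)) := by gcongr
                _ = κ ^ (X.imax - (r + 1) + 1) * ρ ^ r * ρ := by ring
                _ = _ := by rw [show X.imax - (r + 1) + 1 = X.imax - r by omega]
            exact le_of_mul_le_mul_right h2 (by linarith)
          · refine ((Prog.Runs.spend _).bind fun _ _ => Prog.Runs.ret
              (Q := fun E : List (Win × Win) => (E.length : ℝ) ≤ (i + 1 : ℕ) * (2 * Edg)) ?_).mono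
              (fun _ h => h) ?_ ?_
            · rw [List.length_append]
              have : (E'.length : ℝ) ≤ Edg := by rw [hEdg, hG]; exact hE'
              push_cast
              linarith
            · have : (E'.length : ℝ) ≤ Edg := by rw [hEdg, hG]; exact hE'
              push_cast
              linarith
            · simp
          · have : c * X.t * Kp ^ 2 * ρ ^ (r + 1) * (4 * u) ^ r = Stp := by rw [hStp, hG]; ring
            linarith
          · simp [hQry]
      · have h1 : (X.intervals.length : ℝ) ≤ (invEps X.L X.imax + 1) * X.t := by
          exact_mod_cast X.intervals_length_le (by omega)
        have h2 : 10 * ((X.intervals.length : ℝ) + 1) * (live.length + 1) ≤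
            20 * (invEps X.L X.imax + 2) * G := by
          calc 10 * ((X.intervals.length : ℝ) + 1) * (live.length + 1)
              ≤ 10 * ((invEps X.L X.imax + 1) * X.t + X.t) * (Λ + Λ) := by gcongr
            _ = 20 * (invEps X.L X.imax + 2) * (X.t * Λ) := by ring
            _ ≤ _ := by gcongr
        have h3 : Λ ≤ G := le_trans (le_mul_of_one_le_left (by linarith) ht1) htΛ
        have h4 : (tauMax X.L X.imax : ℝ) ≤ tauMax X.L X.imax * G :=
          le_mul_of_one_le_right hT0 hG1
        have h5 : (tauMax X.L X.imax + 20 * invEps X.L X.imax + 60) * G ≤ c * G := by gcongr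
        linarith
      · linarith
    · intro E hE
      refine hE.trans ?_
      rw [List.length_range]
      calc (N : ℝ) * (2 * Edg) ≤ (u * ρ) * (2 * Edg) := by
            have : 0 ≤ Edg := by linarith
            gcongr
        _ = _ := by rw [hEdg, hG]; ring
    · rw [List.length_range]
      have hStp1 : c * G ≤ Stp := le_mul_of_one_le_right (by positivity) (h2u.trans h4u)
      have hEdgStp : Edg ≤ Stp := by
        rw [hEdg, hStp]
        have : G ≤ c * G := by nlinarith
        gcongr
      calc (N : ℝ) * (c * G + Stp + Edg) ≤ (u * ρ) * (4 * Stp) := by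
            have : 0 ≤ Edg := by linarith
            have : 0 ≤ Stp := by linarith
            gcongr
            linarith
        _ = _ := by rw [hStp, hG]; ring
    · rw [List.length_range]
      have hΛQ : Λ ≤ Qry := by
        rw [hΛ, hQry]
        calc Kp * ρ ^ (r + 1) ≤ Kp ^ 2 * ρ ^ (r + 1) * 1 := by rw [mul_one]; gcongr
          _ ≤ _ := by gcongr
      calc (N : ℝ) * (Λ + Qry) ≤ (u * ρ) * (2 * Qry) := by
            have : 0 ≤ Qry := by linarith
            gcongr
            linarith
        _ = _ := by rw [hQry]; ring

end Inst

/-! ### Combinatorics of cliques and dense intervals -/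

/-- A bounded monotone sequence repeats a value after two steps, early on. -/
lemma exists_stable {F : ℕ → ℕ} (hF : Monotone F) {M : ℕ} (hM : ∀ i, F i ≤ M) :
    ∃ j ≤ M, F (2 * j) = F (2 * j + 2) := by
  by_contra! h
  have key : ∀ j ≤ M + 1, j ≤ F (2 * j) := by
    intro j hj
    induction j with
    | zero => simp
    | succ j ih =>
      have h1 := h j (by omega)
      have h2 := hF (show 2 * j ≤ 2 * j + 2 by omega)
      have h3 := ih (by omega)
      rw [show 2 * (j + 1) = 2 * j + 2 by ring]
      omega
  have h1 := key (M + 1) le_rfl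
  have h2 := hM (2 * (M + 1))
  omega

/-- Two monotone maps on `S` cut it into cells, which are arranged like a staircase: each cell is
the last one in its row or in its column. Hence there are few elements in sparse cells, even if
the cells are weighted with the smaller one of the weights of the row and the column. -/
lemma card_sparse_cells_le (S : Finset ℕ) (f g : ℕ → ℕ) (hf : MonotoneOn f S)
    (hg : MonotoneOn g S) (w w' : ℕ → ℝ) (hw : ∀ i, 0 ≤ w i) (hw' : ∀ i, 0 ≤ w' i)
    (η : ℝ) (hη : 0 ≤ η) :
    ((S.filter fun k => ((S.filter fun k' => f k' = f k ∧ g k' = g k).card : ℝ) <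
      η * min (w (f k)) (w' (g k))).card : ℝ) ≤
      η * (∑ i ∈ S.image f, w i + ∑ j ∈ S.image g, w' j) := by
  classical
  set R := S.filter fun k => ((S.filter fun k' => f k' = f k ∧ g k' = g k).card : ℝ) <
      η * min (w (f k)) (w' (g k)) with hR
  set Cells := S.image fun k => (f k, g k) with hCells
  -- cells that are last in their row, and the others
  set Rows := Cells.filter fun c => ∀ c' ∈ Cells, c'.1 = c.1 → c'.2 ≤ c.2 with hRows
  set Cols := Cells.filter fun c => ∀ c' ∈ Cells, c'.2 = c.2 → c'.1 ≤ c.1 with hCols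
  -- a cell with a later one in its row and another one in its column contradicts monotonicity
  have hcover : Cells ⊆ Rows ∪ Cols := by
    intro c hc
    by_contra hcon
    simp only [hRows, hCols, Finset.mem_union, Finset.mem_filter, hc, true_and, not_or] at hcon
    push Not at hcon
    obtain ⟨⟨c1, hc1, h1, h2⟩, ⟨c2, hc2, h3, h4⟩⟩ := hcon
    simp only [hCells, Finset.mem_image] at hc1 hc2
    obtain ⟨k1, hk1, rfl⟩ := hc1
    obtain ⟨k2, hk2, rfl⟩ := hc2
    simp only at h1 h2 h3 h4
    have h5 : k1 < k2 := by
      by_contra! h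
      have := hf hk2 hk1 h
      omega
    have := hg hk1 hk2 h5.le
    omega
  have hcell : ∀ c : ℕ × ℕ, ((R.filter fun k => (f k, g k) = c).card : ℝ) ≤
      η * min (w c.1) (w' c.2) := by
    intro c
    by_cases hne : (R.filter fun k => (f k, g k) = c).Nonempty
    · obtain ⟨k, hk⟩ := hne
      simp only [hR, Finset.mem_filter] at hk
      obtain ⟨⟨hkS, hk1⟩, rfl⟩ := hk
      refine le_trans ?_ hk1.le
      norm_cast
      refine Finset.card_le_card fun k' hk' => ?_
      simp only [hR, Finset.mem_filter, Prod.mk.injEq] at hk' ⊢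
      exact ⟨hk'.1.1, hk'.2⟩
    · rw [Finset.not_nonempty_iff_eq_empty.1 hne]
      simp only [Finset.card_empty, Nat.cast_zero]
      exact mul_nonneg hη (le_min (hw _) (hw' _))
  have h1 : (R.card : ℝ) = ∑ c ∈ Cells, ((R.filter fun k => (f k, g k) = c).card : ℝ) := by
    rw [← Nat.cast_sum, ← Finset.card_eq_sum_card_fiberwise]
    intro k hk
    exact Finset.mem_image_of_mem _ (Finset.mem_filter.1 hk).1
  have h2 : ∑ c ∈ Rows, η * min (w c.1) (w' c.2) ≤ η * ∑ i ∈ S.image f, w i := by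
    rw [← Finset.mul_sum]
    refine mul_le_mul_of_nonneg_left ?_ hη
    have hinj : Set.InjOn Prod.fst (Rows : Set (ℕ × ℕ)) := by
      intro c hc c' hc' h
      simp only [hRows, Finset.coe_filter, Set.mem_ofPred_eq] at hc hc'
      exact Prod.ext h (le_antisymm (hc'.2 c hc.1 h) (hc.2 c' hc'.1 h.symm))
    calc _ ≤ ∑ c ∈ Rows, w c.1 := Finset.sum_le_sum fun c _ => min_le_left _ _
      _ = ∑ i ∈ Rows.image Prod.fst, w i := (Finset.sum_image hinj).symm
      _ ≤ _ := by
        refine Finset.sum_le_sum_of_subset_of_nonneg ?_ fun i _ _ => hw i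
        intro i hi
        simp only [hRows, hCells, Finset.mem_image, Finset.mem_filter] at hi ⊢
        obtain ⟨c, ⟨⟨k, hk, rfl⟩, -⟩, rfl⟩ := hi
        exact ⟨k, hk, rfl⟩
  have h3 : ∑ c ∈ Cols, η * min (w c.1) (w' c.2) ≤ η * ∑ j ∈ S.image g, w' j := by
    rw [← Finset.mul_sum]
    refine mul_le_mul_of_nonneg_left ?_ hη
    have hinj : Set.InjOn Prod.snd (Cols : Set (ℕ × ℕ)) := by
      intro c hc c' hc' h
      simp only [hCols, Finset.coe_filter, Set.mem_ofPred_eq] at hc hc'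
      exact Prod.ext (le_antisymm (hc'.2 c hc.1 h) (hc.2 c' hc'.1 h.symm)) h
    calc _ ≤ ∑ c ∈ Cols, w' c.2 := Finset.sum_le_sum fun c _ => min_le_right _ _
      _ = ∑ i ∈ Cols.image Prod.snd, w' i := (Finset.sum_image hinj).symm
      _ ≤ _ := by
        refine Finset.sum_le_sum_of_subset_of_nonneg ?_ fun i _ _ => hw' i
        intro i hi
        simp only [hCols, hCells, Finset.mem_image, Finset.mem_filter] at hi ⊢
        obtain ⟨c, ⟨⟨k, hk, rfl⟩, -⟩, rfl⟩ := hi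
        exact ⟨k, hk, rfl⟩
  have hnn : ∀ c : ℕ × ℕ, 0 ≤ η * min (w c.1) (w' c.2) := fun c =>
    mul_nonneg hη (le_min (hw _) (hw' _))
  calc (R.card : ℝ) ≤ ∑ c ∈ Cells, η * min (w c.1) (w' c.2) := by
        rw [h1]; exact Finset.sum_le_sum fun c _ => hcell c
    _ ≤ ∑ c ∈ Rows ∪ Cols, η * min (w c.1) (w' c.2) :=
        Finset.sum_le_sum_of_subset_of_nonneg hcover fun c _ _ => hnn c
    _ ≤ ∑ c ∈ Rows, η * min (w c.1) (w' c.2) + ∑ c ∈ Cols, η * min (w c.1) (w' c.2) := by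
        rw [← Finset.sum_union_inter]
        exact le_add_of_nonneg_right (Finset.sum_nonneg fun c _ => hnn c)
    _ ≤ _ := by rw [mul_add]; exact add_le_add h2 h3

/-- The number of elements of a set of windows in `7 J`. -/
def cnt (A : Finset Win) (J : Interval) : ℕ := (A.filter fun w => J.seven w = true).card

lemma cnt_mono {A A' : Finset Win} (h : A ⊆ A') (J : Interval) : cnt A J ≤ cnt A' J :=
  Finset.card_le_card (Finset.filter_subset_filter _ h)

lemma cnt_le_card (A : Finset Win) (J : Interval) : cnt A J ≤ A.card :=
  Finset.card_le_card (Finset.filter_subset _ _)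

lemma cnt_pos {A : Finset Win} {J : Interval} {w : Win} (hw : w ∈ A) (h : J.seven w = true) :
    0 < cnt A J :=
  Finset.card_pos.2 ⟨w, Finset.mem_filter.2 ⟨hw, h⟩⟩

lemma countP_eq_cnt {l : List Win} (hl : l.Nodup) (J : Interval) :
    l.countP J.seven = cnt l.toFinset J := by
  rw [cnt, List.countP_eq_length_filter, ← List.toFinset_card_of_nodup (hl.filter _)]
  congr 1
  ext w
  simp

/-- The enlarged intervals of a grid are nested. -/
lemma grid_succ_arith {s b k k' : ℕ} (hb : 0 < b)
    (h : k / s * s ≤ k' + 3 * s ∧ k' < k / s * s + 4 * s) :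
    k / (s * b) * (s * b) ≤ k' + 3 * (s * b) ∧ k' < k / (s * b) * (s * b) + 4 * (s * b) := by
  rw [← Nat.div_div_eq_div_mul]
  generalize k / s = i at h ⊢
  have h1 : i / b * b ≤ i := Nat.div_mul_le_self _ _
  have h2 : i < i / b * b + b := Nat.lt_div_mul_add hb
  have h3 : i / b * (s * b) ≤ i * s := by
    calc i / b * (s * b) = i / b * b * s := by ring
      _ ≤ _ := Nat.mul_le_mul_right _ h1
  have h4 : i * s + s ≤ i / b * (s * b) + s * b := by
    calc i * s + s = (i + 1) * s := by ring
      _ ≤ (i / b * b + b) * s := Nat.mul_le_mul_right _ h2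
      _ = _ := by ring
  have h5 : s ≤ s * b := Nat.le_mul_of_pos_right _ hb
  omega

lemma cnt_grid_one_le (A : Finset Win) (side : Bool) (k : ℕ) : cnt A (grid side 1 k) ≤ 7 := by
  cases side
  · refine (Finset.card_le_card (t := (Finset.Ico (k - 3) (k + 4)).image Sum.inl) ?_).trans ?_
    · intro w hw
      obtain ⟨-, hw⟩ := Finset.mem_filter.1 hw
      rcases w with j | j
      · rw [grid_seven_inl] at hw
        refine Finset.mem_image_of_mem _ (Finset.mem_Ico.2 ?_)
        omega
      · simp [grid_seven_inr_false] at hw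
    · refine Finset.card_image_le.trans ?_
      rw [Nat.card_Ico]; omega
  · refine (Finset.card_le_card (t := (Finset.Ico (k - 3) (k + 4)).image Sum.inr) ?_).trans ?_
    · intro w hw
      obtain ⟨-, hw⟩ := Finset.mem_filter.1 hw
      rcases w with j | j
      · simp [grid_seven_inl_true] at hw
      · rw [grid_seven_inr] at hw
        refine Finset.mem_image_of_mem _ (Finset.mem_Ico.2 ?_)
        omega
    · refine Finset.card_image_le.trans ?_
      rw [Nat.card_Ico]; omega

/-- The live windows, counted over the parents of the intervals of a grid. -/
lemma sum_cnt_parents_le (A : Finset Win) (side : Bool) (M b S : ℕ) (hb : 0 < b) (hS : 0 < S) :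
    ∑ i ∈ Finset.range M, cnt A (grid side S (i / b)) ≤ 7 * b * A.card := by
  have h1 : ∀ i, cnt A (grid side S (i / b)) =
      ∑ w ∈ A, if (grid side S (i / b)).seven w = true then 1 else 0 := fun i => by
    rw [cnt, Finset.card_filter]
  simp_rw [h1]
  rw [Finset.sum_comm, mul_comm, ← smul_eq_mul]
  refine Finset.sum_le_card_nsmul _ _ _ fun w _ => ?_
  rw [← Finset.card_filter]
  rcases side with _ | _ <;> rcases w with k | k
  · simp_rw [grid_seven_inl]; exact card_grid_le M b S k hb hS
  · simp [grid_seven_inr_false]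
  · simp [grid_seven_inl_true]
  · simp_rw [grid_seven_inr]; exact card_grid_le M b S k hb hS

/-! ### Good samples -/

/-- A partial matching `m`, defined on `S₀`, between close windows, with respect to a
pseudo-metric `δ` on the windows. -/
structure CloseMatching (X : Inst) (δ : Win → Win → ℕ) (D : ℕ) (m : ℕ → ℕ) (S₀ : Finset ℕ) :
    Prop where
  refl : ∀ x, δ x x = 0
  symm : ∀ x y, δ x y = δ y x
  tri : ∀ x y z, δ x z ≤ δ x y + δ y z
  lt_numA : ∀ k ∈ S₀, k < X.numA
  lt_numB : ∀ k ∈ S₀, m k < X.numB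
  strictMono : StrictMonoOn m S₀
  close : ∀ k ∈ S₀, δ (Sum.inl k) (Sum.inr (m k)) ≤ D

/-- What the analysis needs to know about the parameters of an instance. -/
structure Inst.Regular (X : Inst) : Prop where
  base_ge : 8 ≤ X.base
  t_le : X.t ≤ X.base ^ invEps X.L X.imax
  rho_ge : 1 ≤ X.rho

open scoped Classical in
/-- The elements of the matching both of whose windows are live. -/
noncomputable def surv (S₀ : Finset ℕ) (m : ℕ → ℕ) (live : List Win) : Finset ℕ :=
  S₀.filter fun k => Sum.inl k ∈ live ∧ Sum.inr (m k) ∈ live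

namespace Inst

variable (X : Inst) (δ : Win → Win → ℕ) (D : ℕ)

/-- The live windows at distance at most `D c_L ^ τ` from `y`. -/
noncomputable def ball (live : List Win) (y : Win) (τ : ℕ) : Finset Win :=
  live.toFinset.filter fun z => δ y z ≤ D * expansion X.L X.imax ^ τ

/-- What a clique sampled with center `x` and threshold `τ` can be, for successful calls. -/
structure Valid (live : List Win) (x : Win) (τ : ℕ) (C : List Win) : Prop where
  sublist : C.Sublist live
  le : ∀ z ∈ C, δ x z ≤ D * expansion X.L X.imax ^ τ
  mem : ∀ z ∈ live, alpha (X.L - 1) X.imax * (δ x z + D) ≤ D * expansion X.L X.imax ^ τ → z ∈ C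

/-- Every possible clique with center `x` and threshold `τ` brings element `k` of the matching
forward: either the clique is big, and the edge is found, or both windows stay alive. -/
def Hit (m : ℕ → ℕ) (live : List Win) (k : ℕ) (x : Win) (τ : ℕ) : Prop :=
  ∀ C, X.Valid δ D live x τ C →
    (X.Big C live → Sum.inl k ∈ C ∧ Sum.inr (m k) ∈ C) ∧
    (¬ X.Big C live → Sum.inl k ∈ X.nextLive C live ∧ Sum.inr (m k) ∈ X.nextLive C live)

lemma alpha_pos (L imax : ℕ) : 0 < alpha L imax := pow_pos (by norm_num) _

lemma expansion_eq : expansion X.L X.imax = 100 * alpha (X.L - 1) X.imax := rfl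

lemma expansion_ge : 100 ≤ expansion X.L X.imax := by
  have := alpha_pos (X.L - 1) X.imax
  rw [expansion_eq]; omega

variable {X δ D} {m : ℕ → ℕ} {S₀ : Finset ℕ} {live : List Win}

lemma mem_ball {y z : Win} {τ : ℕ} :
    z ∈ X.ball δ D live y τ ↔ z ∈ live ∧ δ y z ≤ D * expansion X.L X.imax ^ τ := by
  simp [ball]

lemma ball_mono (y : Win) : _root_.Monotone (X.ball δ D live y) := by
  intro τ τ' h z hz
  rw [mem_ball] at hz ⊢
  refine ⟨hz.1, hz.2.trans (Nat.mul_le_mul_left _ (Nat.pow_le_pow_right ?_ h))⟩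
  have := X.expansion_ge
  omega

/-- Twice the radius of a ball, plus `D`, is at most the next radius, even after multiplication
with the approximation factor of the calls. -/
lemma radius_step (τ : ℕ) :
    alpha (X.L - 1) X.imax * (2 * (D * expansion X.L X.imax ^ τ) + D) ≤
      D * expansion X.L X.imax ^ (τ + 1) := by
  have h1 : D ≤ D * expansion X.L X.imax ^ τ :=
    Nat.le_mul_of_pos_right _ (pow_pos (by have := X.expansion_ge; omega) _)
  rw [pow_succ, X.expansion_eq]
  set R := D * (100 * alpha (X.L - 1) X.imax) ^ τ with hR
  rw [X.expansion_eq] at h1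
  calc alpha (X.L - 1) X.imax * (2 * R + D) ≤ alpha (X.L - 1) X.imax * (100 * R) :=
        Nat.mul_le_mul_left _ (by omega)
    _ = _ := by rw [hR]; ring

lemma radius_step' (τ : ℕ) :
    2 * (D * expansion X.L X.imax ^ τ) + D ≤ D * expansion X.L X.imax ^ (τ + 1) :=
  (Nat.le_mul_of_pos_left _ (alpha_pos _ _)).trans (X.radius_step τ)

variable (hM : CloseMatching X δ D m S₀)
include hM

/-- A clique whose center lies in the ball of `y` is squeezed between two balls of `y`. -/
lemma Valid.sandwich {x y : Win} {τ : ℕ} {C : List Win} (hC : X.Valid δ D live x (τ + 1) C)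
    (hx : x ∈ X.ball δ D live y τ) :
    X.ball δ D live y τ ⊆ C.toFinset ∧ C.toFinset ⊆ X.ball δ D live y (τ + 2) := by
  rw [mem_ball] at hx
  constructor
  · intro z hz
    rw [mem_ball] at hz
    rw [List.mem_toFinset]
    refine hC.mem z hz.1 (le_trans (Nat.mul_le_mul_left _ ?_) (X.radius_step τ))
    have h1 := hM.tri x y z
    rw [hM.symm x y] at h1
    omega
  · intro z hz
    rw [List.mem_toFinset] at hz
    rw [mem_ball]
    refine ⟨hC.sublist.subset hz, ?_⟩
    have h1 := hM.tri y x z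
    have h2 := hC.le z hz
    have h3 := X.radius_step' (D := D) τ
    have h4 := X.radius_step' (D := D) (τ + 1)
    rw [show τ + 1 + 1 = τ + 2 by ring] at h4
    omega

/-- Two windows with a common point in their balls are close. -/
lemma mem_ball_of_common {x y y' : Win} {τ : ℕ} (h : x ∈ X.ball δ D live y τ)
    (h' : x ∈ X.ball δ D live y' τ) : δ y' y ≤ 2 * (D * expansion X.L X.imax ^ τ) := by
  rw [mem_ball] at h h'
  have h1 := hM.tri y' x y
  rw [hM.symm x y] at h1
  omega

omit hM in
/-- The windows in the interval of length `s` around the `k`-th window lie in its enlargement. -/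
lemma self_mem_grid_false (s k k' : ℕ) (hs : 0 < s) (h : k' / s = k / s) :
    (grid false s (k / s)).seven (Sum.inl k') = true := by
  rw [grid_seven_inl, ← h]
  have h1 := Nat.div_mul_le_self k' s
  have h2 := Nat.lt_div_mul_add (a := k') hs
  omega

omit hM in
lemma self_mem_grid_true (s k k' : ℕ) (hs : 0 < s) (h : k' / s = k / s) :
    (grid true s (k / s)).seven (Sum.inr k') = true := by
  rw [grid_seven_inr, ← h]
  have h1 := Nat.div_mul_le_self k' s
  have h2 := Nat.lt_div_mul_add (a := k') hs
  omega

variable (X m) in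
/-- The intervals around the two windows of element `k` of the matching. -/
noncomputable def around (side : Bool) (e k : ℕ) : Interval :=
  grid side (X.base ^ e) ((if side then m k else k) / X.base ^ e)

variable (m) in
/-- The two windows of element `k` of the matching. -/
def wind (side : Bool) (k : ℕ) : Win := if side then Sum.inr (m k) else Sum.inl k

omit hM in
lemma around_seven_self (hb : 0 < X.base) (side : Bool) (e k k' : ℕ)
    (h : (if side then m k' else k') / X.base ^ e = (if side then m k else k) / X.base ^ e) :
    (X.around m side e k).seven (wind m side k') = true := by
  cases side
  · exact self_mem_grid_false _ _ _ (pow_pos hb e) h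
  · exact self_mem_grid_true _ _ _ (pow_pos hb e) h

omit hM in
lemma around_mem_intervals (hb : 0 < X.base) {side : Bool} {e k : ℕ}
    (he : e ≤ invEps X.L X.imax)
    (hk : (if side then m k else k) < if side then X.numB else X.numA) :
    X.around m side e k ∈ X.intervals := by
  have key : ∀ j M : ℕ, j < M → j / X.base ^ e < (M + X.base ^ e - 1) / X.base ^ e := by
    intro j M h
    have hs : 0 < X.base ^ e := pow_pos hb e
    rw [Nat.div_lt_iff_lt_mul hs]
    have := Nat.lt_div_mul_add (a := M + X.base ^ e - 1) hs
    omega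
  rw [intervals_eq, List.mem_flatMap]
  refine ⟨e, List.mem_range.2 (by omega), ?_⟩
  rw [List.mem_append, List.mem_map, List.mem_map]
  cases side
  · exact Or.inl ⟨_, List.mem_range.2 (key _ _ (by simpa using hk)), rfl⟩
  · exact Or.inr ⟨_, List.mem_range.2 (key _ _ (by simpa using hk)), rfl⟩

omit hM in
lemma cnt_around_succ (hb : 0 < X.base) (A : Finset Win) (side : Bool) (e k : ℕ) :
    cnt A (X.around m side e k) ≤ cnt A (X.around m side (e + 1) k) := by
  refine Finset.card_le_card fun w hw => ?_
  obtain ⟨hwA, hw⟩ := Finset.mem_filter.1 hw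
  refine Finset.mem_filter.2 ⟨hwA, ?_⟩
  unfold around at hw ⊢
  rw [pow_succ]
  rcases side with _ | _ <;> rcases w with j | j
  · rw [grid_seven_inl] at hw ⊢; exact grid_succ_arith hb hw
  · simp [grid_seven_inr_false] at hw
  · simp [grid_seven_inl_true] at hw
  · rw [grid_seven_inr] at hw ⊢; exact grid_succ_arith hb hw

omit hM in
lemma mem_surv {k : ℕ} :
    k ∈ surv S₀ m live ↔ k ∈ S₀ ∧ Sum.inl k ∈ live ∧ Sum.inr (m k) ∈ live := by simp [surv]

omit hM in
lemma wind_mem_live {k : ℕ} (hk : k ∈ surv S₀ m live) (side : Bool) : wind m side k ∈ live := by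
  rw [mem_surv] at hk
  cases side
  · exact hk.2.1
  · exact hk.2.2

/-- Both windows of an element of the matching lie in each of its balls. -/
lemma wind_mem_ball {k : ℕ} (hk : k ∈ surv S₀ m live) (side : Bool) (τ : ℕ) :
    wind m side k ∈ X.ball δ D live (Sum.inl k) τ := by
  rw [mem_ball]
  refine ⟨wind_mem_live hk side, ?_⟩
  rw [mem_surv] at hk
  cases side
  · simp [wind, hM.refl]
  · refine (hM.close k hk.1).trans (Nat.le_mul_of_pos_right _ (pow_pos ?_ _))
    have := X.expansion_ge
    omega

omit hM in
lemma sn_eq_of_log {a b : ℕ} (ha : 0 < a) (hb : 0 < b)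
    (h : Nat.log X.base a = Nat.log X.base b) : X.sn a = X.sn b := by
  unfold sn; rw [if_neg (by omega), if_neg (by omega), h]

omit hM in
lemma sn_mono (hb : 0 < X.base) {a b : ℕ} (h : a ≤ b) : X.sn a ≤ X.sn b := by
  unfold sn
  split_ifs with h1 h2
  · exact le_rfl
  · exact Nat.zero_le _
  · omega
  · exact Nat.pow_le_pow_right hb (Nat.log_mono_right h)

variable (X δ D m live) in
/-- The balls of radius `D c ^ τ` and `D c ^ (τ + 2)` look alike in all the counts that the
algorithm makes. -/
structure Stable (k τ : ℕ) : Prop where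
  card : X.sn (X.ball δ D live (Sum.inl k) τ).card =
    X.sn (X.ball δ D live (Sum.inl k) (τ + 2)).card
  cnt : ∀ side, ∀ e ≤ invEps X.L X.imax,
    X.sn (cnt (X.ball δ D live (Sum.inl k) τ) (X.around m side e k)) =
      X.sn (cnt (X.ball δ D live (Sum.inl k) (τ + 2)) (X.around m side e k))

/-- Every element has a stable radius, since there are many radii but the counts, rounded to powers
of the base, take few values. -/
lemma exists_stable_radius (hX : X.Regular) (hlive : live.Nodup) (hsub : live ⊆ X.windows)
    (hE : 1 ≤ invEps X.L X.imax) {k : ℕ} (hk : k ∈ surv S₀ m live) :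
    ∃ τ < tauMax X.L X.imax, Stable X δ D m live k τ := by
  set E := invEps X.L X.imax with hEdef
  have hb := hX.base_ge
  have hlog : ∀ A : Finset Win, A ⊆ live.toFinset → Nat.log X.base A.card ≤ E := by
    intro A hA
    have h1 : A.card ≤ X.t := by
      refine (Finset.card_le_card hA).trans ((List.toFinset_card_le _).trans ?_)
      rw [← X.windows_length]
      exact (List.subperm_of_subset hlive hsub).length_le
    calc _ ≤ Nat.log X.base (X.base ^ E) := Nat.log_mono_right (h1.trans hX.t_le)
      _ = E := Nat.log_pow (by omega) _
  set B : ℕ → Finset Win := X.ball δ D live (Sum.inl k) with hB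
  have hBsub : ∀ τ, B τ ⊆ live.toFinset := fun τ => Finset.filter_subset _ _
  have hBmono : _root_.Monotone B := ball_mono _
  -- all the counts at once: if this sum does not change from `τ` to `τ + 2`, no summand does
  set F : ℕ → ℕ := fun τ => Nat.log X.base (B τ).card +
    ∑ e ∈ Finset.range (E + 1), (Nat.log X.base (cnt (B τ) (X.around m false e k)) +
      Nat.log X.base (cnt (B τ) (X.around m true e k))) with hF
  have hcard : ∀ τ τ', τ ≤ τ' → Nat.log X.base (B τ).card ≤ Nat.log X.base (B τ').card :=
    fun τ τ' h => Nat.log_mono_right (Finset.card_le_card (hBmono h))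
  have hcnt : ∀ J τ τ', τ ≤ τ' →
      Nat.log X.base (cnt (B τ) J) ≤ Nat.log X.base (cnt (B τ') J) :=
    fun J τ τ' h => Nat.log_mono_right (cnt_mono (hBmono h) J)
  have hFmono : _root_.Monotone F := fun τ τ' h =>
    add_le_add (hcard τ τ' h) (Finset.sum_le_sum fun e _ =>
      add_le_add (hcnt _ τ τ' h) (hcnt _ τ τ' h))
  have hFle : ∀ τ, F τ ≤ E + (E + 1) * (2 * E) := by
    intro τ
    refine add_le_add (hlog _ (hBsub τ)) ?_
    refine (Finset.sum_le_card_nsmul _ _ (2 * E) fun e _ => ?_).trans (by simp)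
    have h1 := hlog _ ((Finset.filter_subset (fun w =>
      (X.around m false e k).seven w = true) _).trans (hBsub τ))
    have h2 := hlog _ ((Finset.filter_subset (fun w =>
      (X.around m true e k).seven w = true) _).trans (hBsub τ))
    unfold cnt
    omega
  obtain ⟨j, hj, hjF⟩ := exists_stable hFmono hFle
  refine ⟨2 * j, ?_, ?_⟩
  · have : tauMax X.L X.imax = 1000 * E ^ 2 := rfl
    nlinarith
  · have h1 := hcard (2 * j) (2 * j + 2) (by omega)
    have h2 : ∀ e ∈ Finset.range (E + 1),
        Nat.log X.base (cnt (B (2 * j)) (X.around m false e k)) +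
          Nat.log X.base (cnt (B (2 * j)) (X.around m true e k)) ≤
        Nat.log X.base (cnt (B (2 * j + 2)) (X.around m false e k)) +
          Nat.log X.base (cnt (B (2 * j + 2)) (X.around m true e k)) := fun e _ =>
      add_le_add (hcnt _ _ _ (by omega)) (hcnt _ _ _ (by omega))
    have h3 := Finset.sum_le_sum h2
    have h4 : Nat.log X.base (B (2 * j)).card = Nat.log X.base (B (2 * j + 2)).card := by
      simp only [hF] at hjF
      omega
    have h5 := (Finset.sum_eq_sum_iff_of_le h2).1 (by simp only [hF] at hjF; omega)
    have hpos : ∀ side τ, wind m side k ∈ B τ := fun side τ => wind_mem_ball hM hk side τ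
    refine ⟨sn_eq_of_log (Finset.card_pos.2 ⟨_, hpos true _⟩)
      (Finset.card_pos.2 ⟨_, hpos true _⟩) h4, fun side e he => ?_⟩
    have h6 := h5 e (Finset.mem_range.2 (by omega))
    have h7 := hcnt (X.around m false e k) (2 * j) (2 * j + 2) (by omega)
    have h8 := hcnt (X.around m true e k) (2 * j) (2 * j + 2) (by omega)
    refine sn_eq_of_log (cnt_pos (hpos side _) (around_seven_self (by omega) side e k k rfl))
      (cnt_pos (hpos side _) (around_seven_self (by omega) side e k k rfl)) ?_
    change Nat.log X.base (cnt (B (2 * j)) (X.around m side e k)) =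
      Nat.log X.base (cnt (B (2 * j + 2)) (X.around m side e k))
    cases side <;> omega

variable (X δ D live) in
/-- The ball is big: its density exceeds `ρ⁻¹`. -/
def BigBall (k τ : ℕ) : Prop :=
  X.rho⁻¹ < (X.sn (X.ball δ D live (Sum.inl k) τ).card : ℝ) / X.sn live.toFinset.card

variable (X δ D m live) in
/-- The ball is dense on the interval of length `b ^ e` around one of the two windows. -/
def DenseBall (k τ : ℕ) (side : Bool) (e : ℕ) : Prop :=
  X.rho ≤ ((X.sn (cnt (X.ball δ D live (Sum.inl k) τ) (X.around m side e k)) : ℝ) /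
    X.sn (cnt live.toFinset (X.around m side e k))) /
      ((X.sn (X.ball δ D live (Sum.inl k) τ).card : ℝ) / X.sn live.toFinset.card)

/-- Cliques with a center in a stable ball pass the same tests as the ball. -/
lemma Stable.tests (hX : X.Regular) (hlive : live.Nodup) {k τ : ℕ} (hk : k ∈ surv S₀ m live)
    (hs : Stable X δ D m live k τ) {x : Win} (hx : x ∈ X.ball δ D live (Sum.inl k) τ)
    {C : List Win} (hC : X.Valid δ D live x (τ + 1) C) :
    (X.Big C live ↔ BigBall X δ D live k τ) ∧
    ∀ side, ∀ e ≤ invEps X.L X.imax, DenseBall X δ D m live k τ side e →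
      X.Dense C live (X.around m side e k) := by
  have hb := hX.base_ge
  obtain ⟨h1, h2⟩ := hC.sandwich hM hx
  have hCn : C.Nodup := hC.sublist.nodup hlive
  have hcard : X.sn C.length = X.sn (X.ball δ D live (Sum.inl k) τ).card := by
    rw [← List.toFinset_card_of_nodup hCn]
    refine le_antisymm ?_ (sn_mono (by omega) (Finset.card_le_card h1))
    rw [hs.card]
    exact sn_mono (by omega) (Finset.card_le_card h2)
  have hL : live.length = live.toFinset.card := (List.toFinset_card_of_nodup hlive).symm
  refine ⟨?_, fun side e he hd => ?_⟩
  · unfold Big BigBall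
    rw [hcard, hL]
  · have hcnt : X.sn (C.countP (X.around m side e k).seven) =
        X.sn (EditApprox.cnt (X.ball δ D live (Sum.inl k) τ) (X.around m side e k)) := by
      rw [countP_eq_cnt hCn]
      refine le_antisymm ?_ (sn_mono (by omega) (cnt_mono h1 _))
      rw [hs.cnt side e he]
      exact sn_mono (by omega) (cnt_mono h2 _)
    refine ⟨?_, ?_⟩
    · rw [List.any_eq_true]
      exact ⟨_, wind_mem_live hk side, around_seven_self (by omega) side e k k rfl⟩
    · rw [hcnt, hcard, hL, countP_eq_cnt hlive]
      exact hd

end Inst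

/-! ### Most elements of the matching have many good samples -/

/-- A union of large sets that do not overlap much is large. -/
lemma card_mul_le_card_biUnion {ι κ : Type*} [DecidableEq ι] [DecidableEq κ] (K : Finset ι)
    (B : ι → Finset κ) (c M : ℝ)
    (hc : ∀ k ∈ K, c ≤ (B k).card)
    (hM : ∀ x ∈ K.biUnion B, ((K.filter fun k => x ∈ B k).card : ℝ) ≤ M) :
    K.card * c ≤ (K.biUnion B).card * M := by
  have h1 : ∑ k ∈ K, ((B k).card : ℝ) =
      ∑ x ∈ K.biUnion B, ((K.filter fun k => x ∈ B k).card : ℝ) := by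
    have h2 : ∀ k ∈ K, (B k).card = ∑ x ∈ K.biUnion B, if x ∈ B k then 1 else 0 := by
      intro k hk
      rw [← Finset.card_filter]
      congr 1
      ext x
      simp only [Finset.mem_filter, Finset.mem_biUnion]
      exact ⟨fun h => ⟨⟨k, hk, h⟩, h⟩, fun h => h.2⟩
    norm_cast
    rw [Finset.sum_congr rfl h2, Finset.sum_comm]
    exact Finset.sum_congr rfl fun x _ => (Finset.card_filter _ _).symm
  calc K.card * c = ∑ k ∈ K, c := by simp
    _ ≤ ∑ k ∈ K, ((B k).card : ℝ) := Finset.sum_le_sum hc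
    _ ≤ ∑ x ∈ K.biUnion B, M := by rw [h1]; exact Finset.sum_le_sum hM
    _ = _ := by simp

/-- The inequality that results when the companions are counted against the union of their
balls. -/
lemma large_union_arith {η w g N b ρ K U : ℝ} (hg : 0 < g) (hN : 0 ≤ N) (hb : 0 < b) (hw : 0 < w)
    (hK : η * w ≤ K) (h : K * (g * N / b) ≤ U * (b * (ρ * g) * w)) :
    η * N ≤ ρ * b ^ 2 * U := by
  have h1 : η * w * (g * N / b) ≤ U * (b * (ρ * g) * w) :=
    (mul_le_mul_of_nonneg_right hK (by positivity)).trans h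
  have h2 : 0 < g * w / b := by positivity
  refine le_of_mul_le_mul_right ?_ h2
  calc η * N * (g * w / b) = η * w * (g * N / b) := by ring
    _ ≤ _ := h1
    _ = _ := by field_simp

namespace Inst

variable (X : Inst) (δ : Win → Win → ℕ) (D : ℕ)
variable {X δ D} {m : ℕ → ℕ} {S₀ : Finset ℕ} {live : List Win}

/-- The index of the window of element `k` of the matching on one side. -/
def idx (m : ℕ → ℕ) (side : Bool) (k : ℕ) : ℕ := if side then m k else k

variable (X live) in
/-- The weight of the `i`-th interval of length `b ^ e`: the number of live windows in the enlarged
parent interval, or of all live windows if there is no parent. -/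
noncomputable def weight (side : Bool) (e i : ℕ) : ℝ :=
  if e < invEps X.L X.imax then cnt live.toFinset (grid side (X.base ^ (e + 1)) (i / X.base))
  else live.toFinset.card

lemma weight_nonneg (side : Bool) (e i : ℕ) : 0 ≤ X.weight live side e i := by
  unfold weight; split_ifs <;> positivity

lemma around_parent (side : Bool) (e k : ℕ) : X.around m side (e + 1) k =
    grid side (X.base ^ (e + 1)) (idx m side k / X.base ^ e / X.base) := by
  unfold around idx
  rw [Nat.div_div_eq_div_mul, ← pow_succ]

/-- The weights of the intervals of one length that contain elements of the matching. -/
lemma sum_weight_le (hX : X.Regular) (side : Bool) (e : ℕ) (S : Finset ℕ)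
    (hS : ∀ k ∈ S, idx m side k < X.t) :
    ∑ i ∈ S.image (fun k => idx m side k / X.base ^ e), X.weight live side e i ≤
      7 * X.base * live.toFinset.card := by
  have hb := hX.base_ge
  have hb' : (8 : ℝ) ≤ X.base := by exact_mod_cast hb
  by_cases he : e < invEps X.L X.imax
  · simp only [weight, if_pos he]
    have h1 : ∑ i ∈ S.image (fun k => idx m side k / X.base ^ e),
        cnt live.toFinset (grid side (X.base ^ (e + 1)) (i / X.base)) ≤
        ∑ i ∈ Finset.range X.t,
        cnt live.toFinset (grid side (X.base ^ (e + 1)) (i / X.base)) := by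
      refine Finset.sum_le_sum_of_subset fun i hi => ?_
      obtain ⟨k, hk, rfl⟩ := Finset.mem_image.1 hi
      exact Finset.mem_range.2 ((Nat.div_le_self _ _).trans_lt (hS k hk))
    have h2 := h1.trans (sum_cnt_parents_le live.toFinset side X.t X.base (X.base ^ (e + 1))
      (by omega) (pow_pos (by omega) _))
    exact_mod_cast h2
  · simp only [weight, if_neg he, Finset.sum_const, nsmul_eq_mul]
    have h1 : (S.image (fun k => idx m side k / X.base ^ e)).card ≤ 1 := by
      refine Finset.card_le_one.2 fun i hi j hj => ?_
      obtain ⟨k, hk, rfl⟩ := Finset.mem_image.1 hi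
      obtain ⟨k', hk', rfl⟩ := Finset.mem_image.1 hj
      have h2 : X.t ≤ X.base ^ e :=
        hX.t_le.trans (Nat.pow_le_pow_right (by omega) (by omega))
      rw [Nat.div_eq_of_lt ((hS k hk).trans_le h2), Nat.div_eq_of_lt ((hS k' hk').trans_le h2)]
    have h3 : ((S.image (fun k => idx m side k / X.base ^ e)).card : ℝ) ≤ 7 * X.base :=
      (Nat.cast_le.2 h1).trans (by push_cast; linarith)
    exact mul_le_mul_of_nonneg_right h3 (Nat.cast_nonneg _)

variable (hM : CloseMatching X δ D m S₀)

variable (X δ D live) in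
/-- The density of the ball, rounded. -/
noncomputable def ballDensity (k τ : ℕ) : ℝ :=
  (X.sn (X.ball δ D live (Sum.inl k) τ).card : ℝ) / X.sn live.toFinset.card

lemma card_live_pos {k : ℕ} (hk : k ∈ surv S₀ m live) : 0 < live.toFinset.card :=
  Finset.card_pos.2 ⟨_, List.mem_toFinset.2 (mem_surv.1 hk).2.1⟩

lemma ballDensity_mul_le (hX : X.Regular) {k : ℕ} (hk : k ∈ surv S₀ m live) (τ : ℕ) :
    X.ballDensity δ D live k τ * live.toFinset.card ≤
      X.base * (X.ball δ D live (Sum.inl k) τ).card := by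
  have hb := hX.base_ge
  have h1 : (0 : ℝ) < X.sn live.toFinset.card := by
    exact_mod_cast X.sn_pos (by omega) (card_live_pos hk)
  have h2 : (X.sn (X.ball δ D live (Sum.inl k) τ).card : ℝ) ≤
      (X.ball δ D live (Sum.inl k) τ).card := by exact_mod_cast X.sn_le _
  have h3 : (live.toFinset.card : ℝ) ≤ X.base * X.sn live.toFinset.card := by
    exact_mod_cast X.le_mul_sn (by omega) _
  unfold ballDensity
  rw [div_mul_eq_mul_div, div_le_iff₀ h1]
  calc _ ≤ ((X.ball δ D live (Sum.inl k) τ).card : ℝ) * (X.base * X.sn live.toFinset.card) :=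
        mul_le_mul h2 h3 (Nat.cast_nonneg _) (Nat.cast_nonneg _)
    _ = _ := by ring

section

include hM

lemma ballDensity_pos (hX : X.Regular) {k : ℕ} (hk : k ∈ surv S₀ m live) (τ : ℕ) :
    0 < X.ballDensity δ D live k τ := by
  have hb := hX.base_ge
  have h1 := X.sn_pos (by omega) (card_live_pos hk)
  have h2 := X.sn_pos (by omega) (Finset.card_pos.2 ⟨_, wind_mem_ball hM hk true τ⟩)
  unfold ballDensity
  positivity

/-- Every ball that is not big is dense on a shortest interval, all of whose counts are
`snap`ped to `1`. -/
lemma denseBall_zero (hX : X.Regular) {k τ : ℕ} (hk : k ∈ surv S₀ m live)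
    (hbig : ¬ X.BigBall δ D live k τ) (side : Bool) : X.DenseBall δ D m live k τ side 0 := by
  have hb := hX.base_ge
  have hg := ballDensity_pos hM hX hk τ
  have h1 : ∀ a, 0 < a → a ≤ 7 → X.sn a = 1 := by
    intro a ha ha'
    unfold sn
    rw [if_neg (by omega), Nat.log_of_lt (by omega), pow_zero]
  have h2 : ∀ A : Finset Win, wind m side k ∈ A → X.sn (cnt A (X.around m side 0 k)) = 1 := by
    intro A hA
    refine h1 _ (cnt_pos hA (around_seven_self (by omega) side 0 k k rfl)) ?_
    unfold around
    rw [pow_zero]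
    exact cnt_grid_one_le _ _ _
  unfold DenseBall
  rw [h2 _ (wind_mem_ball hM hk side τ), h2 _ (List.mem_toFinset.2 (wind_mem_live hk side))]
  unfold BigBall at hbig
  rw [not_lt] at hbig
  unfold ballDensity at hg
  rw [Nat.cast_one, div_one, le_div_iff₀ hg, mul_comm, ← le_div_iff₀ (by linarith [hX.rho_ge]),
    one_div]
  exact hbig

/-- A ball that is not dense on the parent interval has few windows in an interval. -/
lemma Stable.cnt_le (hX : X.Regular) {k τ : ℕ} (hk : k ∈ surv S₀ m live)
    (hs : Stable X δ D m live k τ) (side : Bool) {e : ℕ} (he : e ≤ invEps X.L X.imax)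
    (hd : e < invEps X.L X.imax → ¬ X.DenseBall δ D m live k τ side (e + 1)) :
    (EditApprox.cnt (X.ball δ D live (Sum.inl k) (τ + 2)) (X.around m side e k) : ℝ) ≤
      X.base * (X.rho * X.ballDensity δ D live k τ) *
        X.weight live side e (idx m side k / X.base ^ e) := by
  have hb := hX.base_ge
  have hρ := hX.rho_ge
  have hg := ballDensity_pos hM hX hk τ
  have hb0 : (0 : ℝ) ≤ X.base := Nat.cast_nonneg _
  unfold weight
  split_ifs with h
  · have h1 : (EditApprox.cnt (X.ball δ D live (Sum.inl k) (τ + 2)) (X.around m side e k) : ℝ) ≤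
        X.base * X.sn (EditApprox.cnt (X.ball δ D live (Sum.inl k) τ) (X.around m side e k)) := by
      rw [hs.cnt side e he]
      exact_mod_cast X.le_mul_sn (by omega) _
    have h2 : (X.sn (EditApprox.cnt (X.ball δ D live (Sum.inl k) τ) (X.around m side e k)) : ℝ) ≤
        X.sn (EditApprox.cnt (X.ball δ D live (Sum.inl k) τ) (X.around m side (e + 1) k)) := by
      exact_mod_cast sn_mono (by omega) (cnt_around_succ (by omega) _ side e k)
    have h3 := hd h
    change ¬ X.rho ≤ _ / X.ballDensity δ D live k τ at h3
    rw [not_le, div_lt_iff₀ hg] at h3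
    have h4 : 0 < EditApprox.cnt live.toFinset (X.around m side (e + 1) k) :=
      cnt_pos (List.mem_toFinset.2 (wind_mem_live hk side))
        (around_seven_self (by omega) side (e + 1) k k rfl)
    have h5 : (0 : ℝ) < X.sn (EditApprox.cnt live.toFinset (X.around m side (e + 1) k)) := by
      exact_mod_cast X.sn_pos (by omega) h4
    rw [div_lt_iff₀ h5] at h3
    have h6 : (X.sn (EditApprox.cnt live.toFinset (X.around m side (e + 1) k)) : ℝ) ≤
        EditApprox.cnt live.toFinset (X.around m side (e + 1) k) := by
      exact_mod_cast X.sn_le _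
    rw [← around_parent]
    have h7 : 0 ≤ X.rho * X.ballDensity δ D live k τ := by positivity
    calc _ ≤ _ := h1
      _ ≤ X.base * (X.rho * X.ballDensity δ D live k τ *
          EditApprox.cnt live.toFinset (X.around m side (e + 1) k)) := by
        refine mul_le_mul_of_nonneg_left ?_ hb0
        exact h2.trans (h3.le.trans (mul_le_mul_of_nonneg_left h6 h7))
      _ = _ := by ring
  · have h1 : (EditApprox.cnt (X.ball δ D live (Sum.inl k) (τ + 2)) (X.around m side e k) : ℝ) ≤
        X.base * X.sn (X.ball δ D live (Sum.inl k) τ).card := by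
      rw [hs.card]
      exact_mod_cast (cnt_le_card _ _).trans (X.le_mul_sn (by omega) _)
    have h2 : (0 : ℝ) < X.sn live.toFinset.card := by
      exact_mod_cast X.sn_pos (by omega) (card_live_pos hk)
    have h3 : (X.sn live.toFinset.card : ℝ) ≤ live.toFinset.card := by
      exact_mod_cast X.sn_le _
    have h4 : (X.sn (X.ball δ D live (Sum.inl k) τ).card : ℝ) =
        X.ballDensity δ D live k τ * X.sn live.toFinset.card := by
      unfold ballDensity; field_simp
    rw [h4] at h1
    calc _ ≤ _ := h1
      _ ≤ X.base * ((X.rho * X.ballDensity δ D live k τ) * live.toFinset.card) := by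
        refine mul_le_mul_of_nonneg_left (mul_le_mul ?_ h3 h2.le (by positivity)) hb0
        nlinarith
      _ = _ := by ring

/-- Every element of a ball that is big is a good center. -/
lemma Stable.hit_of_bigBall (hX : X.Regular) (hlive : live.Nodup) {k τ : ℕ}
    (hk : k ∈ surv S₀ m live) (hs : Stable X δ D m live k τ) (hbig : X.BigBall δ D live k τ)
    {x : Win} (hx : x ∈ X.ball δ D live (Sum.inl k) τ) : X.Hit δ D m live k x (τ + 1) := by
  intro C hC
  have h1 := (hs.tests hM hX hlive hk hx hC).1.2 hbig
  have h2 := (hC.sandwich hM hx).1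
  exact ⟨fun _ => ⟨List.mem_toFinset.1 (h2 (wind_mem_ball hM hk false τ)),
    List.mem_toFinset.1 (h2 (wind_mem_ball hM hk true τ))⟩, fun h => absurd h1 h⟩

/-- An element of a ball that is not big is a good center, even for another element of the
matching in the same intervals. -/
lemma Stable.hit_of_denseBall (hX : X.Regular) (hlive : live.Nodup) {k k' τ : ℕ}
    (hk : k ∈ surv S₀ m live) (hk' : k' ∈ surv S₀ m live) (hs : Stable X δ D m live k' τ)
    (hbig : ¬ X.BigBall δ D live k' τ) (e : Bool → ℕ) (he : ∀ side, e side ≤ invEps X.L X.imax)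
    (hd : ∀ side, X.DenseBall δ D m live k' τ side (e side))
    (hcell : ∀ side, idx m side k / X.base ^ e side = idx m side k' / X.base ^ e side)
    {x : Win} (hx : x ∈ X.ball δ D live (Sum.inl k') τ) : X.Hit δ D m live k x (τ + 1) := by
  intro C hC
  have hb := hX.base_ge
  have h1 := hs.tests hM hX hlive hk' hx hC
  refine ⟨fun h => absurd (h1.1.1 h) hbig, fun _ => ?_⟩
  have h2 : ∀ side, wind m side k ∈ X.nextLive C live := by
    intro side
    rw [mem_nextLive]
    refine ⟨wind_mem_live hk side, _, around_mem_intervals (by omega) (he side) ?_,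
      h1.2 side (e side) (he side) (hd side), around_seven_self (by omega) side _ k' k
        (hcell side)⟩
    have h3 := (mem_surv.1 hk').1
    cases side
    · exact hM.lt_numA _ h3
    · exact hM.lt_numB _ h3
  exact ⟨h2 false, h2 true⟩

/-- The elements of the matching in a cell whose balls contain a common window. -/
lemma Stable.card_common_le (hX : X.Regular) {k τ : ℕ} (hk : k ∈ surv S₀ m live)
    (hs : Stable X δ D m live k τ) (side : Bool) {e : ℕ} (he : e ≤ invEps X.L X.imax)
    (hd : e < invEps X.L X.imax → ¬ X.DenseBall δ D m live k τ side (e + 1))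
    {x : Win} (hx : x ∈ X.ball δ D live (Sum.inl k) τ) (K : Finset ℕ) (hK : K ⊆ surv S₀ m live)
    (hcell : ∀ k' ∈ K, idx m side k' / X.base ^ e = idx m side k / X.base ^ e)
    (hxK : ∀ k' ∈ K, x ∈ X.ball δ D live (Sum.inl k') τ) :
    (K.card : ℝ) ≤ X.base * (X.rho * X.ballDensity δ D live k τ) *
        X.weight live side e (idx m side k / X.base ^ e) := by
  have hb := hX.base_ge
  refine le_trans ?_ (hs.cnt_le hM hX hk side he hd)
  have hinj : Set.InjOn (wind m side) (K : Set ℕ) := by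
    intro a ha b hb' hab
    cases side
    · exact Sum.inl_injective hab
    · exact hM.strictMono.injOn (mem_surv.1 (hK ha)).1 (mem_surv.1 (hK hb')).1
        (Sum.inr_injective hab)
  rw [← Finset.card_image_of_injOn hinj]
  norm_cast
  refine Finset.card_le_card fun w hw => ?_
  obtain ⟨k', hk', rfl⟩ := Finset.mem_image.1 hw
  refine Finset.mem_filter.2 ⟨?_, around_seven_self (by omega) side e k k' (hcell k' hk')⟩
  rw [mem_ball]
  refine ⟨wind_mem_live (hK hk') side, ?_⟩
  have h1 := mem_ball_of_common hM (hxK k' hk') hx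
  have h2 : δ (Sum.inl k') (wind m side k') ≤ D := by
    cases side
    · simp [wind, hM.refl]
    · exact hM.close k' (mem_surv.1 (hK hk')).1
  have h3 := hM.tri (Sum.inl k) (Sum.inl k') (wind m side k')
  have h4 := X.radius_step' (D := D) τ
  have h5 := X.radius_step' (D := D) (τ + 1)
  rw [show τ + 1 + 1 = τ + 2 by ring] at h5
  omega

open scoped Classical in
set_option maxHeartbeats 1000000 in
/-- The core of the analysis. All but few elements of the matching have many good samples. An
exception has few companions, that is elements of the same type (radius, scales and size of the
ball) in the same intervals; otherwise the balls of the companions, which overlap only little, have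
a large union, and all its elements are good centers. -/
theorem exists_few_exceptions (hX : X.Regular) (hlive : live.Nodup) (hsub : live ⊆ X.windows)
    (hE : 1 ≤ invEps X.L X.imax) {η : ℝ} (hη : 0 < η) (hη1 : η ≤ 1) :
    ∃ Bad ⊆ surv S₀ m live,
      (Bad.card : ℝ) ≤ (tauMax X.L X.imax * (invEps X.L X.imax + 1) ^ 3) *
        (η * (14 * X.base * live.length)) ∧
      ∀ k ∈ surv S₀ m live, k ∉ Bad →
        η * live.length ≤ X.rho * X.base ^ 2 *
          ((live.toFinset ×ˢ Finset.range (tauMax X.L X.imax)).filter fun p =>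
            X.Hit δ D m live k p.1 (p.2 + 1)).card := by
  set E := invEps X.L X.imax with hEdef
  set T := tauMax X.L X.imax with hT
  set S := surv S₀ m live with hS
  have hb := hX.base_ge
  have hb' : (8 : ℝ) ≤ X.base := by exact_mod_cast hb
  have hρ := hX.rho_ge
  have hL : live.length = live.toFinset.card := (List.toFinset_card_of_nodup hlive).symm
  rw [hL]
  set N : ℝ := (live.toFinset.card : ℝ) with hN
  have hN0 : 0 ≤ N := Nat.cast_nonneg _
  have hsr : ∀ k, ∃ τ, k ∈ S → τ < T ∧ Stable X δ D m live k τ := by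
    intro k
    by_cases hk : k ∈ S
    · obtain ⟨τ, h1, h2⟩ := exists_stable_radius hM hX hlive hsub hE hk
      exact ⟨τ, fun _ => ⟨h1, h2⟩⟩
    · exact ⟨0, fun h => absurd h hk⟩
  choose τ hτ using hsr
  -- the scale: the largest one on which the ball is dense
  set e : Bool → ℕ → ℕ := fun side k =>
    Nat.findGreatest (fun e => X.DenseBall δ D m live k (τ k) side e) E with he
  have heE : ∀ side k, e side k ≤ E := fun side k => Nat.findGreatest_le _
  set S' := S.filter fun k => ¬ X.BigBall δ D live k (τ k) with hS'
  have hdense : ∀ k ∈ S', ∀ side, X.DenseBall δ D m live k (τ k) side (e side k) := by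
    intro k hk side
    obtain ⟨hkS, hkb⟩ := Finset.mem_filter.1 hk
    exact Nat.findGreatest_spec (P := fun e => X.DenseBall δ D m live k (τ k) side e)
      (Nat.zero_le E) (denseBall_zero hM hX hkS hkb side)
  have hnot : ∀ k side, e side k < E → ¬ X.DenseBall δ D m live k (τ k) side (e side k + 1) :=
    fun k side h => Nat.findGreatest_is_greatest (P := fun e =>
      X.DenseBall δ D m live k (τ k) side e) (Nat.lt_succ_self _) h
  set h : ℕ → ℕ := fun k => Nat.log X.base (X.ball δ D live (Sum.inl k) (τ k)).card with hh
  set ty : ℕ → ℕ × ℕ × ℕ × ℕ := fun k => (τ k, e false k, e true k, h k) with hty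
  set Ty : Finset (ℕ × ℕ × ℕ × ℕ) := Finset.range T ×ˢ Finset.range (E + 1) ×ˢ
    Finset.range (E + 1) ×ˢ Finset.range (E + 1) with hTy
  have hcardT : X.t = X.windows.length := X.windows_length.symm
  have hNt : live.toFinset.card ≤ X.t := by
    rw [hcardT, ← hL]
    exact (List.subperm_of_subset hlive hsub).length_le
  have htyT : ∀ k ∈ S', ty k ∈ Ty := by
    intro k hk
    have hkS := (Finset.mem_filter.1 hk).1
    have h1 : h k ≤ E := by
      refine (Nat.log_mono_right (b := X.base) (m := X.base ^ E) ?_).trans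
        (Nat.log_pow (by omega) _).le
      exact ((Finset.card_le_card (Finset.filter_subset _ _)).trans hNt).trans hX.t_le
    simp only [hTy, hty, Finset.mem_product, Finset.mem_range, Order.lt_add_one_iff]
    exact ⟨(hτ k hkS).1, heE _ _, heE _ _, h1⟩
  -- the elements of one type, and those with few companions
  set Sty : ℕ × ℕ × ℕ × ℕ → Finset ℕ := fun c => S'.filter fun k => ty k = c with hSty
  set cl : ℕ × ℕ × ℕ × ℕ → ℕ → Finset ℕ := fun c k => (Sty c).filter fun k' =>
    idx m false k' / X.base ^ c.2.1 = idx m false k / X.base ^ c.2.1 ∧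
    idx m true k' / X.base ^ c.2.2.1 = idx m true k / X.base ^ c.2.2.1 with hcl
  set wt : ℕ × ℕ × ℕ × ℕ → ℕ → ℝ := fun c k =>
    min (X.weight live false c.2.1 (idx m false k / X.base ^ c.2.1))
      (X.weight live true c.2.2.1 (idx m true k / X.base ^ c.2.2.1)) with hwt
  set Bd : ℕ × ℕ × ℕ × ℕ → Finset ℕ := fun c => (Sty c).filter fun k =>
    ((cl c k).card : ℝ) < η * wt c k with hBd
  have hidx : ∀ side, ∀ k ∈ S, idx m side k < X.t := by
    intro side k hk
    have h1 := (mem_surv.1 hk).1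
    have h2 := hM.lt_numA k h1
    have h3 := hM.lt_numB k h1
    cases side <;> simp only [idx, Inst.t] <;> simp <;> omega
  -- elements of one type are sorted into cells by the intervals of their two windows; the
  -- exceptions are the elements of sparse cells
  have hBdle : ∀ c, ((Bd c).card : ℝ) ≤ η * (14 * X.base * N) := by
    intro c
    have hsubS : Sty c ⊆ S := (Finset.filter_subset _ _).trans (Finset.filter_subset _ _)
    have hmono : ∀ side, MonotoneOn (fun k => idx m side k / X.base ^
        (if side then c.2.2.1 else c.2.1)) (Sty c : Set ℕ) := by
      intro side a ha b hb hab
      refine Nat.div_le_div_right ?_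
      cases side
      · exact hab
      · exact hM.strictMono.monotoneOn (mem_surv.1 (hsubS ha)).1 (mem_surv.1 (hsubS hb)).1 hab
    have h1 := card_sparse_cells_le (Sty c) _ _ (hmono false) (hmono true)
      (X.weight live false c.2.1) (X.weight live true c.2.2.1) (weight_nonneg _ _)
      (weight_nonneg _ _) η hη.le
    refine h1.trans (mul_le_mul_of_nonneg_left ?_ hη.le)
    have h2 := sum_weight_le (live := live) hX false c.2.1 (Sty c) (m := m)
      fun k hk => hidx false k (hsubS hk)
    have h3 := sum_weight_le (live := live) hX true c.2.2.1 (Sty c) (m := m)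
      fun k hk => hidx true k (hsubS hk)
    calc _ ≤ 7 * X.base * N + 7 * X.base * N := add_le_add h2 h3
      _ = _ := by ring
  refine ⟨Ty.biUnion Bd, ?_, ?_, ?_⟩
  · intro k hk
    obtain ⟨c, -, hk⟩ := Finset.mem_biUnion.1 hk
    exact (Finset.mem_filter.1 (Finset.mem_filter.1 (Finset.mem_filter.1 hk).1).1).1
  · have h1 : ((Ty.biUnion Bd).card : ℝ) ≤ ∑ c ∈ Ty, ((Bd c).card : ℝ) := by
      exact_mod_cast Finset.card_biUnion_le
    refine (h1.trans (Finset.sum_le_card_nsmul _ _ _ fun c _ => hBdle c)).trans (le_of_eq ?_)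
    rw [nsmul_eq_mul]
    congr 1
    simp only [hTy, Finset.card_product, Finset.card_range]
    push_cast
    ring
  · intro k hk hkBad
    obtain ⟨hτT, hst⟩ := hτ k hk
    -- it suffices to have many good centers for one threshold
    suffices hU : ∃ U ⊆ live.toFinset, (∀ x ∈ U, X.Hit δ D m live k x (τ k + 1)) ∧
        η * N ≤ X.rho * X.base ^ 2 * U.card by
      obtain ⟨U, hUL, hUhit, hUcard⟩ := hU
      refine hUcard.trans (mul_le_mul_of_nonneg_left ?_ (by positivity))
      norm_cast
      rw [← Finset.card_image_of_injective U (Prod.mk_left_injective (τ k))]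
      refine Finset.card_le_card fun p hp => ?_
      obtain ⟨x, hx, rfl⟩ := Finset.mem_image.1 hp
      exact Finset.mem_filter.2 ⟨Finset.mem_product.2 ⟨hUL hx, Finset.mem_range.2 hτT⟩,
        hUhit x hx⟩
    by_cases hbig : X.BigBall δ D live k (τ k)
    -- a big ball is itself a large set of good centers
    · refine ⟨_, Finset.filter_subset _ _, fun x hx => hst.hit_of_bigBall hM hX hlive hk hbig hx,
        ?_⟩
      have h1 := ballDensity_mul_le (δ := δ) (D := D) hX hk (τ k)
      have h2 : X.rho⁻¹ < X.ballDensity δ D live k (τ k) := hbig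
      have h3 : X.rho⁻¹ * N ≤ X.base * (X.ball δ D live (Sum.inl k) (τ k)).card :=
        (mul_le_mul_of_nonneg_right h2.le hN0).trans h1
      have h4 : N ≤ X.rho * (X.base * (X.ball δ D live (Sum.inl k) (τ k)).card) := by
        rwa [inv_mul_le_iff₀ (by linarith)] at h3
      have h5 : (0 : ℝ) ≤ X.rho * (X.base * (X.ball δ D live (Sum.inl k) (τ k)).card) := by
        positivity
      calc η * N ≤ N := mul_le_of_le_one_left hN0 hη1
        _ ≤ _ := h4
        _ ≤ X.base * (X.rho * (X.base * (X.ball δ D live (Sum.inl k) (τ k)).card)) :=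
          le_mul_of_one_le_left h5 (by linarith)
        _ = _ := by unfold ball; ring
    · have hkS' : k ∈ S' := Finset.mem_filter.2 ⟨hk, hbig⟩
      have hkSty : k ∈ Sty (ty k) := Finset.mem_filter.2 ⟨hkS', rfl⟩
      set K := cl (ty k) k with hK
      have hKwt : η * wt (ty k) k ≤ K.card := by
        by_contra! hcon
        exact hkBad (Finset.mem_biUnion.2 ⟨ty k, htyT k hkS',
          Finset.mem_filter.2 ⟨hkSty, hcon⟩⟩)
      set g := X.ballDensity δ D live k (τ k) with hg
      have hg0 : 0 < g := ballDensity_pos hM hX hk _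
      -- what the companions have in common
      have hKprop : ∀ k' ∈ K, k' ∈ S ∧ k' ∈ S' ∧ τ k' = τ k ∧ (∀ side, e side k' = e side k) ∧
          (∀ side, idx m side k' / X.base ^ e side k = idx m side k / X.base ^ e side k) ∧
          X.ballDensity δ D live k' (τ k) = g := by
        intro k' hk'
        obtain ⟨h1, h2, h3⟩ := Finset.mem_filter.1 hk'
        obtain ⟨h4, h5⟩ := Finset.mem_filter.1 h1
        have h6 := (Finset.mem_filter.1 h4).1
        simp only [hty, Prod.mk.injEq] at h5
        refine ⟨h6, h4, h5.1, ?_, ?_, ?_⟩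
        · intro side; cases side
          · exact h5.2.1
          · exact h5.2.2.1
        · intro side; cases side
          · exact h2
          · exact h3
        · rw [hg]
          unfold ballDensity
          rw [sn_eq_of_log (Finset.card_pos.2 ⟨_, wind_mem_ball hM h6 true _⟩)
            (Finset.card_pos.2 ⟨_, wind_mem_ball hM hk true _⟩) (b :=
              (X.ball δ D live (Sum.inl k) (τ k)).card)]
          have := h5.2.2.2
          simp only [hh, h5.1] at this
          exact this
      refine ⟨K.biUnion fun k' => X.ball δ D live (Sum.inl k') (τ k), ?_, ?_, ?_⟩
      · exact Finset.biUnion_subset.2 fun k' _ => Finset.filter_subset _ _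
      · intro x hx
        obtain ⟨k', hk', hx⟩ := Finset.mem_biUnion.1 hx
        obtain ⟨h1, h2, h3, h4, h5, -⟩ := hKprop k' hk'
        have hs' := (hτ k' h1).2
        have hd' := hdense k' h2
        have hb2 := (Finset.mem_filter.1 h2).2
        rw [h3] at hs' hd' hb2
        exact hs'.hit_of_denseBall hM hX hlive hk h1 hb2 (fun side => e side k)
          (fun side => heE side k) (fun side => h4 side ▸ hd' side) (fun side => (h5 side).symm) hx
      · have hw0 : 0 < wt (ty k) k := by
          have h1 : ∀ side, 0 < X.weight live side (e side k)
              (idx m side k / X.base ^ e side k) := by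
            intro side
            unfold weight
            split_ifs
            · rw [← around_parent]
              exact_mod_cast cnt_pos (List.mem_toFinset.2 (wind_mem_live hk side))
                (around_seven_self (by omega) side _ k k rfl)
            · exact_mod_cast card_live_pos hk
          exact lt_min (h1 false) (h1 true)
        have h1 := card_mul_le_card_biUnion K (fun k' => X.ball δ D live (Sum.inl k') (τ k))
          (g * N / X.base) (X.base * (X.rho * g) * wt (ty k) k) ?_ ?_
        · exact large_union_arith hg0 hN0 (by linarith) hw0 hKwt h1
        · intro k' hk'
          obtain ⟨h2, -, -, -, -, h3⟩ := hKprop k' hk'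
          have h4 := ballDensity_mul_le (δ := δ) (D := D) hX h2 (τ k)
          rw [h3] at h4
          rw [div_le_iff₀ (by linarith), mul_comm ((X.ball _ _ _ _ _).card : ℝ)]
          exact h4
        · intro x hx
          obtain ⟨k', hk', hx⟩ := Finset.mem_biUnion.1 hx
          obtain ⟨h2, h2', h3, h4, h5, h6⟩ := hKprop k' hk'
          have hs' := (hτ k' h2).2
          rw [h3] at hs'
          -- companions with a common point lie in a single ball, which has few windows in the
          -- interval since it is not dense on the parent interval
          have key : ∀ side,
              ((K.filter fun k'' => x ∈ X.ball δ D live (Sum.inl k'') (τ k)).card : ℝ) ≤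
              X.base * (X.rho * g) * X.weight live side (e side k)
                (idx m side k / X.base ^ e side k) := by
            intro side
            have hd' := hnot k' side
            rw [h3, h4 side] at hd'
            have := hs'.card_common_le hM hX h2 side (heE side k) hd' hx
              (K.filter fun k'' => x ∈ X.ball δ D live (Sum.inl k'') (τ k))
              (fun k'' hk'' => (hKprop k'' (Finset.mem_filter.1 hk'').1).1)
              (fun k'' hk'' => by
                rw [(hKprop k'' (Finset.mem_filter.1 hk'').1).2.2.2.2.1 side, h5 side])
              (fun k'' hk'' => (Finset.mem_filter.1 hk'').2)
            rwa [h6, h5 side] at this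
          change _ ≤ X.base * (X.rho * g) * min _ _
          rw [mul_min_of_nonneg _ _ (by positivity)]
          exact le_min (key false) (key true)

end

end Inst

/-! ### The expected number of missed edges -/

namespace Prog

variable {ok : Query → ℕ → Prop} {σ ι : Type}

lemma worst_foldlM_append (φ : σ → ℝ≥0∞) (f : σ → ι → Prog σ) (l l' : List ι) (s : σ) :
    worst ok φ ((l ++ l').foldlM f s) =
      worst ok (fun s' => worst ok φ (l'.foldlM f s')) (l.foldlM f s) := by
  induction l generalizing s with
  | nil => rfl
  | cons x l ih =>
    simp only [List.cons_append, List.foldlM_cons, bind_eq, worst_bind, ih]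

/-- A potential that contracts up to an additive error. -/
lemma worst_foldlM_le (φ : σ → ℝ≥0∞) (f : σ → ι → Prog σ) (q lam : ℝ≥0∞)
    (h : ∀ s x, worst ok φ (f s x) ≤ q * φ s + lam) (l : List ι) (s : σ) :
    worst ok φ (l.foldlM f s) ≤
      q ^ l.length * φ s + lam * ∑ i ∈ Finset.range l.length, q ^ i := by
  induction l generalizing s with
  | nil => simp
  | cons x l ih =>
    rw [List.foldlM_cons, bind_eq, worst_bind]
    calc _ ≤ worst ok (fun s' => q ^ l.length * φ s' +
          lam * ∑ i ∈ Finset.range l.length, q ^ i) (f s x) := worst_mono ih _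
      _ ≤ q ^ l.length * worst ok φ (f s x) + lam * ∑ i ∈ Finset.range l.length, q ^ i :=
          (worst_add_le _ _ _).trans (add_le_add (worst_const_mul_le _ _ _) (worst_const_le _ _))
      _ ≤ q ^ l.length * (q * φ s + lam) + lam * ∑ i ∈ Finset.range l.length, q ^ i := by
          gcongr; exact h s x
      _ = _ := by rw [List.length_cons, Finset.sum_range_succ, pow_succ]; ring

open scoped Classical in
/-- Amplification: if every block of `ℓ` rounds removes a bad state with probability at least
`1 / 2`, and bad states do not return, then `B` blocks fail with probability at most `2 ^ (-B)`. -/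
lemma worst_blocks_le (bad : σ → Prop) (f : σ → ι → Prog σ) (ℓ : ℕ)
    (hstay : ∀ s x, ¬ bad s → Yields ok (fun s' => ¬ bad s') (f s x))
    (hblock : ∀ (l : List ι) (s : σ), l.length = ℓ →
      worst ok (fun s => if bad s then 1 else 0) (l.foldlM f s) ≤ 2⁻¹)
    (B : ℕ) (l : List ι) (hl : B * ℓ ≤ l.length) (s : σ) :
    worst ok (fun s => if bad s then 1 else 0) (l.foldlM f s) ≤ 2⁻¹ ^ B := by
  induction B generalizing l s with
  | zero =>
    rw [pow_zero]
    refine (worst_mono (fun s => ?_) _).trans (worst_const_le _ 1)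
    split_ifs <;> simp
  | succ B ih =>
    rw [Nat.succ_mul] at hl
    rw [← List.take_append_drop ℓ l, worst_foldlM_append]
    calc _ ≤ worst ok (fun s => 2⁻¹ ^ B * if bad s then 1 else 0) ((l.take ℓ).foldlM f s) := by
          refine worst_mono (fun s' => ?_) _
          by_cases hs : bad s'
          · rw [if_pos hs, mul_one]
            exact ih _ (by rw [List.length_drop]; omega) _
          · rw [if_neg hs, mul_zero]
            refine worst_le_of_yields (Q := fun s => ¬ bad s) (fun b hb => ?_)
              (Yields.foldlM _ (fun s x _ => hstay s x) s' hs)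
            rw [if_neg hb]
      _ ≤ 2⁻¹ ^ B * 2⁻¹ := (worst_const_mul_le _ _ _).trans
          (mul_le_mul_right (hblock _ _ (by rw [List.length_take]; omega)) _)
      _ = _ := (pow_succ _ _).symm

end Prog

namespace Inst

variable (X : Inst) (δ : Win → Win → ℕ) (D : ℕ)

/-- The answers of successful calls. -/
def Ok (q : Query) (v : ℕ) : Prop :=
  δ q.x q.y ≤ v ∧ v ≤ alpha (X.L - 1) X.imax * (δ q.x q.y + q.Δ)

open scoped Classical in
/-- The number of elements of `G` whose edges have not been found. -/
noncomputable def missed (m : ℕ → ℕ) (G : Finset ℕ) (E : List (Win × Win)) : ℕ :=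
  (G.filter fun k => (Sum.inl k, Sum.inr (m k)) ∉ E).card

variable {X δ D} {m : ℕ → ℕ} {S₀ : Finset ℕ} {live : List Win}

open scoped Classical in
lemma missed_le_card (G : Finset ℕ) (E : List (Win × Win)) : missed m G E ≤ G.card :=
  Finset.card_le_card (Finset.filter_subset _ _)

lemma missed_anti {G : Finset ℕ} {E E' : List (Win × Win)} (h : E ⊆ E') :
    missed m G E' ≤ missed m G E := by
  classical
  refine Finset.card_le_card fun k hk => ?_
  obtain ⟨h1, h2⟩ := Finset.mem_filter.1 hk
  exact Finset.mem_filter.2 ⟨h1, fun h3 => h2 (h h3)⟩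

lemma missed_le_add (G S : Finset ℕ) (E : List (Win × Win)) :
    missed m S E ≤ (S \ G).card + missed m G E := by
  classical
  refine (Finset.card_le_card (t := (S \ G) ∪ G.filter fun k =>
    (Sum.inl k, Sum.inr (m k)) ∉ E) fun k hk => ?_).trans (Finset.card_union_le _ _)
  obtain ⟨h1, h2⟩ := Finset.mem_filter.1 hk
  by_cases h3 : k ∈ G
  · exact Finset.mem_union_right _ (Finset.mem_filter.2 ⟨h3, h2⟩)
  · exact Finset.mem_union_left _ (Finset.mem_sdiff.2 ⟨h1, h3⟩)

/-- The cliques that `SampleClique` can find. -/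
lemma yields_filter_ball (x : Win) (τ : ℕ) (live : List Win) :
    Prog.Yields (X.Ok δ) (fun C => X.Valid δ D live x τ C)
      (Prog.filterList (fun y => do
        let v ← Prog.ask ⟨x, y, D⟩
        Prog.spend 1
        pure (decide (v ≤ D * expansion X.L X.imax ^ τ))) live) := by
  refine (Prog.Yields.filterList (A := fun y => δ x y ≤ D * expansion X.L X.imax ^ τ)
    (B := fun y => alpha (X.L - 1) X.imax * (δ x y + D) ≤ D * expansion X.L X.imax ^ τ)
    live fun y _ => ?_).mono fun C hC => ⟨hC.1, hC.2.1, hC.2.2⟩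
  intro v hv
  change (_ → _) ∧ (_ → _)
  rw [decide_eq_true_eq]
  exact ⟨fun h => hv.1.trans h, fun h => hv.2.trans h⟩

/-- The center and the threshold of a sampled clique are uniformly distributed. -/
lemma worst_sampleClique_le (hT : 0 < tauMax X.L X.imax) (hne : live ≠ []) (hlive : live.Nodup)
    (φ : List Win → ℝ≥0∞) (Ψ : Win × ℕ → ℝ≥0∞)
    (h : ∀ x ∈ live, ∀ τ C, X.Valid δ D live x (τ + 1) C → φ C ≤ Ψ (x, τ)) :
    Prog.worst (X.Ok δ) φ (X.sampleClique live D) ≤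
      (∑ p ∈ live.toFinset ×ˢ Finset.range (tauMax X.L X.imax), Ψ p) /
        ((live.length * tauMax X.L X.imax : ℕ) : ℝ≥0∞) := by
  obtain ⟨w, ws, rfl⟩ := List.exists_cons_of_ne_nil hne
  rw [sampleClique]
  simp only [Prog.bind_eq]
  have h1 : ∀ (j : Fin (ws.length + 1)) (τ : Fin (tauMax X.L X.imax - 1 + 1)),
      Prog.worst (X.Ok δ) φ ((Prog.spend (τ + 1)).bind fun _ => Prog.filterList (fun y =>
        (Prog.ask ⟨(w :: ws).get j, y, D⟩).bind fun v => (Prog.spend 1).bind fun _ =>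
          pure (decide (v ≤ D * expansion X.L X.imax ^ ((τ : ℕ) + 1)))) (w :: ws)) ≤
        Ψ ((w :: ws).get j, τ) := by
    intro j τ
    rw [Prog.worst_bind, Prog.worst_spend]
    exact Prog.worst_le_of_yields (fun C hC => h _ (List.get_mem _ _) τ C hC)
      (yields_filter_ball _ _ _)
  have hT' : ((tauMax X.L X.imax - 1 : ℕ) : ℝ≥0∞) + 1 = tauMax X.L X.imax := by
    norm_cast; omega
  have h2 : ∑ p ∈ (w :: ws).toFinset ×ˢ Finset.range (tauMax X.L X.imax), Ψ p =
      ∑ j : Fin (ws.length + 1), ∑ τ : Fin (tauMax X.L X.imax - 1 + 1),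
        Ψ ((w :: ws).get j, τ) := by
    rw [Finset.sum_product]
    have h3 : ∀ g : Win → ℝ≥0∞, ∑ x ∈ (w :: ws).toFinset, g x =
        ∑ j : Fin (ws.length + 1), g ((w :: ws).get j) := by
      intro g
      rw [List.sum_toFinset g hlive]
      exact (Fin.sum_univ_fun_getElem (w :: ws) g).symm
    rw [h3]
    refine Finset.sum_congr rfl fun j _ => ?_
    rw [Fin.sum_univ_eq_sum_range (fun τ => Ψ ((w :: ws).get j, τ)),
      show tauMax X.L X.imax - 1 + 1 = tauMax X.L X.imax by omega]
  rw [h2]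
  calc _ ≤ (∑ j : Fin (ws.length + 1), (∑ τ : Fin (tauMax X.L X.imax - 1 + 1),
        Ψ ((w :: ws).get j, τ)) / (tauMax X.L X.imax : ℝ≥0∞)) / ((ws.length : ℝ≥0∞) + 1) := by
        refine ENNReal.div_le_div_right (Finset.sum_le_sum fun j _ => ?_) _
        rw [← hT']
        exact ENNReal.div_le_div_right (Finset.sum_le_sum fun τ _ => h1 j τ) _
    _ = _ := by
        simp only [div_eq_mul_inv]
        rw [← Finset.sum_mul, mul_assoc, List.length_cons]
        push_cast
        rw [ENNReal.mul_inv (by simp) (by simp), mul_comm ((tauMax X.L X.imax : ℝ≥0∞)⁻¹)]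

variable (X D) in
/-- One round of `Query`, at a depth with `r` further depths below. -/
noncomputable def queryRound (r : ℕ) (live : List Win) (E : List (Win × Win)) :
    Prog (List (Win × Win)) := do
  let C ← X.sampleClique live D
  let next ← X.denseInterval X.intervals C live
  match next with
  | none => do
    Prog.spend (C.length * C.length + 1)
    pure (C.product C ++ E)
  | some live' => do
    let E' ← X.query X.intervals D r live'
    Prog.spend (E'.length + 1)
    pure (E' ++ E)

lemma query_succ (r : ℕ) (live : List Win) : X.query X.intervals D (r + 1) live =
    (List.range ⌈(X.t : ℝ) ^ epsLevel X.L X.imax (X.imax - r) * X.rho⌉₊).foldlM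
      (fun E _ => X.queryRound D r live E) [] := rfl

/-- Edges that have been found stay. -/
lemma yields_queryRound_subset {ok : Query → ℕ → Prop} (r : ℕ) (live : List Win)
    (E : List (Win × Win)) :
    Prog.Yields ok (fun E' => E ⊆ E') (X.queryRound D r live E) := by
  unfold queryRound
  simp only [Prog.bind_eq]
  refine (Prog.yields_true _).bind fun C _ => (Prog.yields_true _).bind fun next _ => ?_
  cases next with
  | none => exact List.subset_append_right _ _
  | some live' =>
    exact (Prog.yields_true _).bind fun E' _ => List.subset_append_right _ _

open scoped Classical in
lemma worst_denseInterval_le {ok : Query → ℕ → Prop} (φ : Option (List Win) → ℝ≥0∞)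
    (C live : List Win) (hC : C.length ≤ live.length) :
    Prog.worst ok φ (X.denseInterval X.intervals C live) ≤
      φ (if X.Big C live then none else some (X.nextLive C live)) :=
  Prog.worst_le_of_yields (fun o ho => by rw [ho])
    ((runs_denseInterval (P := fun _ => True) X C live hC).yields)

open scoped Classical in
/-- One round: the elements hit by the sample are found, up to what the next depth misses. -/
lemma worst_queryRound_le (hT : 0 < tauMax X.L X.imax) (hne : live ≠ []) (hlive : live.Nodup)
    (r : ℕ) (G : Finset ℕ) (hG : G ⊆ S₀) (q lam : ℝ≥0∞)
    (hq : ∀ k ∈ G, (((live.toFinset ×ˢ Finset.range (tauMax X.L X.imax)).filter fun p =>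
      ¬ X.Hit δ D m live k p.1 (p.2 + 1)).card : ℝ≥0∞) ≤
        q * ((live.length * tauMax X.L X.imax : ℕ) : ℝ≥0∞))
    (hlam : ∀ C, C.Sublist live → Prog.worst (X.Ok δ)
      (fun E => (missed m (surv S₀ m (X.nextLive C live)) E : ℝ≥0∞))
      (X.query X.intervals D r (X.nextLive C live)) ≤ lam) (E : List (Win × Win)) :
    Prog.worst (X.Ok δ) (fun E => (missed m G E : ℝ≥0∞)) (X.queryRound D r live E) ≤
      q * missed m G E + lam := by
  set M := G.filter fun k => (Sum.inl k, Sum.inr (m k)) ∉ E with hM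
  set φ : List Win → ℝ≥0∞ := fun C => Prog.worst (X.Ok δ) (fun E => (missed m G E : ℝ≥0∞)) (do
    let next ← X.denseInterval X.intervals C live
    match next with
    | none => do
      Prog.spend (C.length * C.length + 1)
      pure (C.product C ++ E)
    | some live' => do
      let E' ← X.query X.intervals D r live'
      Prog.spend (E'.length + 1)
      pure (E' ++ E)) with hφ
  -- what a sample misses: the elements it does not hit, and those lost at the next depth
  set Ψ : Win × ℕ → ℝ≥0∞ := fun p =>
    ((M.filter fun k => ¬ X.Hit δ D m live k p.1 (p.2 + 1)).card : ℝ≥0∞) + lam with hΨ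
  have h1 : ∀ x ∈ live, ∀ τ C, X.Valid δ D live x (τ + 1) C → φ C ≤ Ψ (x, τ) := by
    intro x hx τ C hC
    simp only [hφ, Prog.bind_eq]
    rw [Prog.worst_bind]
    refine (X.worst_denseInterval_le _ C live hC.sublist.length_le).trans ?_
    by_cases hbig : X.Big C live
    · rw [if_pos hbig]
      refine le_trans ?_ le_self_add
      change ((missed m G (C.product C ++ E) : ℕ) : ℝ≥0∞) ≤ _
      norm_cast
      refine Finset.card_le_card fun k hk => ?_
      obtain ⟨h2, h3⟩ := Finset.mem_filter.1 hk
      refine Finset.mem_filter.2 ⟨Finset.mem_filter.2 ⟨h2, fun h => h3 (by simp [h])⟩,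
        fun hhit => h3 ?_⟩
      have h4 := (hhit C hC).1 hbig
      exact List.mem_append_left _ (List.mem_product.2 h4)
    · rw [if_neg hbig]
      dsimp only
      rw [Prog.worst_bind]
      calc _ ≤ Prog.worst (X.Ok δ) (fun E' =>
            ((M.filter fun k => ¬ X.Hit δ D m live k x (τ + 1)).card : ℝ≥0∞) +
              (missed m (surv S₀ m (X.nextLive C live)) E' : ℝ≥0∞))
            (X.query X.intervals D r (X.nextLive C live)) := by
            refine Prog.worst_mono (fun E' => ?_) _
            change ((missed m G (E' ++ E) : ℕ) : ℝ≥0∞) ≤ _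
            norm_cast
            refine (Finset.card_le_card (t := (M.filter fun k =>
              ¬ X.Hit δ D m live k x (τ + 1)) ∪
              (surv S₀ m (X.nextLive C live)).filter fun k =>
                (Sum.inl k, Sum.inr (m k)) ∉ E') fun k hk => ?_).trans
                (Finset.card_union_le _ _)
            obtain ⟨h2, h3⟩ := Finset.mem_filter.1 hk
            rw [List.mem_append, not_or] at h3
            by_cases hhit : X.Hit δ D m live k x (τ + 1)
            · refine Finset.mem_union_right _ (Finset.mem_filter.2 ⟨?_, h3.1⟩)
              have h4 := (hhit C hC).2 hbig
              exact mem_surv.2 ⟨hG h2, h4⟩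
            · exact Finset.mem_union_left _ (Finset.mem_filter.2
                ⟨Finset.mem_filter.2 ⟨h2, h3.2⟩, hhit⟩)
        _ ≤ _ := (Prog.worst_add_le _ _ _).trans
            (add_le_add (Prog.worst_const_le _ _) (hlam C hC.sublist))
  unfold queryRound
  rw [Prog.bind_eq, Prog.worst_bind]
  refine (worst_sampleClique_le hT hne hlive φ Ψ h1).trans ?_
  have hpos : ((live.length * tauMax X.L X.imax : ℕ) : ℝ≥0∞) ≠ 0 := by
    have := List.length_pos_iff.2 hne
    exact_mod_cast (Nat.mul_pos this hT).ne'
  rw [ENNReal.div_le_iff hpos (ENNReal.natCast_ne_top _)]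
  have h2 : ∑ p ∈ live.toFinset ×ˢ Finset.range (tauMax X.L X.imax),
      ((M.filter fun k => ¬ X.Hit δ D m live k p.1 (p.2 + 1)).card : ℝ≥0∞) ≤
      missed m G E * (q * ((live.length * tauMax X.L X.imax : ℕ) : ℝ≥0∞)) := by
    -- double counting of the pairs of a sample and an element not hit by it
    have h3 : ∑ p ∈ live.toFinset ×ˢ Finset.range (tauMax X.L X.imax),
        (M.filter fun k => ¬ X.Hit δ D m live k p.1 (p.2 + 1)).card =
        ∑ k ∈ M, ((live.toFinset ×ˢ Finset.range (tauMax X.L X.imax)).filter fun p =>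
          ¬ X.Hit δ D m live k p.1 (p.2 + 1)).card := by
      simp_rw [Finset.card_filter]
      exact Finset.sum_comm
    have h4 : missed m G E = M.card := rfl
    rw [h4]
    calc _ = ∑ k ∈ M, (((live.toFinset ×ˢ Finset.range (tauMax X.L X.imax)).filter fun p =>
          ¬ X.Hit δ D m live k p.1 (p.2 + 1)).card : ℝ≥0∞) := by exact_mod_cast h3
      _ ≤ _ := by
        rw [← nsmul_eq_mul]
        exact Finset.sum_le_card_nsmul _ _ _ fun k hk => hq k (Finset.mem_filter.1 hk).1
  simp only [hΨ]
  rw [Finset.sum_add_distrib, Finset.sum_const, Finset.card_product, Finset.card_range,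
    List.toFinset_card_of_nodup hlive, nsmul_eq_mul, add_mul]
  refine add_le_add (h2.trans (le_of_eq ?_)) (le_of_eq ?_) <;> ring

open scoped Classical in
/-- At the last depth nothing is missed. -/
lemma worst_query_zero (hM : CloseMatching X δ D m S₀) :
    Prog.worst (X.Ok δ) (fun E => (missed m (surv S₀ m live) E : ℝ≥0∞))
      (X.query X.intervals D 0 live) = 0 := by
  have key : ∀ (l : List (Win × Win)) (E₀ : List (Win × Win)),
      Prog.Yields (X.Ok δ) (fun E => E₀ ⊆ E ∧ ∀ p ∈ l, δ p.1 p.2 ≤ D → p ∈ E)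
        (l.foldlM (fun E p => do
          let v ← Prog.ask ⟨p.1, p.2, D⟩
          Prog.spend 1
          pure (if v ≤ D * expansion X.L X.imax then p :: E else E)) E₀) := by
    intro l
    induction l with
    | nil => exact fun E₀ => ⟨List.Subset.refl _, by simp⟩
    | cons p l ih =>
      intro E₀
      rw [List.foldlM_cons]
      refine Prog.Yields.bind (Q := fun E => E₀ ⊆ E ∧ (δ p.1 p.2 ≤ D → p ∈ E)) ?_ fun E hE => ?_
      · intro v hv
        change E₀ ⊆ (if v ≤ D * expansion X.L X.imax then p :: E₀ else E₀) ∧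
          (_ → p ∈ (if v ≤ D * expansion X.L X.imax then p :: E₀ else E₀))
        refine ⟨?_, fun hp => ?_⟩
        · split_ifs
          · exact List.subset_cons_self _ _
          · exact List.Subset.refl _
        · rw [if_pos]
          · simp
          · have h1 : v ≤ alpha (X.L - 1) X.imax * (δ p.1 p.2 + D) := hv.2
            calc v ≤ _ := h1
              _ ≤ alpha (X.L - 1) X.imax * (100 * D) := Nat.mul_le_mul_left _ (by omega)
              _ = _ := by rw [expansion_eq]; ring
      · refine (ih E).mono fun E' hE' => ⟨List.Subset.trans hE.1 hE'.1, ?_⟩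
        intro p' hp'
        rcases List.mem_cons.1 hp' with rfl | hp'
        · exact fun h => hE'.1 (hE.2 h)
        · exact hE'.2 p' hp'
  refine le_antisymm (Prog.worst_le_of_yields (fun E hE => ?_) (key _ [])) bot_le
  norm_cast
  refine Nat.le_zero.2 (Finset.card_eq_zero.2 (Finset.filter_eq_empty_iff.2 fun k hk => ?_))
  obtain ⟨h1, h2, h3⟩ := mem_surv.1 hk
  rw [not_not]
  exact hE.2 _ (List.mem_product.2 ⟨h2, h3⟩) (hM.close k h1)

end Inst

namespace Inst

variable (X : Inst)

/-- `t ^ ε`, not rounded. -/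
noncomputable def growth : ℝ := (X.t : ℝ) ^ eps X.L X.imax

/-- The instance is large enough for the constants to be smaller than `t ^ ε`. -/
structure Large : Prop extends X.Regular where
  base_le : (X.base : ℝ) ≤ 2 * X.growth
  const_le : 200000 * (tauMax X.L X.imax : ℝ) ^ 2 * (invEps X.L X.imax + 1) ^ 4 ≤ X.growth

variable {X} {δ : Win → Win → ℕ} {D : ℕ} {m : ℕ → ℕ} {S₀ : Finset ℕ} {live : List Win}

lemma invEps_pos (L imax : ℕ) : 1 ≤ invEps L imax := Nat.one_le_pow _ _ (by norm_num)

lemma tauMax_pos (L imax : ℕ) : 1 ≤ tauMax L imax := by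
  have := Nat.one_le_pow 2 _ (invEps_pos L imax)
  unfold tauMax
  omega

lemma epsLevel_eq (L imax i : ℕ) : epsLevel L imax i = eps L imax * ((100 ^ (i + 1) : ℕ) : ℝ) := by
  unfold epsLevel
  push_cast
  ring

lemma rpow_epsLevel (i : ℕ) : (X.t : ℝ) ^ epsLevel X.L X.imax i = X.growth ^ 100 ^ (i + 1) := by
  rw [epsLevel_eq, Real.rpow_mul (Nat.cast_nonneg _), Real.rpow_natCast, growth]

lemma Large.growth_ge (hX : X.Large) : 200000 ≤ X.growth := by
  refine le_trans ?_ hX.const_le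
  have h1 : (1 : ℝ) ≤ (tauMax X.L X.imax : ℝ) ^ 2 :=
    one_le_pow₀ (by exact_mod_cast tauMax_pos _ _)
  have h2 : (1 : ℝ) ≤ ((invEps X.L X.imax : ℝ) + 1) ^ 4 := one_le_pow₀ (by simp)
  nlinarith

lemma Large.arith (hX : X.Large) (a : ℕ) :
    504 * (tauMax X.L X.imax : ℝ) ^ 2 * (invEps X.L X.imax + 1) ^ 3 * X.base ^ 3 *
      X.growth ^ (2 * a) ≤ X.growth ^ (2 * a + 4) ∧
    (1 ≤ a → 3528 * (tauMax X.L X.imax : ℝ) ^ 2 * (invEps X.L X.imax + 1) ^ 4 * X.base ^ 5 *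
      X.growth ^ (2 * a) ≤ X.growth ^ (20 * a)) := by
  have hz := hX.growth_ge
  have hb := hX.base_le
  have hK := hX.const_le
  set z := X.growth
  set T : ℝ := (tauMax X.L X.imax : ℝ)
  set E : ℝ := (invEps X.L X.imax : ℝ) + 1 with hE
  set b : ℝ := (X.base : ℝ)
  have hb0 : 0 ≤ b := Nat.cast_nonneg _
  have hE1 : 1 ≤ E := by simp [hE]
  have hE0 : 0 ≤ E := by linarith
  have hE34 : E ^ 3 ≤ E ^ 4 := pow_le_pow_right₀ hE1 (by norm_num)
  have h3 : b ^ 3 ≤ 8 * z ^ 3 := by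
    calc b ^ 3 ≤ (2 * z) ^ 3 := pow_le_pow_left₀ hb0 hb 3
      _ = _ := by ring
  have h5 : b ^ 5 ≤ 32 * z ^ 5 := by
    calc b ^ 5 ≤ (2 * z) ^ 5 := pow_le_pow_left₀ hb0 hb 5
      _ = _ := by ring
  have hTE : 0 ≤ T ^ 2 * E ^ 4 := by positivity
  constructor
  · calc 504 * T ^ 2 * E ^ 3 * b ^ 3 * z ^ (2 * a)
        ≤ 504 * T ^ 2 * E ^ 4 * (8 * z ^ 3) * z ^ (2 * a) := by gcongr
      _ = (4032 * (T ^ 2 * E ^ 4)) * (z ^ (2 * a) * z ^ 3) := by ring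
      _ ≤ z * (z ^ (2 * a) * z ^ 3) := by gcongr; linarith
      _ = _ := by ring
  · intro ha
    calc 3528 * T ^ 2 * E ^ 4 * b ^ 5 * z ^ (2 * a)
        ≤ 3528 * T ^ 2 * E ^ 4 * (32 * z ^ 5) * z ^ (2 * a) := by gcongr
      _ = (112896 * (T ^ 2 * E ^ 4)) * (z ^ (2 * a) * z ^ 5) := by ring
      _ ≤ z * (z ^ (2 * a) * z ^ 5) := by gcongr; linarith
      _ = z ^ (2 * a + 6) := by ring
      _ ≤ _ := pow_le_pow_right₀ (by linarith) (by omega)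

lemma surv_card_le (S₀ : Finset ℕ) (m : ℕ → ℕ) (live : List Win) :
    (surv S₀ m live).card ≤ live.length := by
  refine le_trans ?_ (List.toFinset_card_le live)
  rw [← Finset.card_image_of_injective _ (Sum.inl_injective (β := ℕ))]
  refine Finset.card_le_card fun w hw => ?_
  obtain ⟨k, hk, rfl⟩ := Finset.mem_image.1 hw
  exact List.mem_toFinset.2 (mem_surv.1 hk).2.1

/-- A block of rounds finds most of the edges: the samples hit all elements but few exceptions,
and the next depth misses only few. -/
lemma exists_block (hM : CloseMatching X δ D m S₀) (hX : X.Large) (hlive : live.Nodup)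
    (hsub : live ⊆ X.windows) {a : ℕ} (ha : 1 ≤ a) (r : ℕ)
    (hchild : ∀ C : List Win, Prog.worst (X.Ok δ)
      (fun E => (missed m (surv S₀ m (X.nextLive C live)) E : ℝ≥0∞))
      (X.query X.intervals D r (X.nextLive C live)) ≤
        ENNReal.ofReal ((X.nextLive C live).length / X.growth ^ (20 * a))) :
    ∃ G ⊆ surv S₀ m live,
      (((surv S₀ m live) \ G).card : ℝ) ≤ live.length / (6 * X.growth ^ a) ∧
      ∀ l : List ℕ, X.growth ^ (2 * a + 4) * X.rho ≤ l.length → ∀ E,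
        Prog.worst (X.Ok δ) (fun E => (missed m G E : ℝ≥0∞))
          (l.foldlM (fun E _ => X.queryRound D r live E) E) ≤
            ENNReal.ofReal (live.length / (3 * X.growth ^ a)) := by
  classical
  have hz := hX.growth_ge
  obtain ⟨har1, har2⟩ := hX.arith a
  have har2 := har2 ha
  have hρ := hX.rho_ge
  have hbN := hX.base_ge
  have hb : (8 : ℝ) ≤ X.base := by exact_mod_cast hbN
  rcases eq_or_ne live [] with rfl | hne
  · refine ⟨∅, Finset.empty_subset _, ?_, fun l _ E => ?_⟩
    · have : surv S₀ m [] = ∅ := by simp [surv]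
      simp [this]
    · refine (Prog.worst_mono (ψ := fun _ => 0) (fun E => ?_) _).trans
        ((Prog.worst_const_le _ _).trans bot_le)
      simp [missed]
  have hT1 : (1 : ℝ) ≤ tauMax X.L X.imax := by exact_mod_cast tauMax_pos _ _
  have hE0 : (1 : ℝ) ≤ (invEps X.L X.imax : ℝ) + 1 := by simp
  have hsh : X.shrink = 7 * (invEps X.L X.imax + 1) * (X.base : ℝ) ^ 2 := rfl
  have hbad := fun η => exists_few_exceptions hM hX.toRegular hlive hsub (invEps_pos _ _) (η := η)
  have hnext := X.nextLive_length_le (live := live) (by omega : 1 < X.base) (by linarith)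
  have hTN := tauMax_pos X.L X.imax
  set z := X.growth with hzdef
  set T : ℝ := (tauMax X.L X.imax : ℝ) with hT
  set E' : ℝ := (invEps X.L X.imax : ℝ) + 1 with hE'
  set b : ℝ := (X.base : ℝ) with hbdef
  set ρ := X.rho with hρdef
  set N : ℝ := (live.length : ℝ) with hN
  have hN0 : 0 ≤ N := Nat.cast_nonneg _
  have hza : 0 < z ^ a := by positivity
  have hza1 : 1 ≤ z ^ a := one_le_pow₀ (by linarith)
  -- chosen such that the exceptions make up at most `N / (6 z ^ a)`
  set η : ℝ := 1 / (84 * T * E' ^ 3 * b * z ^ a) with hη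
  have hη0 : 0 < η := by positivity
  have hT3 : 1 ≤ T * E' ^ 3 * b * z ^ a := by
    have h1 : 1 ≤ E' ^ 3 := one_le_pow₀ hE0
    have h2 : 1 ≤ T * E' ^ 3 := one_le_mul_of_one_le_of_one_le hT1 h1
    have h3 : 1 ≤ T * E' ^ 3 * b := one_le_mul_of_one_le_of_one_le h2 (by linarith)
    exact one_le_mul_of_one_le_of_one_le h3 hza1
  have hη1 : η ≤ 1 := by
    rw [hη, div_le_one (by positivity)]
    nlinarith
  obtain ⟨Bad, hBS, hBc, hGood⟩ := hbad η hη0 hη1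
  -- a lower bound for the probability that a sample hits a given element which is no exception
  set p : ℝ := η / (T * ρ * b ^ 2) with hp
  have hp0 : 0 < p := by positivity
  have hp1 : p ≤ 1 := by
    rw [hp, div_le_one (by positivity)]
    refine hη1.trans ?_
    exact one_le_mul_of_one_le_of_one_le (one_le_mul_of_one_le_of_one_le hT1 hρ)
      (one_le_pow₀ (by linarith))
  set q : ℝ≥0∞ := ENNReal.ofReal (1 - p) with hq
  set G := surv S₀ m live \ Bad with hG
  have hGS : G ⊆ surv S₀ m live := Finset.sdiff_subset
  have hnonhit : ∀ k ∈ G, (((live.toFinset ×ˢ Finset.range (tauMax X.L X.imax)).filter fun p =>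
      ¬ X.Hit δ D m live k p.1 (p.2 + 1)).card : ℝ≥0∞) ≤
        q * ((live.length * tauMax X.L X.imax : ℕ) : ℝ≥0∞) := by
    intro k hk
    obtain ⟨hk1, hk2⟩ := Finset.mem_sdiff.1 hk
    have h1 := hGood k hk1 hk2
    have h2 := Finset.card_filter_add_card_filter_not
      (s := live.toFinset ×ˢ Finset.range (tauMax X.L X.imax))
      (fun p => X.Hit δ D m live k p.1 (p.2 + 1))
    rw [Finset.card_product, Finset.card_range, List.toFinset_card_of_nodup hlive] at h2
    set c1 := ((live.toFinset ×ˢ Finset.range (tauMax X.L X.imax)).filter fun p =>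
      X.Hit δ D m live k p.1 (p.2 + 1)).card
    set c2 := ((live.toFinset ×ˢ Finset.range (tauMax X.L X.imax)).filter fun p =>
      ¬ X.Hit δ D m live k p.1 (p.2 + 1)).card
    have h3 : (c1 : ℝ) + c2 = N * T := by rw [hN, hT]; exact_mod_cast h2
    have h4 : p * (N * T) ≤ c1 := by
      rw [hp, div_mul_eq_mul_div, div_le_iff₀ (by positivity)]
      calc η * (N * T) = (η * N) * T := by ring
        _ ≤ (ρ * b ^ 2 * c1) * T := by gcongr
        _ = _ := by ring
    rw [hq, ← ENNReal.ofReal_natCast, ← ENNReal.ofReal_natCast (_ * _),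
      ← ENNReal.ofReal_mul (by linarith)]
    refine ENNReal.ofReal_le_ofReal ?_
    push_cast
    change (c2 : ℝ) ≤ (1 - p) * (N * T)
    linarith
  -- what the next depth misses, given the number of its live windows
  set lam : ℝ≥0∞ := ENNReal.ofReal (X.shrink * N / ρ / z ^ (20 * a)) with hlam
  have hround := worst_queryRound_le (X := X) (δ := δ) (D := D) (m := m) hTN hne hlive r G
    (hGS.trans (Finset.filter_subset _ _)) q lam hnonhit fun C _ => by
      refine (hchild C).trans (ENNReal.ofReal_le_ofReal ?_)
      refine div_le_div_of_nonneg_right ?_ (by positivity)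
      rw [le_div_iff₀ (by linarith)]
      exact hnext C
  refine ⟨G, hGS, ?_, fun l hl E => ?_⟩
  · have h1 : surv S₀ m live \ G = Bad := by
      rw [hG, sdiff_sdiff_right_self]
      exact Finset.inter_eq_right.2 hBS
    rw [h1]
    refine hBc.trans (le_of_eq ?_)
    rw [hη]
    field_simp
    ring
  · have h1 := Prog.worst_foldlM_le (ok := X.Ok δ) (fun E => (missed m G E : ℝ≥0∞))
      (fun E _ => X.queryRound D r live E) q lam (fun E _ => hround E) l E
    refine h1.trans ?_
    -- each round hits with probability `p`, and there are at least `6 z ^ a / p` rounds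
    have h2 : q ^ l.length * (missed m G E : ℝ≥0∞) ≤ ENNReal.ofReal (N / (6 * z ^ a)) := by
      have h3 : (1 - p) ^ l.length ≤ 1 / (6 * z ^ a) := by
        have h4 : 6 * z ^ a ≤ p * l.length := by
          have h5 : 6 * z ^ a ≤ p * (z ^ (2 * a + 4) * ρ) := by
            rw [hp, hη]
            rw [div_div, div_mul_eq_mul_div, le_div_iff₀ (by positivity), one_mul]
            calc _ = (504 * T ^ 2 * E' ^ 3 * b ^ 3 * z ^ (2 * a)) * ρ := by ring
              _ ≤ _ := by gcongr
          exact h5.trans (mul_le_mul_of_nonneg_left hl hp0.le)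
        have h6 : (1 - p) ^ l.length ≤ Real.exp (-(p * l.length)) := by
          calc (1 - p) ^ l.length ≤ (Real.exp (-p)) ^ l.length := by
                refine pow_le_pow_left₀ (by linarith) ?_ _
                have := Real.add_one_le_exp (-p)
                linarith
            _ = _ := by rw [← Real.exp_nat_mul]; ring_nf
        refine h6.trans ?_
        rw [Real.exp_neg, ← one_div]
        refine one_div_le_one_div_of_le (by positivity) (h4.trans ?_)
        have := Real.add_one_le_exp (p * l.length)
        linarith
      have h7 : (missed m G E : ℝ) ≤ N := by
        rw [hN]
        exact_mod_cast (missed_le_card G E).trans ((Finset.card_le_card hGS).trans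
          (surv_card_le S₀ m live))
      rw [hq, ← ENNReal.ofReal_pow (by linarith), ← ENNReal.ofReal_natCast,
        ← ENNReal.ofReal_mul (by have : 0 ≤ 1 - p := by linarith
                                 positivity)]
      refine ENNReal.ofReal_le_ofReal ?_
      calc _ ≤ 1 / (6 * z ^ a) * N := by gcongr
        _ = _ := by ring
    -- the losses to the next depth sum up to `lam / p`; the factor `z ^ (20 a)` absorbs `1 / p`
    have h3 : lam * ∑ i ∈ Finset.range l.length, q ^ i ≤ ENNReal.ofReal (N / (6 * z ^ a)) := by
      have h4 : ∑ i ∈ Finset.range l.length, q ^ i ≤ ENNReal.ofReal (1 / p) := by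
        refine (ENNReal.sum_le_tsum _).trans ?_
        rw [ENNReal.tsum_geometric, hq, ← ENNReal.ofReal_one,
          ← ENNReal.ofReal_sub _ (by linarith), sub_sub_cancel, ENNReal.ofReal_div_of_pos hp0,
          ENNReal.ofReal_one, one_div]
      refine (mul_le_mul_right h4 lam).trans ?_
      have h0 : 0 ≤ X.shrink * N / ρ / z ^ (20 * a) := by rw [hsh]; positivity
      rw [hlam, ← ENNReal.ofReal_mul h0]
      refine ENNReal.ofReal_le_ofReal ?_
      rw [hp, hη, hsh, one_div_div, div_div, div_mul_div_comm, div_le_div_iff₀ (by positivity)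
        (by positivity)]
      have h5 : (ρ * z ^ (20 * a)) * (1 / (84 * T * E' ^ 3 * b * z ^ a)) =
        ρ * z ^ (20 * a) / (84 * T * E' ^ 3 * b * z ^ a) := by ring
      rw [h5, mul_div_assoc', le_div_iff₀ (by positivity)]
      calc _ = (3528 * T ^ 2 * E' ^ 4 * b ^ 5 * z ^ (2 * a)) * (N * ρ) := by ring
        _ ≤ z ^ (20 * a) * (N * ρ) := by gcongr
        _ = _ := by ring
    refine (add_le_add h2 h3).trans ?_
    rw [← ENNReal.ofReal_add (by positivity) (by positivity)]
    refine ENNReal.ofReal_le_ofReal (le_of_eq ?_)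
    field_simp
    ring

lemma rounds_ge (i : ℕ) : X.growth ^ 100 ^ (i + 1) * X.rho ≤
    ⌈(X.t : ℝ) ^ epsLevel X.L X.imax i * X.rho⌉₊ := by
  rw [rpow_epsLevel]
  exact Nat.le_ceil _

/-- The expected number of edges missed by a query; it decreases with the depth. -/
theorem worst_query_le (hM : CloseMatching X δ D m S₀) (hX : X.Large) (r : ℕ) (hr : r ≤ X.imax)
    (live : List Win) (hlive : live.Nodup) (hsub : live ⊆ X.windows) :
    Prog.worst (X.Ok δ) (fun E => (missed m (surv S₀ m live) E : ℝ≥0∞))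
      (X.query X.intervals D r live) ≤
        ENNReal.ofReal (live.length / X.growth ^ 20 ^ (X.imax - r)) := by
  induction r generalizing live with
  | zero => rw [worst_query_zero hM]; exact bot_le
  | succ r ih =>
    have hz := hX.growth_ge
    have hρ := hX.rho_ge
    set j := X.imax - (r + 1) with hj
    have hj1 : X.imax - r = j + 1 := by omega
    obtain ⟨G, hGS, hG1, hG2⟩ := exists_block hM hX hlive hsub (a := 20 ^ j)
      (Nat.one_le_pow _ _ (by norm_num)) r fun C => by
        rw [mul_comm 20, ← pow_succ, ← hj1]
        have h1 := X.nextLive_sublist C live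
        exact ih (by omega) _ (h1.nodup hlive) (List.Subset.trans h1.subset hsub)
    have hza : 0 < X.growth ^ 20 ^ j := by positivity
    rw [query_succ, hj1]
    have hexp : 2 * 20 ^ j + 4 ≤ 100 ^ (j + 1 + 1) := by
      have h1 : 20 ^ j ≤ 100 ^ j := Nat.pow_le_pow_left (by norm_num) j
      have h2 : 1 ≤ 100 ^ j := Nat.one_le_pow _ _ (by norm_num)
      rw [pow_succ, pow_succ]
      omega
    have h1 := hG2 (List.range ⌈(X.t : ℝ) ^ epsLevel X.L X.imax (j + 1) * X.rho⌉₊) (by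
      rw [List.length_range]
      refine le_trans ?_ (X.rounds_ge (j + 1))
      exact mul_le_mul_of_nonneg_right (pow_le_pow_right₀ (by linarith) hexp) (by linarith)) []
    calc _ ≤ Prog.worst (X.Ok δ) (fun E => (((surv S₀ m live) \ G).card : ℝ≥0∞) +
            (missed m G E : ℝ≥0∞)) _ := Prog.worst_mono (fun E => by
              exact_mod_cast missed_le_add G _ E) _
      _ ≤ _ := (Prog.worst_add_le _ _ _).trans (add_le_add (Prog.worst_const_le _ _) h1)
      _ ≤ ENNReal.ofReal (live.length / (6 * X.growth ^ 20 ^ j)) +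
          ENNReal.ofReal (live.length / (3 * X.growth ^ 20 ^ j)) := by
            gcongr
            rw [← ENNReal.ofReal_natCast]
            exact ENNReal.ofReal_le_ofReal hG1
      _ ≤ _ := by
            rw [← ENNReal.ofReal_add (by positivity) (by positivity)]
            refine ENNReal.ofReal_le_ofReal ?_
            rw [div_add_div _ _ (by positivity) (by positivity), div_le_div_iff₀ (by positivity)
              (by positivity)]
            have : (0 : ℝ) ≤ (live.length : ℝ) * (X.growth ^ 20 ^ j) ^ 2 := by positivity
            nlinarith

lemma windows_eq_surv (hM : CloseMatching X δ D m S₀) : surv S₀ m X.windows = S₀ := by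
  ext k
  rw [mem_surv, mem_windows, mem_windows]
  exact ⟨fun h => h.1, fun h => ⟨h, Or.inl ⟨k, hM.lt_numA k h, rfl⟩,
    Or.inr ⟨m k, hM.lt_numB k h, rfl⟩⟩⟩

open scoped Classical in
/-- With high probability a query misses only few edges. -/
theorem worst_query_windows_le (hM : CloseMatching X δ D m S₀) (hX : X.Large)
    (himax : 1 ≤ X.imax) :
    Prog.worst (X.Ok δ)
      (fun E => if (X.t : ℝ) / X.growth < missed m S₀ E then 1 else 0)
      (X.query X.intervals D X.imax X.windows) ≤ 2⁻¹ ^ ⌈X.growth ^ 2⌉₊ := by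
  have hz := hX.growth_ge
  have hρ := hX.rho_ge
  have hlen := X.windows_length
  have hS := windows_eq_surv hM
  obtain ⟨r, hr⟩ : ∃ r, X.imax = r + 1 := ⟨X.imax - 1, by omega⟩
  obtain ⟨G, hGS, hG1, hG2⟩ := exists_block hM hX X.windows_nodup (List.Subset.refl _) (a := 1)
    le_rfl r fun C => by
      have h1 := X.nextLive_sublist C X.windows
      have h2 := worst_query_le hM hX r (by omega) _ (h1.nodup X.windows_nodup) h1.subset
      rwa [show X.imax - r = 1 by omega, pow_one, show (20 : ℕ) = 20 * 1 by norm_num] at h2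
  rw [hS] at hGS hG1
  rw [hlen, pow_one] at hG1
  simp only [hlen, pow_one] at hG2
  set z := X.growth with hzdef
  set t : ℝ := (X.t : ℝ) with ht
  set ρ := X.rho with hρdef
  -- twice the bound on the expected number of missed elements of `G`
  set θ : ℝ := 2 * t / (3 * z) with hθ
  have ht0 : 0 < t := by
    have := X.numB_pos
    have : 0 < X.t := by unfold Inst.t; omega
    rw [ht]; exact_mod_cast this
  have hθ0 : 0 < θ := by positivity
  set ℓ := ⌈z ^ (2 * 1 + 4) * ρ⌉₊ with hℓ
  -- the rounds at depth `0` suffice for `z ^ 2` blocks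
  have hN : ⌈z ^ 2⌉₊ * ℓ ≤
      ⌈(X.t : ℝ) ^ epsLevel X.L X.imax (X.imax - r) * ρ⌉₊ := by
    have h1 : (⌈z ^ 2⌉₊ : ℝ) ≤ 2 * z ^ 2 := by
      have := (Nat.ceil_lt_add_one (by positivity : 0 ≤ z ^ 2)).le
      nlinarith
    have h2 : (ℓ : ℝ) ≤ 2 * (z ^ 6 * ρ) := by
      have h3 := (Nat.ceil_lt_add_one (by positivity : 0 ≤ z ^ (2 * 1 + 4) * ρ)).le
      have h4 : 1 ≤ z ^ 6 * ρ :=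
        one_le_mul_of_one_le_of_one_le (one_le_pow₀ (by linarith)) hρ
      norm_num at h3
      have h5 : (ℓ : ℝ) ≤ z ^ 6 * ρ + 1 := by rw [hℓ]; norm_num; exact h3
      linarith
    have h3 := X.rounds_ge (X.imax - r)
    rw [show X.imax - r = 1 by omega] at h3 ⊢
    have h4 : (⌈z ^ 2⌉₊ : ℝ) * ℓ ≤ z ^ 100 ^ (1 + 1) * ρ := by
      calc (⌈z ^ 2⌉₊ : ℝ) * ℓ ≤ (2 * z ^ 2) * (2 * (z ^ 6 * ρ)) := by gcongr
        _ = 4 * (z ^ 8 * ρ) := by ring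
        _ ≤ z * (z ^ 8 * ρ) := by gcongr; linarith
        _ = z ^ 9 * ρ := by ring
        _ ≤ _ := mul_le_mul_of_nonneg_right (pow_le_pow_right₀ (by linarith) (by norm_num))
            (by linarith)
    exact_mod_cast h4.trans h3
  have hkey := Prog.worst_blocks_le (ok := X.Ok δ)
    (fun E : List (Win × Win) => θ < (missed m G E : ℝ))
    (fun E (_ : ℕ) => X.queryRound D r X.windows E) ℓ (fun E _ hE => by
      refine (yields_queryRound_subset r _ E).mono fun E' hE' => ?_
      rw [not_lt] at hE ⊢
      refine le_trans ?_ hE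
      exact_mod_cast missed_anti hE') (fun l E hl => by
      have h1 := hG2 l (by rw [hl]; exact Nat.le_ceil _) E
      -- Markov's inequality
      calc _ ≤ Prog.worst (X.Ok δ) (fun E => ENNReal.ofReal (1 / θ) * (missed m G E : ℝ≥0∞))
            (l.foldlM (fun E _ => X.queryRound D r X.windows E) E) := by
            refine Prog.worst_mono (fun E => ?_) _
            split_ifs with h
            · rw [← ENNReal.ofReal_natCast, ← ENNReal.ofReal_mul (by positivity),
                ← ENNReal.ofReal_one]
              refine ENNReal.ofReal_le_ofReal ?_
              rw [one_div, le_inv_mul_iff₀ hθ0, mul_one]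
              exact h.le
            · exact bot_le
        _ ≤ ENNReal.ofReal (1 / θ) * ENNReal.ofReal (t / (3 * z)) :=
            (Prog.worst_const_mul_le _ _ _).trans (by gcongr)
        _ = 2⁻¹ := by
            rw [← ENNReal.ofReal_mul (by positivity), hθ,
              show 1 / (2 * t / (3 * z)) * (t / (3 * z)) = (2 : ℝ)⁻¹ by field_simp,
              ENNReal.ofReal_inv_of_pos (by norm_num)]
            norm_num) ⌈z ^ 2⌉₊ (List.range
              ⌈(X.t : ℝ) ^ epsLevel X.L X.imax (X.imax - r) * ρ⌉₊) (by rwa [List.length_range]) []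
  rw [← query_succ, ← hr] at hkey
  refine le_trans (Prog.worst_mono (fun E => ?_) _) hkey
  by_cases h : θ < (missed m G E : ℝ)
  · rw [if_pos h]; split_ifs <;> simp
  · rw [if_neg h, if_neg]
    rw [not_lt] at h ⊢
    have h1 : (missed m S₀ E : ℝ) ≤ (S₀ \ G).card + missed m G E := by
      exact_mod_cast missed_le_add G S₀ E
    have h2 : t / (6 * z) + θ ≤ t / z := by
      rw [hθ, div_add_div _ _ (by positivity) (by positivity), div_le_div_iff₀ (by positivity)
        (by positivity)]
      have : 0 < t * z ^ 2 := by positivity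
      nlinarith
    linarith

end Inst

/-! ### The estimates that are aggregated -/

lemma editDist_le_length {α : Type*} (A B : List α) (h : A.length = B.length) :
    editDist A B ≤ A.length := by
  induction A generalizing B with
  | nil => rw [List.eq_nil_of_length_eq_zero h.symm]; simp
  | cons a A ih =>
    obtain _ | ⟨b, B⟩ := B
    · simp at h
    · have h1 := ih B (by simpa using h)
      have h2 : editDist [a] [b] ≤ 1 :=
        Nat.sInf_le (EditPath.step (Edit.substitution [] [] a b) (EditPath.refl _))
      have h3 := editDist_append_le [a] [b] A B
      simp only [List.singleton_append, List.length_cons] at h3 ⊢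
      omega

namespace Prog

variable {ok : Query → ℕ → Prop} {σ ι : Type}

open scoped Classical in
/-- A bad state is unlikely at the end, if one of the rounds removes it with high probability, and
no other round brings it back. -/
lemma worst_foldlM_bad_le (bad : σ → Prop) (f : σ → ι → Prog σ) (x : ι) (c : ℝ≥0∞)
    (hstay : ∀ s y, ¬ bad s → Yields ok (fun s' => ¬ bad s') (f s y))
    (hx : ∀ s, worst ok (fun s => if bad s then 1 else 0) (f s x) ≤ c) (l : List ι) (hl : x ∈ l)
    (s : σ) : worst ok (fun s => if bad s then 1 else 0) (l.foldlM f s) ≤ c := by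
  have hrest : ∀ (l : List ι) (s : σ),
      worst ok (fun s => if bad s then 1 else 0) (l.foldlM f s) ≤ if bad s then 1 else 0 := by
    intro l s
    by_cases hs : bad s
    · rw [if_pos hs]
      refine (worst_mono (fun s => ?_) _).trans (worst_const_le _ 1)
      split_ifs <;> simp
    · rw [if_neg hs]
      refine worst_le_of_yields (Q := fun s => ¬ bad s) (fun b hb => ?_)
        (Yields.foldlM _ (fun s x _ => hstay s x) s hs)
      rw [if_neg hb]
  induction l generalizing s with
  | nil => simp at hl
  | cons y l ih =>
    rw [List.foldlM_cons, bind_eq, worst_bind]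
    rcases List.mem_cons.1 hl with rfl | hl
    · exact (worst_mono (hrest l) _).trans (hx s)
    · exact (worst_mono (fun s => ih hl s) _).trans (worst_const_le _ _)

end Prog

namespace Inst

variable (X : Inst)

/-- Enter all edges of a list. -/
def recordAll (D : ℕ) (l : List (Win × Win)) (E : ℕ → ℕ → ℕ) : ℕ → ℕ → ℕ :=
  l.foldl (fun E p => X.record E D p) E

variable {X}

lemma record_apply (E : ℕ → ℕ → ℕ) (D : ℕ) (p : Win × Win) (k j : ℕ) :
    X.record E D p k j =
      if p = (Sum.inl k, Sum.inr j) then min (E k j) (beta X.L X.imax * D) else E k j := by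
  rcases p with ⟨x | x, y | y⟩
  · simp [record]
  · simp only [record, Prod.mk.injEq, Sum.inl.injEq, Sum.inr.injEq, Function.update_apply]
    by_cases h1 : k = x
    · subst h1
      by_cases h2 : j = y
      · subst h2; simp
      · simp [h2, Ne.symm h2]
    · simp [h1, Ne.symm h1]
  · simp [record]
  · simp [record]

lemma recordAll_le (D : ℕ) (l : List (Win × Win)) (E : ℕ → ℕ → ℕ) (k j : ℕ) :
    X.recordAll D l E k j ≤ E k j := by
  induction l generalizing E with
  | nil => exact le_rfl
  | cons p l ih =>
    refine (ih (X.record E D p)).trans ?_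
    rw [record_apply]
    split_ifs
    · exact min_le_left _ _
    · exact le_rfl

lemma recordAll_le_of_mem (D : ℕ) (l : List (Win × Win)) (E : ℕ → ℕ → ℕ) (k j : ℕ)
    (h : (Sum.inl k, Sum.inr j) ∈ l) : X.recordAll D l E k j ≤ beta X.L X.imax * D := by
  induction l generalizing E with
  | nil => simp at h
  | cons p l ih =>
    rcases List.mem_cons.1 h with rfl | h
    · refine (recordAll_le D l (X.record E D _) k j).trans ?_
      rw [record_apply, if_pos rfl]
      exact min_le_right _ _
    · exact ih _ h

lemma le_recordAll (δ : Win → Win → ℕ) (D : ℕ) (l : List (Win × Win)) (E : ℕ → ℕ → ℕ) (k j : ℕ)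
    (hl : ∀ p ∈ l, δ p.1 p.2 ≤ beta X.L X.imax * D) (h : δ (Sum.inl k) (Sum.inr j) ≤ E k j) :
    δ (Sum.inl k) (Sum.inr j) ≤ X.recordAll D l E k j := by
  induction l generalizing E with
  | nil => exact h
  | cons p l ih =>
    refine ih (X.record E D p) (fun p' hp' => hl p' (List.mem_cons_of_mem _ hp')) ?_
    rw [record_apply]
    split_ifs with hp
    · refine le_min h ?_
      have := hl p (by simp)
      rwa [hp] at this
    · exact h

lemma foldlM_record {P : Query → Prop} (D : ℕ) (l : List (Win × Win)) (E : ℕ → ℕ → ℕ) :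
    Prog.Runs P (fun E' => E' = X.recordAll D l E) (l.foldlM (fun E p => do
      Prog.spend 1
      pure (X.record E D p)) E) l.length 0 := by
  induction l generalizing E with
  | nil =>
    exact (Prog.Runs.ret (Q := fun E' => E' = X.recordAll D [] E) rfl).mono (fun _ h => h)
      (by simp) le_rfl
  | cons p l ih =>
    rw [List.foldlM_cons]
    refine (((Prog.Runs.spend 1).bind fun _ _ => Prog.Runs.ret
      (Q := fun E' => E' = X.record E D p) rfl).bind (Q' := fun E' =>
        E' = X.recordAll D (p :: l) E) (s' := l.length) (q' := 0) fun E' hE' => ?_).mono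
        (fun _ h => h) ?_ ?_
    · rw [hE']; exact ih _
    · rw [List.length_cons]; push_cast; linarith
    · simp

variable {δ : Win → Win → ℕ} {D : ℕ} {m : ℕ → ℕ} {S₀ : Finset ℕ}

lemma expansion_pow_le {τ τ' : ℕ} (h : τ ≤ τ') :
    D * expansion X.L X.imax ^ τ ≤ D * expansion X.L X.imax ^ τ' :=
  Nat.mul_le_mul_left _ (Nat.pow_le_pow_right (by have := X.expansion_ge; omega) h)

lemma yields_sampleClique (live : List Win) :
    Prog.Yields (X.Ok δ) (fun C => ∃ x, ∀ z ∈ C,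
      δ x z ≤ D * expansion X.L X.imax ^ tauMax X.L X.imax) (X.sampleClique live D) := by
  have hT := tauMax_pos X.L X.imax
  rw [sampleClique.eq_def]
  cases live with
  | nil => exact ⟨Sum.inl 0, by simp⟩
  | cons w ws =>
    intro j τ
    refine (yields_filter_ball (X := X) (D := D) ((w :: ws).get j) (τ + 1) (w :: ws)).mono
      fun C hC => ⟨_, fun z hz => (hC.le z hz).trans (expansion_pow_le ?_)⟩
    have := τ.2
    omega

/-- The edges that are found are short. -/
lemma yields_query (hM : CloseMatching X δ D m S₀) (r : ℕ) (live : List Win) :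
    Prog.Yields (X.Ok δ) (fun E => ∀ p ∈ E, δ p.1 p.2 ≤ beta X.L X.imax * D)
      (X.query X.intervals D r live) := by
  have hβ : beta X.L X.imax * D = D * expansion X.L X.imax ^ (tauMax X.L X.imax + 2) :=
    mul_comm _ _
  rw [hβ]
  induction r generalizing live with
  | zero =>
    rw [query]
    refine Prog.Yields.foldlM _ (fun E p _ hE v hv => ?_) [] (by simp)
    change ∀ p' ∈ (if v ≤ D * expansion X.L X.imax then p :: E else E), _
    split_ifs with h
    · intro p' hp'
      rcases List.mem_cons.1 hp' with rfl | hp'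
      · have h1 := X.expansion_pow_le (D := D) (show 1 ≤ tauMax X.L X.imax + 2 by omega)
        rw [pow_one] at h1
        exact (hv.1.trans h).trans h1
      · exact hE p' hp'
    · exact hE
  | succ r ih =>
    rw [query_succ]
    refine Prog.Yields.foldlM _ (fun E _ _ hE => ?_) [] (by simp)
    unfold queryRound
    simp only [Prog.bind_eq]
    refine (yields_sampleClique live).bind fun C hC => (Prog.yields_true _).bind fun next _ => ?_
    have happend : ∀ E' : List (Win × Win), (∀ p ∈ E', δ p.1 p.2 ≤
        D * expansion X.L X.imax ^ (tauMax X.L X.imax + 2)) → ∀ p ∈ E' ++ E, δ p.1 p.2 ≤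
        D * expansion X.L X.imax ^ (tauMax X.L X.imax + 2) := by
      intro E' hE' p hp
      rcases List.mem_append.1 hp with hp | hp
      · exact hE' p hp
      · exact hE p hp
    cases next with
    | none =>
      refine happend _ fun p hp => ?_
      obtain ⟨x, hx⟩ := hC
      obtain ⟨h1, h2⟩ := List.mem_product.1 (show (p.1, p.2) ∈ C.product C from hp)
      have h3 := hM.tri p.1 x p.2
      rw [hM.symm p.1 x] at h3
      have h4 := hx _ h1
      have h5 := hx _ h2
      have h6 := X.radius_step' (D := D) (tauMax X.L X.imax)
      have h7 := X.expansion_pow_le (D := D)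
        (show tauMax X.L X.imax + 1 ≤ tauMax X.L X.imax + 2 by omega)
      omega
    | some live' => exact (ih live').bind fun E' hE' => happend E' hE'

variable (X) in
/-- One round of `AggregateEstimates`. -/
noncomputable def aggregateRound (E : ℕ → ℕ → ℕ) (D : ℕ) : Prog (ℕ → ℕ → ℕ) := do
  Prog.spend 1
  let edges ← X.query X.intervals D X.imax X.windows
  edges.foldlM (fun E p => do
    Prog.spend 1
    pure (X.record E D p)) E

lemma aggregateEstimates_eq : X.aggregateEstimates X.intervals = (do
    Prog.spend (X.numA * X.numB)
    X.thresholds.foldlM X.aggregateRound (fun _ _ => X.d)) := rfl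

lemma yields_aggregateRound {ok : Query → ℕ → Prop} {Q : List (Win × Win) → Prop}
    {Q' : (ℕ → ℕ → ℕ) → Prop} {E : ℕ → ℕ → ℕ}
    (hQ : Prog.Yields ok Q (X.query X.intervals D X.imax X.windows))
    (hQ' : ∀ l, Q l → Q' (X.recordAll D l E)) :
    Prog.Yields ok Q' (X.aggregateRound E D) := by
  unfold aggregateRound
  simp only [Prog.bind_eq]
  refine (Prog.yields_true (Prog.spend 1)).bind fun _ _ => hQ.bind fun l hl => ?_
  exact ((foldlM_record (P := fun _ => True) D l E).yields).mono fun E' hE' => hE' ▸ hQ' l hl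

/-- The estimates lie between the distance and the length of the windows. -/
def Bounds (X : Inst) (δ : Win → Win → ℕ) (E : ℕ → ℕ → ℕ) : Prop :=
  (∀ k < X.numA, ∀ j < X.numB, δ (Sum.inl k) (Sum.inr j) ≤ E k j) ∧ ∀ k j, E k j ≤ X.d

lemma yields_aggregateEstimates (hM : ∀ D, CloseMatching X δ D m ∅)
    (hd : ∀ k < X.numA, ∀ j < X.numB, δ (Sum.inl k) (Sum.inr j) ≤ X.d) :
    Prog.Yields (X.Ok δ) (X.Bounds δ) (X.aggregateEstimates X.intervals) := by
  rw [aggregateEstimates_eq, Prog.bind_eq]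
  refine (Prog.yields_true (Prog.spend _)).bind fun _ _ => ?_
  refine Prog.Yields.foldlM _ (fun E D _ hE => ?_) _ ⟨hd, fun _ _ => le_rfl⟩
  refine yields_aggregateRound (yields_query (hM D) _ _) fun l hl => ⟨fun k hk j hj => ?_,
    fun k j => (recordAll_le D l E k j).trans (hE.2 k j)⟩
  exact le_recordAll δ D l E k j hl (hE.1 k hk j hj)

/-- The number of elements of the matching whose estimate is too large for a target distance. -/
noncomputable def wrong (X : Inst) (m : ℕ → ℕ) (S : Finset ℕ) (D : ℕ) (E : ℕ → ℕ → ℕ) : ℕ :=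
  (S.filter fun k => beta X.L X.imax * D < E k (m k)).card

open scoped Classical in
/-- With high probability few estimates are wrong. -/
lemma worst_wrong_le (hM : CloseMatching X δ D m S₀) (hX : X.Large) (himax : 1 ≤ X.imax)
    (hD : D ∈ X.thresholds) :
    Prog.worst (X.Ok δ)
      (fun E => if (X.t : ℝ) / X.growth < X.wrong m S₀ D E then 1 else 0)
      (X.aggregateEstimates X.intervals) ≤ 2⁻¹ ^ ⌈X.growth ^ 2⌉₊ := by
  rw [aggregateEstimates_eq, Prog.bind_eq, Prog.worst_bind, Prog.worst_spend]
  refine Prog.worst_foldlM_bad_le (fun E => (X.t : ℝ) / X.growth < X.wrong m S₀ D E)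
    X.aggregateRound D _ (fun E D' hE => ?_) (fun E => ?_) _ hD _
  · refine yields_aggregateRound (Prog.yields_true _) fun l _ => ?_
    rw [not_lt] at hE ⊢
    refine le_trans ?_ hE
    norm_cast
    refine Finset.card_le_card fun k hk => ?_
    obtain ⟨h1, h2⟩ := Finset.mem_filter.1 hk
    exact Finset.mem_filter.2 ⟨h1, h2.trans_le (recordAll_le _ _ _ _ _)⟩
  · refine le_trans ?_ (worst_query_windows_le hM hX himax)
    unfold aggregateRound
    simp only [Prog.bind_eq]
    rw [Prog.worst_bind, Prog.worst_spend, Prog.worst_bind]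
    refine Prog.worst_mono (fun l => ?_) _
    refine Prog.worst_le_of_yields (fun E' hE' => ?_)
      (foldlM_record (P := fun _ => True) D l E).yields
    have h1 : X.wrong m S₀ D E' ≤ missed m S₀ l := by
      rw [hE']
      refine Finset.card_le_card fun k hk => ?_
      obtain ⟨h1, h2⟩ := Finset.mem_filter.1 hk
      exact Finset.mem_filter.2 ⟨h1, fun h =>
        absurd h2 (not_lt.2 (recordAll_le_of_mem _ _ _ _ _ h))⟩
    have h2 : (X.wrong m S₀ D E' : ℝ) ≤ missed m S₀ l := by exact_mod_cast h1
    split_ifs with h3 h4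
    · exact le_rfl
    · exact absurd (h3.trans_le h2) h4
    · exact bot_le
    · exact le_rfl

/-- Every distance is close to a threshold. -/
lemma exists_threshold (hγ : 1 ≤ X.γ) {x : ℕ} (hx : x ≤ X.d) :
    ∃ D ∈ X.thresholds, x ≤ D ∧ D ≤ X.γ + 2 * x := by
  set K := Nat.clog 2 ((X.d + X.γ - 1) / X.γ) with hK
  have hlast : x ≤ min (2 ^ K * X.γ) X.d := by
    refine le_min (hx.trans ?_) hx
    have h1 : (X.d + X.γ - 1) / X.γ ≤ 2 ^ K := Nat.le_pow_clog (by norm_num) _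
    have h2 := Nat.lt_div_mul_add (a := X.d + X.γ - 1) (b := X.γ) hγ
    have h3 := Nat.mul_le_mul_right X.γ h1
    omega
  have hex : ∃ k, x ≤ min (2 ^ k * X.γ) X.d := ⟨K, hlast⟩
  classical
  refine ⟨min (2 ^ Nat.find hex * X.γ) X.d, ?_, Nat.find_spec hex, ?_⟩
  · unfold thresholds
    exact List.mem_map.2 ⟨_, List.mem_range.2 (Nat.lt_succ_of_le (Nat.find_min' hex hlast)), rfl⟩
  · rcases Nat.eq_zero_or_pos (Nat.find hex) with h | h
    · rw [h, pow_zero, one_mul]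
      exact (min_le_left _ _).trans (by omega)
    · have h1 := Nat.find_min hex (show Nat.find hex - 1 < Nat.find hex by omega)
      rw [le_min_iff, not_and_or] at h1
      have h2 : 2 ^ Nat.find hex = 2 * 2 ^ (Nat.find hex - 1) := by
        rw [← pow_succ']; congr 1; omega
      refine (min_le_left _ _).trans ?_
      rw [h2, mul_assoc]
      omega

/-- The estimates along the matching, if few of them are wrong. -/
lemma sum_estimates_le {α : Type*} {A B : List α} (hγ : 1 ≤ X.γ) (M : X.Matching A B)
    {E : ℕ → ℕ → ℕ} (hE : X.Bounds (fun x y => editDist (X.word A B x) (X.word A B y)) E)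
    (w : ℕ)
    (hw : ∀ D ∈ X.thresholds, X.wrong M.m (M.S.filter fun k =>
      editDist (X.word A B (Sum.inl k)) (X.word A B (Sum.inr (M.m k))) ≤ D) D E ≤ w) :
    ∑ k ∈ M.S, E k (M.m k) ≤ beta X.L X.imax * (5 * (X.numA * X.γ) + 8 * editDist A B) +
      X.d * (X.thresholds.length * w) := by
  classical
  set δ : ℕ → ℕ := fun k => editDist (X.word A B (Sum.inl k)) (X.word A B (Sum.inr (M.m k)))
    with hδ
  set β := beta X.L X.imax with hβ
  set W : ℕ → Finset ℕ := fun D => (M.S.filter fun k => δ k ≤ D).filter fun k =>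
    β * D < E k (M.m k) with hW
  -- at most `w` estimates are wrong for each threshold, and those are at most `d`
  set Bad := X.thresholds.toFinset.biUnion W with hBad
  have hBadS : Bad.card ≤ X.thresholds.length * w := by
    refine (Finset.card_biUnion_le).trans ((Finset.sum_le_card_nsmul _ _ w fun D hD => ?_).trans ?_)
    · exact hw D (List.mem_toFinset.1 hD)
    · rw [smul_eq_mul]
      exact Nat.mul_le_mul_right _ (List.toFinset_card_le _)
  have hpt : ∀ k ∈ M.S, E k (M.m k) ≤ β * (X.γ + 2 * δ k) + if k ∈ Bad then X.d else 0 := by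
    intro k hk
    split_ifs with hb
    · exact (hE.2 _ _).trans (Nat.le_add_left _ _)
    · obtain ⟨D, hD, h1, h2⟩ := X.exists_threshold hγ
        ((hE.1 k (M.lt_numA k hk) _ (M.lt_numB k hk)).trans (hE.2 _ _))
      have h3 : ¬ β * D < E k (M.m k) := fun h => hb (Finset.mem_biUnion.2
        ⟨D, List.mem_toFinset.2 hD, Finset.mem_filter.2 ⟨Finset.mem_filter.2 ⟨hk, h1⟩, h⟩⟩)
      rw [add_zero]
      exact (not_lt.1 h3).trans (Nat.mul_le_mul_left _ h2)
  have hsub : M.S ⊆ Finset.range X.numA := fun k hk => Finset.mem_range.2 (M.lt_numA k hk)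
  have hcard : M.S.card ≤ X.numA := by simpa using Finset.card_le_card hsub
  have hδsum : ∑ k ∈ M.S, (X.γ + 2 * δ k) ≤ 5 * (X.numA * X.γ) + 8 * editDist A B := by
    calc _ ≤ ∑ k ∈ M.S, (5 * X.γ + 8 * M.cost k) := by
          refine Finset.sum_le_sum fun k hk => ?_
          have : δ k ≤ 4 * M.cost k + 2 * X.γ := M.close k hk
          omega
      _ ≤ ∑ k ∈ Finset.range X.numA, (5 * X.γ + 8 * M.cost k) :=
          Finset.sum_le_sum_of_subset hsub
      _ = 5 * (X.numA * X.γ) + 8 * ∑ k ∈ Finset.range X.numA, M.cost k := by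
          rw [Finset.sum_add_distrib, Finset.mul_sum]
          simp
          ring
      _ ≤ _ := by have := M.sum_cost; omega
  calc _ ≤ ∑ k ∈ M.S, (β * (X.γ + 2 * δ k) + if k ∈ Bad then X.d else 0) :=
        Finset.sum_le_sum hpt
    _ = β * ∑ k ∈ M.S, (X.γ + 2 * δ k) + (M.S.filter fun k => k ∈ Bad).card * X.d := by
        rw [Finset.sum_add_distrib, Finset.mul_sum, ← Finset.sum_filter, Finset.sum_const,
          smul_eq_mul]
    _ ≤ _ := by
        refine add_le_add (Nat.mul_le_mul_left _ hδsum) ?_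
        rw [mul_comm]
        refine Nat.mul_le_mul_left _ (le_trans (Finset.card_le_card ?_) hBadS)
        intro k hk
        exact (Finset.mem_filter.1 hk).2

/-- The loss `β` of the estimates is much smaller than the approximation factor of the level: the
exponent of `α` grows by the factor `20000 / ε ^ 2` per level, that of `β` only by about
`τ_max = 1000 / ε ^ 2`. -/
lemma beta_mul_le (hL : 1 ≤ X.L) : 64 * beta X.L X.imax ≤ alpha X.L X.imax := by
  set E := invEps X.L X.imax with hE
  have hE1 : 1 ≤ E := invEps_pos _ _
  set Q := (20000 * E ^ 2) ^ (X.L - 1) with hQ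
  have hQ1 : 1 ≤ Q := Nat.one_le_pow _ _ (by positivity)
  have hα : alpha (X.L - 1) X.imax ≤ 2 ^ Q := by
    unfold alpha
    refine Nat.pow_le_pow_right (by norm_num) (Nat.pow_le_pow_left ?_ _)
    refine Nat.mul_le_mul_left _ (Nat.pow_le_pow_left ?_ 2)
    exact Nat.pow_le_pow_right (by norm_num) (by omega)
  have hc : expansion X.L X.imax ≤ 2 ^ (7 + Q) := by
    unfold expansion
    rw [pow_add]
    exact Nat.mul_le_mul (by norm_num) hα
  have hβ : beta X.L X.imax ≤ 2 ^ ((7 + Q) * (1000 * E ^ 2 + 2)) := by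
    unfold beta
    rw [pow_mul]
    exact Nat.pow_le_pow_left hc _
  calc 64 * beta X.L X.imax ≤ 2 ^ 6 * 2 ^ ((7 + Q) * (1000 * E ^ 2 + 2)) :=
        Nat.mul_le_mul (by norm_num) hβ
    _ = 2 ^ (6 + (7 + Q) * (1000 * E ^ 2 + 2)) := by rw [← pow_add]
    _ ≤ 2 ^ (20000 * E ^ 2) ^ X.L := by
        refine Nat.pow_le_pow_right (by norm_num) ?_
        have h0 : (20000 * E ^ 2) ^ X.L = Q * (20000 * E ^ 2) := by
          rw [hQ, ← pow_succ]; congr 1; omega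
        rw [h0]
        have h1 : 1 ≤ E ^ 2 := Nat.one_le_pow _ _ hE1
        have h2 : (7 + Q) * (1000 * E ^ 2 + 2) ≤ (8 * Q) * (1002 * E ^ 2) :=
          Nat.mul_le_mul (by omega) (by omega)
        have h3 : Q ≤ Q * E ^ 2 := Nat.le_mul_of_pos_right _ (by omega)
        nlinarith
    _ = _ := rfl

end Inst

/-! ### The running time of one level -/

namespace Inst

variable {X : Inst}

variable (X) in
/-- The queries that are made: pairs of windows, with a target distance. -/
def Legal (q : Query) : Prop := q.x ∈ X.windows ∧ q.y ∈ X.windows ∧ q.Δ ∈ X.thresholds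

lemma rho_pow (himax : 1 ≤ X.imax) : X.rho ^ X.imax = X.t := by
  unfold rho
  rw [← Real.rpow_natCast, ← Real.rpow_mul (Nat.cast_nonneg _), one_div_mul_cancel, Real.rpow_one]
  exact_mod_cast (by omega : X.imax ≠ 0)

lemma t_pos : 1 ≤ X.t := by
  have := X.numB_pos
  unfold Inst.t
  omega

lemma rho_ge_one : 1 ≤ X.rho :=
  Real.one_le_rpow (by exact_mod_cast X.t_pos) (by positivity)

variable (X) in
/-- The factor that the recursion of `Query` contributes to the running time. -/
noncomputable def overhead : ℝ :=
  (X.shrink ^ X.imax) ^ 2 * X.rho * (8 * X.growth ^ 100 ^ (X.imax + 1)) ^ X.imax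

variable (X) in
/-- The cost of handling one pair of live windows. -/
noncomputable def pairCost : ℝ := tauMax X.L X.imax + 20 * invEps X.L X.imax + 60

lemma Large.one_le_overhead (hX : X.Large) : 1 ≤ X.overhead := by
  have hz := hX.growth_ge
  have hb : (8 : ℝ) ≤ X.base := by exact_mod_cast hX.base_ge
  have h1 : 1 ≤ X.shrink := by
    unfold shrink
    have h1 : (1 : ℝ) ≤ (X.base : ℝ) ^ 2 := one_le_pow₀ (by linarith)
    have h2 : (0 : ℝ) ≤ invEps X.L X.imax := Nat.cast_nonneg _
    nlinarith
  unfold overhead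
  refine one_le_mul_of_one_le_of_one_le
    (one_le_mul_of_one_le_of_one_le (one_le_pow₀ (one_le_pow₀ h1))
    X.rho_ge_one) (one_le_pow₀ ?_)
  have : 1 ≤ X.growth ^ 100 ^ (X.imax + 1) := one_le_pow₀ (by linarith)
  linarith

lemma runs_query_windows (hX : X.Large) (himax : 1 ≤ X.imax) {D : ℕ} (hD : D ∈ X.thresholds) :
    (X.query X.intervals D X.imax X.windows).Runs X.Legal
      (fun E => (E.length : ℝ) ≤ X.t ^ 2 * X.overhead) (X.pairCost * X.t ^ 2 * X.overhead)
      (X.t * X.overhead) := by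
  have hz := hX.growth_ge
  have hρ := X.rho_ge_one
  have ht := X.rho_pow himax
  have ht0 : (0 : ℝ) ≤ X.t := Nat.cast_nonneg _
  set z := X.growth with hzdef
  set u : ℝ := 2 * z ^ 100 ^ (X.imax + 1) with hu
  have hu1 : 1 ≤ z ^ 100 ^ (X.imax + 1) := one_le_pow₀ (by linarith)
  have hb : 1 < X.base := by have := hX.base_ge; omega
  have h1 := runs_query (P := X.Legal) (D := D) X hb (u := u) (c := X.pairCost) (by linarith) hρ ht
    (fun r hr => by
      rw [rpow_epsLevel]
      have h2 : z ^ 100 ^ (X.imax - r + 1) ≤ z ^ 100 ^ (X.imax + 1) :=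
        pow_le_pow_right₀ (by linarith) (Nat.pow_le_pow_right (by norm_num) (by omega))
      have h0 : 0 ≤ z ^ 100 ^ (X.imax - r + 1) * X.rho := by positivity
      have h3 := (Nat.ceil_lt_add_one h0).le
      have h4 : 1 ≤ z ^ 100 ^ (X.imax + 1) * X.rho := one_le_mul_of_one_le_of_one_le hu1 hρ
      have h5 : z ^ 100 ^ (X.imax - r + 1) * X.rho ≤ z ^ 100 ^ (X.imax + 1) * X.rho := by gcongr
      calc _ ≤ _ := h3
        _ ≤ _ := by rw [hu]; linarith) le_rfl
    (fun x hx y hy => ⟨hx, hy, hD⟩) X.imax le_rfl X.windows (List.Subset.refl _)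
    (by rw [X.windows_length, Nat.sub_self, pow_zero, one_mul, ht])
  have h4u : (4 * u) ^ X.imax = (8 * z ^ 100 ^ (X.imax + 1)) ^ X.imax := by rw [hu]; ring
  have h2u : (2 * u) ^ X.imax ≤ (8 * z ^ 100 ^ (X.imax + 1)) ^ X.imax :=
    pow_le_pow_left₀ (by positivity) (by rw [hu]; linarith) _
  have hO : X.overhead = (X.shrink ^ X.imax) ^ 2 * X.rho *
    (8 * z ^ 100 ^ (X.imax + 1)) ^ X.imax := rfl
  rw [pow_succ X.rho, ht] at h1
  have hfac : 0 ≤ (X.shrink ^ X.imax) ^ 2 * X.rho := by positivity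
  refine h1.mono (fun E hE => hE.trans ?_) (le_of_eq ?_) ?_
  · calc _ = X.t ^ 2 * ((X.shrink ^ X.imax) ^ 2 * X.rho * (2 * u) ^ X.imax) := by ring
      _ ≤ _ := by rw [hO]; gcongr
  · rw [h4u, hO]; ring
  · calc _ = X.t * ((X.shrink ^ X.imax) ^ 2 * X.rho * (2 * u) ^ X.imax) := by ring
      _ ≤ _ := by rw [hO]; gcongr

lemma pairCost_nonneg : 0 ≤ X.pairCost := by unfold pairCost; positivity

lemma runs_aggregateEstimates (hX : X.Large) (himax : 1 ≤ X.imax) :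
    (X.aggregateEstimates X.intervals).Runs X.Legal (fun _ => True)
      (X.thresholds.length * (X.pairCost + 3) * X.t ^ 2 * X.overhead)
      (X.thresholds.length * (X.t * X.overhead)) := by
  have hO := hX.one_le_overhead
  have hc := X.pairCost_nonneg
  have ht1 : (1 : ℝ) ≤ X.t := by exact_mod_cast X.t_pos
  have hthr : (1 : ℝ) ≤ X.thresholds.length := by
    unfold thresholds
    simp
  have hround : ∀ D ∈ X.thresholds, ∀ E, (X.aggregateRound E D).Runs X.Legal (fun _ => True)
      ((X.pairCost + 2) * X.t ^ 2 * X.overhead) (X.t * X.overhead) := by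
    intro D hD E
    unfold aggregateRound
    simp only [Prog.bind_eq]
    refine ((Prog.Runs.spend 1).bind fun _ _ => (runs_query_windows hX himax hD).bind
      (s' := X.t ^ 2 * X.overhead) (q' := 0) fun l hl =>
      (foldlM_record D l E).mono (fun _ _ => trivial) hl le_rfl).mono (fun _ h => h) ?_ ?_
    · have : 1 ≤ X.t ^ 2 * X.overhead :=
        one_le_mul_of_one_le_of_one_le (one_le_pow₀ ht1) hO
      push_cast
      linarith
    · linarith
  rw [aggregateEstimates_eq, Prog.bind_eq]
  refine ((Prog.Runs.spend _).bind fun _ _ => Prog.Runs.foldlM X.thresholds (fun _ _ => True)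
    (fun i hi E _ => hround _ (List.getElem_mem hi) E) _ trivial).mono (fun _ h => h) ?_ ?_
  · have h1 : ((X.numA * X.numB : ℕ) : ℝ) ≤ X.t ^ 2 := by
      have : X.numA * X.numB ≤ X.t ^ 2 := by
        rw [sq]
        exact Nat.mul_le_mul (Nat.le_add_right _ _) (Nat.le_add_left _ _)
      exact_mod_cast this
    have h2 : (X.t : ℝ) ^ 2 ≤ X.thresholds.length * (X.t ^ 2 * X.overhead) := by
      have h3 : (X.t : ℝ) ^ 2 ≤ X.t ^ 2 * X.overhead := le_mul_of_one_le_right (by positivity) hO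
      exact h3.trans (le_mul_of_one_le_left (by positivity) hthr)
    linarith
  · linarith

lemma runs_mainProg (hX : X.Large) (himax : 1 ≤ X.imax) (hγ : 1 ≤ X.γ) :
    X.mainProg.Runs X.Legal (fun _ => True)
      (X.t ^ 2 * (X.thresholds.length * (X.pairCost + 3) * X.overhead +
        (invEps X.L X.imax + (X.d / X.γ : ℕ) + 8)))
      (X.thresholds.length * (X.t * X.overhead)) := by
  have ht1 : (1 : ℝ) ≤ X.t := by exact_mod_cast X.t_pos
  have hE : (0 : ℝ) ≤ invEps X.L X.imax := Nat.cast_nonneg _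
  have hb := hX.base_ge
  have hA : (X.numA : ℝ) ≤ X.t := by
    unfold Inst.t; push_cast; linarith [X.numB.cast_nonneg (α := ℝ)]
  have hB : (X.numB : ℝ) ≤ X.t := by
    unfold Inst.t; push_cast; linarith [X.numA.cast_nonneg (α := ℝ)]
  have hAB : (X.numA : ℝ) * X.numB ≤ X.t ^ 2 := by
    rw [sq]; gcongr
  unfold mainProg
  simp only [Prog.bind_eq]
  refine ((Prog.Runs.spend _).bind fun _ _ => (Prog.Runs.spend _).bind fun _ _ =>
    (runs_aggregateEstimates hX himax).bind fun E _ =>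
      (runs_edFromEstimates (E := E) (P := X.Legal) X hγ).mono (fun _ _ => trivial)
        le_rfl le_rfl).mono (fun _ h => h) ?_ ?_
  · have h1 : (X.intervals.length : ℝ) ≤ (invEps X.L X.imax + 1) * X.t := by
      exact_mod_cast X.intervals_length_le (by omega)
    have h2 : (X.t : ℝ) ≤ X.t ^ 2 := by nlinarith
    have h3 : (X.numA : ℝ) * (X.numB * ((X.d / X.γ + 1 + 2 : ℕ) : ℝ)) ≤
        X.t ^ 2 * ((X.d / X.γ : ℕ) + 3) := by
      rw [← mul_assoc]
      refine mul_le_mul hAB ?_ (Nat.cast_nonneg _) (by positivity)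
      push_cast; linarith
    have h4 : ((invEps X.L X.imax : ℝ) + 1) * X.t ≤ (invEps X.L X.imax + 1) * X.t ^ 2 := by gcongr
    nlinarith
  · linarith

end Inst

/-! ### The size of the parameters -/

/-- The hypotheses of the theorem on `n` and `Δ`. -/
structure Setting (imax L n : ℕ) (Δ : ℝ) : Prop where
  imax_pos : 1 ≤ imax
  L_pos : 1 ≤ L
  nMin_le : nMin L imax ≤ n
  le_Δ : (n : ℝ) ^ (1 - eps' L imax) ≤ Δ
  Δ_le : Δ ≤ n

lemma eps'_eq (L imax : ℕ) : eps' L imax = 1 / ((200 * invEps L imax : ℕ) : ℝ) := by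
  unfold eps' invEps
  push_cast
  rw [← pow_succ']

lemma eps_eq (L imax : ℕ) : eps L imax = 1 / (invEps L imax : ℝ) := by
  unfold eps invEps
  push_cast
  rfl

/-- The unit in which all sizes are measured: `n ^ ε'`. Since `1 / ε' = 200 / ε` is the
natural number `200 * invEps`, both `n` and, up to rounding, `√n` are natural powers of it. -/
noncomputable def size (L imax n : ℕ) : ℝ := (n : ℝ) ^ eps' L imax

lemma nMin_eq (L imax : ℕ) : nMin L imax =
    (1000 * ((200 * invEps L imax : ℕ) : ℝ) ^ 10) ^ (4 ^ (L + 2) * (200 * invEps L imax) ^ 2) := by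
  have h : (4 : ℝ) ^ (L + 2) / eps' L imax ^ 2 =
      ((4 ^ (L + 2) * (200 * invEps L imax) ^ 2 : ℕ) : ℝ) := by
    rw [eps'_eq, div_pow, one_pow, div_div_eq_mul_div, div_one]
    push_cast
    rfl
  unfold nMin
  rw [h, Real.rpow_natCast, eps'_eq]
  congr 1
  rw [div_pow, one_pow, div_div_eq_mul_div, div_one]

lemma root_pow {x : ℝ} (hx : 0 ≤ x) {k : ℕ} (hk : k ≠ 0) : (x ^ (1 / (k : ℝ))) ^ k = x := by
  rw [one_div, Real.rpow_inv_natCast_pow hx hk]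

lemma size_pow (L imax n : ℕ) : size L imax n ^ (200 * invEps L imax) = n := by
  unfold size
  rw [eps'_eq]
  exact root_pow (Nat.cast_nonneg _) (by have := Inst.invEps_pos L imax; omega)

lemma le_size {L imax n : ℕ} (h : nMin L imax ≤ n) :
    (1000 * ((200 * invEps L imax : ℕ) : ℝ) ^ 10) ^ (4 ^ (L + 2) * (200 * invEps L imax)) ≤
      size L imax n := by
  have hR : 200 * invEps L imax ≠ 0 := by have := Inst.invEps_pos L imax; omega
  rw [← pow_le_pow_iff_left₀ (by positivity) (by unfold size; positivity) hR, size_pow, ← pow_mul]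
  refine le_trans (le_of_eq ?_) h
  rw [nMin_eq, sq, mul_assoc]

lemma inst_γ_pos (imax L n : ℕ) (Δ : ℝ) : 1 ≤ (inst imax L n Δ).γ := le_max_left _ _

lemma inst_le_two_mul_γ (imax L n : ℕ) (Δ : ℝ) :
    Δ * Nat.sqrt n / n ≤ 2 * (inst imax L n Δ).γ := by
  have h1 : (1 : ℝ) ≤ (inst imax L n Δ).γ := by exact_mod_cast inst_γ_pos imax L n Δ
  have h2 : (⌊Δ * (Nat.sqrt n : ℝ) / (n : ℝ)⌋₊ : ℝ) ≤ (inst imax L n Δ).γ := by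
    exact_mod_cast le_max_right _ _
  have h3 := Nat.lt_floor_add_one (Δ * (Nat.sqrt n : ℝ) / (n : ℝ))
  linarith

lemma n_eq_sq (L imax n : ℕ) : (n : ℝ) = (size L imax n ^ (100 * invEps L imax)) ^ 2 := by
  rw [← pow_mul, show 100 * invEps L imax * 2 = 200 * invEps L imax by ring, size_pow]

namespace Setting

variable {imax L n : ℕ} {Δ : ℝ} (S : Setting imax L n Δ)

include S

lemma invEps_ge : 8000000 ≤ invEps L imax := by
  have h1 := S.imax_pos
  have h2 := S.L_pos
  calc 8000000 = 200 ^ 3 := by norm_num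
    _ ≤ _ := Nat.pow_le_pow_right (by norm_num) (by omega)

lemma size_ge : 1000 * (200 * (invEps L imax : ℝ)) ^ 10 ≤ size L imax n := by
  refine le_trans ?_ (le_size S.nMin_le)
  push_cast
  refine le_self_pow₀ ?_ ?_
  · have h1 : (1 : ℝ) ≤ invEps L imax := by exact_mod_cast Inst.invEps_pos L imax
    have h2 : (1 : ℝ) ≤ (200 * (invEps L imax : ℝ)) ^ 10 := one_le_pow₀ (by linarith)
    linarith
  · have := Inst.invEps_pos L imax
    positivity

lemma invEps_le_size : 1000000 * (200 * (invEps L imax : ℝ)) ≤ size L imax n := by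
  refine le_trans ?_ S.size_ge
  have h1 : (8000000 : ℝ) ≤ invEps L imax := by exact_mod_cast S.invEps_ge
  have h2 : (1 : ℝ) ≤ (200 * (invEps L imax : ℝ)) ^ 8 := one_le_pow₀ (by linarith)
  have h3 : (200 * (invEps L imax : ℝ)) ^ 10 = (200 * (invEps L imax : ℝ)) ^ 8 *
    (200 * (invEps L imax : ℝ)) * (200 * (invEps L imax : ℝ)) := by ring
  rw [h3]
  have h4 : 1 * (200 * (invEps L imax : ℝ)) * 1000 ≤ (200 * (invEps L imax : ℝ)) ^ 8 *
    (200 * (invEps L imax : ℝ)) * (200 * (invEps L imax : ℝ)) := by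
    gcongr
    linarith
  linarith

lemma size_large : 1000000000000 ≤ size L imax n := by
  have h1 : (8000000 : ℝ) ≤ invEps L imax := by exact_mod_cast S.invEps_ge
  linarith [S.invEps_le_size]

lemma n_pos : 0 < n := by
  have h1 := size_pow L imax n
  have h2 := S.size_large
  have h3 : 0 < size L imax n ^ (200 * invEps L imax) := by positivity
  rw [h1] at h3
  exact_mod_cast h3

lemma d_le : (Nat.sqrt n : ℝ) ≤ size L imax n ^ (100 * invEps L imax) := by
  have h0 := S.size_large
  rw [← pow_le_pow_iff_left₀ (Nat.cast_nonneg _) (by positivity) (two_ne_zero), ← n_eq_sq L imax n]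
  exact_mod_cast Nat.sqrt_le' n

lemma lt_d : size L imax n ^ (100 * invEps L imax) < Nat.sqrt n + 1 := by
  have h0 := S.size_large
  rw [← pow_lt_pow_iff_left₀ (by positivity) (by positivity) (two_ne_zero), ← n_eq_sq L imax n]
  exact_mod_cast Nat.lt_succ_sqrt' n

lemma d_ge : size L imax n ^ (100 * invEps L imax - 1) ≤ Nat.sqrt n := by
  have h0 := S.size_large
  have h1 := S.lt_d
  have hE := S.invEps_ge
  have h2 : size L imax n ^ (100 * invEps L imax) =
      size L imax n * size L imax n ^ (100 * invEps L imax - 1) := by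
    rw [← pow_succ']
    congr 1
    omega
  have h3 : 1 ≤ size L imax n ^ (100 * invEps L imax - 1) := one_le_pow₀ (by linarith)
  rw [h2] at h1
  nlinarith

lemma size_le_d : size L imax n ≤ Nat.sqrt n := by
  have h0 := S.size_large
  have hE := S.invEps_ge
  exact (le_self_pow₀ (by linarith) (by omega)).trans S.d_ge

lemma d_pos : (1 : ℝ) ≤ Nat.sqrt n := by linarith [S.size_le_d, S.size_large]

lemma div_size_le : (n : ℝ) / size L imax n ≤ Δ := by
  refine le_trans (le_of_eq ?_) S.le_Δ
  rw [Real.rpow_sub (by exact_mod_cast S.n_pos), Real.rpow_one]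
  rfl

lemma Δ_pos : 0 < Δ := by
  have h0 := S.size_large
  have h1 : (0 : ℝ) < n := by exact_mod_cast S.n_pos
  exact lt_of_lt_of_le (by positivity) S.div_size_le

lemma γ_le : (inst imax L n Δ).γ ≤ max 1 (Δ * Nat.sqrt n / n) := by
  have h := S.Δ_pos
  change ((max 1 ⌊Δ * (Nat.sqrt n : ℝ) / (n : ℝ)⌋₊ : ℕ) : ℝ) ≤ _
  push_cast
  exact max_le_max le_rfl (Nat.floor_le (by positivity))

lemma d_le_γ : (Nat.sqrt n : ℝ) ≤ 2 * size L imax n * (inst imax L n Δ).γ := by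
  have h0 := S.size_large
  have hn : (0 : ℝ) < n := by exact_mod_cast S.n_pos
  have h1 := inst_le_two_mul_γ imax L n Δ
  have h2 := S.div_size_le
  have h3 : (Nat.sqrt n : ℝ) / size L imax n ≤ Δ * Nat.sqrt n / n := by
    calc _ = n / size L imax n * Nat.sqrt n / n := by field_simp
      _ ≤ _ := by gcongr
  have h4 := h3.trans h1
  rw [div_le_iff₀ (by linarith)] at h4
  linarith

lemma γ_le_d : (inst imax L n Δ).γ ≤ (inst imax L n Δ).d := by
  have hn : (0 : ℝ) < n := by exact_mod_cast S.n_pos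
  have h1 := S.γ_le
  have h2 := S.d_pos
  have h3 : Δ * Nat.sqrt n / n ≤ Nat.sqrt n := by
    rw [div_le_iff₀ hn, mul_comm]
    exact mul_le_mul_of_nonneg_left S.Δ_le (by linarith)
  have h4 : ((inst imax L n Δ).γ : ℝ) ≤ Nat.sqrt n := h1.trans (max_le h2 h3)
  exact_mod_cast h4

lemma numA_mul_γ_le : ((inst imax L n Δ).numA : ℝ) * (inst imax L n Δ).γ ≤ Δ := by
  have h0 := S.size_large
  have hn : (0 : ℝ) < n := by exact_mod_cast S.n_pos
  have hd := S.d_pos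
  have h1 : ((inst imax L n Δ).numA : ℝ) ≤ n / Nat.sqrt n := Nat.cast_div_le
  have h2 : (n : ℝ) / Nat.sqrt n ≤ Δ := by
    refine le_trans ?_ S.div_size_le
    exact div_le_div_of_nonneg_left hn.le (by linarith) S.size_le_d
  calc _ ≤ (n : ℝ) / Nat.sqrt n * max 1 (Δ * Nat.sqrt n / n) := by
        gcongr
        exact S.γ_le
    _ ≤ Δ := by
        rcases max_cases (1 : ℝ) (Δ * Nat.sqrt n / n) with ⟨h, -⟩ | ⟨h, -⟩
        · rw [h, mul_one]; exact h2
        · rw [h]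
          refine le_of_eq ?_
          field_simp

/-- The number of windows. -/
lemma t_le : ((inst imax L n Δ).t : ℝ) ≤
    9 * size L imax n * size L imax n ^ (100 * invEps L imax) := by
  have h0 := S.size_large
  have hn : (0 : ℝ) < n := by exact_mod_cast S.n_pos
  have hd := S.d_pos
  have hγ : (1 : ℝ) ≤ (inst imax L n Δ).γ := by exact_mod_cast (inst_γ_pos imax L n Δ)
  have h1 : ((inst imax L n Δ).numA : ℝ) ≤ n / Nat.sqrt n := Nat.cast_div_le
  have h2 : ((inst imax L n Δ).numB : ℝ) ≤ n / (inst imax L n Δ).γ + 2 := by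
    have h3 : (inst imax L n Δ).numB ≤ n / (inst imax L n Δ).γ + 2 := by
      have hγ' := (inst_γ_pos imax L n Δ)
      unfold Inst.numB
      have h4 : (inst imax L n Δ).n - (inst imax L n Δ).d + (inst imax L n Δ).γ - 1 ≤
        n + (inst imax L n Δ).γ := by
        have : (inst imax L n Δ).n = n := rfl
        omega
      have h5 := Nat.div_le_div_right (c := (inst imax L n Δ).γ) h4
      rw [Nat.add_div_right _ hγ'] at h5
      omega
    calc _ ≤ ((n / (inst imax L n Δ).γ + 2 : ℕ) : ℝ) := by exact_mod_cast h3
      _ ≤ _ := by push_cast; gcongr; exact Nat.cast_div_le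
  have h3 : (n : ℝ) / (inst imax L n Δ).γ ≤ 2 * size L imax n * (n / Nat.sqrt n) := by
    rw [div_le_iff₀ (by linarith)]
    have h4 := S.d_le_γ
    calc (n : ℝ) = n / Nat.sqrt n * Nat.sqrt n := by field_simp
      _ ≤ n / Nat.sqrt n * (2 * size L imax n * (inst imax L n Δ).γ) := by gcongr
      _ = _ := by ring
  have h4 : (n : ℝ) / Nat.sqrt n ≤ 4 * Nat.sqrt n := by
    rw [div_le_iff₀ (by linarith)]
    have h5 : (n : ℝ) < (Nat.sqrt n + 1) ^ 2 := by exact_mod_cast Nat.lt_succ_sqrt' n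
    nlinarith
  have h5 : ((inst imax L n Δ).t : ℝ) ≤ 9 * size L imax n * Nat.sqrt n := by
    unfold Inst.t
    push_cast
    have h6 : 2 * size L imax n * (n / Nat.sqrt n) ≤ 2 * size L imax n * (4 * Nat.sqrt n) := by
      gcongr
    nlinarith
  exact h5.trans (mul_le_mul_of_nonneg_left S.d_le (by linarith))

lemma t_ge : size L imax n ^ (100 * invEps L imax) ≤ (inst imax L n Δ).t := by
  refine S.lt_d.le.trans ?_
  have h1 : Nat.sqrt n ≤ (inst imax L n Δ).numA := by
    have hd : 0 < Nat.sqrt n := by exact_mod_cast (by linarith [S.d_pos] : (0 : ℝ) < Nat.sqrt n)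
    exact (Nat.le_div_iff_mul_le hd).2 (Nat.sqrt_le n)
  have h2 := (inst imax L n Δ).numB_pos
  unfold Inst.t
  exact_mod_cast (by omega)

omit S in
lemma growth_pow : (inst imax L n Δ).growth ^ invEps L imax = (inst imax L n Δ).t := by
  unfold Inst.growth
  change (((inst imax L n Δ).t : ℝ) ^ eps L imax) ^ invEps L imax = _
  rw [eps_eq]
  exact root_pow (Nat.cast_nonneg _) (by have := Inst.invEps_pos L imax; omega)

omit S in
lemma growth_nonneg : 0 ≤ (inst imax L n Δ).growth := by unfold Inst.growth; positivity

lemma growth_ge : size L imax n ^ 100 ≤ (inst imax L n Δ).growth := by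
  have h0 := S.size_large
  rw [← pow_le_pow_iff_left₀ (by positivity) growth_nonneg
    (by have := S.invEps_ge; omega : invEps L imax ≠ 0), growth_pow, ← pow_mul]
  exact S.t_ge

lemma growth_le : (inst imax L n Δ).growth ≤ size L imax n ^ 101 := by
  have h0 := S.size_large
  have hE := S.invEps_ge
  rw [← pow_le_pow_iff_left₀ growth_nonneg (by positivity)
    (by omega : invEps L imax ≠ 0), growth_pow, ← pow_mul]
  refine S.t_le.trans ?_
  calc _ ≤ size L imax n * size L imax n * size L imax n ^ (100 * invEps L imax) := by
        gcongr; linarith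
    _ = size L imax n ^ (100 * invEps L imax + 2) := by ring
    _ ≤ _ := pow_le_pow_right₀ (by linarith) (by omega)

lemma size_pow_le_growth {k : ℕ} (hk : k ≤ 100) :
    size L imax n ^ k ≤ (inst imax L n Δ).growth :=
  (pow_le_pow_right₀ (by linarith [S.size_large]) hk).trans S.growth_ge

lemma size_le_growth : size L imax n ≤ (inst imax L n Δ).growth := by
  simpa using S.size_pow_le_growth (k := 1) (by norm_num)

lemma large : (inst imax L n Δ).Large := by
  have h0 := S.size_large
  have hz := S.size_le_growth
  have hceil : (inst imax L n Δ).growth ≤ (inst imax L n Δ).base := Nat.le_ceil _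
  have hceil' : ((inst imax L n Δ).base : ℝ) < (inst imax L n Δ).growth + 1 :=
    Nat.ceil_lt_add_one growth_nonneg
  refine ⟨⟨?_, ?_, Inst.rho_ge_one⟩, by linarith, ?_⟩
  · have : (8 : ℝ) ≤ (inst imax L n Δ).base := by linarith
    exact_mod_cast this
  · have h1 : ((inst imax L n Δ).t : ℝ) ≤ ((inst imax L n Δ).base : ℝ) ^ invEps L imax := by
      rw [← growth_pow]
      exact pow_le_pow_left₀ growth_nonneg hceil _
    exact_mod_cast h1
  · change 200000 * (tauMax L imax : ℝ) ^ 2 * ((invEps L imax : ℝ) + 1) ^ 4 ≤ _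
    refine le_trans ?_ (S.size_ge.trans hz)
    have hT : (tauMax L imax : ℝ) = 1000 * (invEps L imax : ℝ) ^ 2 := by
      unfold tauMax; push_cast; rfl
    rw [hT]
    have h1 : (1 : ℝ) ≤ invEps L imax := by exact_mod_cast Inst.invEps_pos L imax
    set E : ℝ := (invEps L imax : ℝ)
    have h2 : (E + 1) ^ 4 ≤ (2 * E) ^ 4 := pow_le_pow_left₀ (by linarith) (by linarith) 4
    have h3 : E ^ 8 ≤ E ^ 10 := pow_le_pow_right₀ h1 (by norm_num)
    calc _ = 200000000000 * E ^ 4 * (E + 1) ^ 4 := by ring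
      _ ≤ 200000000000 * E ^ 4 * (2 * E) ^ 4 := by gcongr
      _ = 3200000000000 * E ^ 8 := by ring
      _ ≤ 3200000000000 * E ^ 10 := by gcongr
      _ ≤ 1000 * 200 ^ 10 * E ^ 10 := by
          refine mul_le_mul_of_nonneg_right (by norm_num) (by positivity)
      _ = _ := by ring

/-- The number of thresholds. -/
lemma thresholds_length_le : ((inst imax L n Δ).thresholds.length : ℝ) ≤ size L imax n ^ 2 := by
  have h0 := S.size_large
  have hE := S.invEps_le_size
  have hE1 : (8000000 : ℝ) ≤ invEps L imax := by exact_mod_cast S.invEps_ge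
  set y := size L imax n with hy
  have h1 : ((inst imax L n Δ).d + (inst imax L n Δ).γ - 1) / (inst imax L n Δ).γ ≤
      2 ^ (⌈y⌉₊ * (100 * invEps L imax)) := by
    refine (Inst.ceil_div_le _ _ (inst_γ_pos imax L n Δ)).trans ?_
    have h2 : ((inst imax L n Δ).d : ℝ) ≤ 2 ^ (⌈y⌉₊ * (100 * invEps L imax)) := by
      refine S.d_le.trans ?_
      rw [pow_mul 2]
      refine pow_le_pow_left₀ (by linarith) ?_ _
      refine (Nat.le_ceil y).trans ?_
      exact_mod_cast Nat.lt_two_pow_self.le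
    exact_mod_cast h2
  have h2 := Nat.clog_le_of_le_pow h1
  have h3 : (inst imax L n Δ).thresholds.length ≤ ⌈y⌉₊ * (100 * invEps L imax) + 1 := by
    unfold Inst.thresholds
    simpa using h2
  have h4 : (⌈y⌉₊ : ℝ) ≤ y + 1 := (Nat.ceil_lt_add_one (by linarith)).le
  calc _ ≤ (((⌈y⌉₊ * (100 * invEps L imax) + 1 : ℕ)) : ℝ) := by exact_mod_cast h3
    _ ≤ (y + 1) * (100 * invEps L imax) + 1 := by push_cast; gcongr
    _ ≤ y ^ 2 := by nlinarith

/-- The total of the errors from wrong estimates. -/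
lemma wrong_total_le : (Nat.sqrt n : ℝ) * ((inst imax L n Δ).thresholds.length *
    ((inst imax L n Δ).t / (inst imax L n Δ).growth)) ≤ Δ := by
  have h0 := S.size_large
  refine le_trans ?_ S.div_size_le
  have hz := S.size_pow_le_growth (k := 5) (by norm_num)
  have hn := n_eq_sq L imax n
  set y := size L imax n with hy
  have hd := S.d_le
  have hthr := S.thresholds_length_le
  have ht := S.t_le
  set Y := y ^ (100 * invEps L imax) with hY
  have hY0 : 0 ≤ Y := by positivity
  set g := (inst imax L n Δ).growth
  have hg : 0 < g := lt_of_lt_of_le (by positivity) hz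
  calc _ ≤ Y * (y ^ 2 * (9 * y * Y / y ^ 5)) := by
        gcongr
    _ = 9 / y * (Y ^ 2 / y) := by field_simp
    _ ≤ 1 * (Y ^ 2 / y) := by
        gcongr
        rw [div_le_one (by linarith)]
        linarith
    _ = _ := by rw [hn, one_mul]

lemma d_le_Δ : (Nat.sqrt n : ℝ) ≤ Δ := by
  have h0 := S.size_large
  have hn : (n : ℝ) = size L imax n ^ (100 * invEps L imax) *
    size L imax n ^ (100 * invEps L imax) := by rw [n_eq_sq L imax n, sq]
  refine S.d_le.trans (le_trans ?_ S.div_size_le)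
  rw [le_div_iff₀ (by linarith), hn]
  refine mul_le_mul_of_nonneg_left ?_ (by positivity)
  exact le_self_pow₀ (by linarith) (by have := S.invEps_ge; omega)

end Setting

namespace Setting

variable {imax L n : ℕ} {Δ : ℝ} (S : Setting imax L n Δ)

/-! ### Efficiency -/

lemma sq_le_two_pow (i : ℕ) : i ^ 2 ≤ 2 ^ (i + 1) := by
  induction i with
  | zero => norm_num
  | succ i ih =>
    have h1 : i + 1 ≤ 2 ^ i := Nat.lt_two_pow_self
    have h2 : 2 ^ (i + 1) = 2 * 2 ^ i := pow_succ' 2 i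
    have h3 : 2 ^ (i + 1 + 1) = 2 * 2 ^ (i + 1) := pow_succ' 2 (i + 1)
    nlinarith

include S

/-- The exponents fit: there is room for the overhead in `n ^ (3 / (2 imax))`. -/
lemma exponent_le :
    202 * imax * (5 + imax * (7 + 100 ^ (imax + 1))) ≤ 3 * (200 * invEps L imax) := by
  have h1 := sq_le_two_pow imax
  have hi := S.imax_pos
  have hL := S.L_pos
  set P := 100 ^ (imax + 1) with hP
  have hP1 : 10000 ≤ P := by
    calc 10000 = 100 ^ 2 := by norm_num
      _ ≤ _ := Nat.pow_le_pow_right (by norm_num) (by omega)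
  have h2 : 40000 * (2 ^ (imax + 1) * P) ≤ 200 * invEps L imax := by
    unfold invEps
    calc 40000 * (2 ^ (imax + 1) * P) = 200 * 200 ^ (imax + 2) := by
          rw [hP, ← mul_pow]; ring
      _ ≤ _ := Nat.mul_le_mul_left _ (Nat.pow_le_pow_right (by norm_num) (by omega))
  have h3 : imax ^ 2 * P ≤ 2 ^ (imax + 1) * P := Nat.mul_le_mul_right _ h1
  have h4 : imax ≤ imax ^ 2 := Nat.le_self_pow (by norm_num) _
  have h5 : imax ^ 2 * 10000 ≤ imax ^ 2 * P := Nat.mul_le_mul_left _ hP1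
  calc _ = 1010 * imax + 1414 * imax ^ 2 + 202 * (imax ^ 2 * P) := by ring
    _ ≤ 203 * (imax ^ 2 * P) := by omega
    _ ≤ _ := by omega

/-- The overhead of the algorithm, up to powers of `t ^ ε`. -/
lemma overhead_le : (inst imax L n Δ).overhead ≤
    (n : ℝ) ^ (1 / (2 * (imax : ℝ))) *
      (inst imax L n Δ).growth ^ (1 + imax * (7 + 100 ^ (imax + 1))) := by
  have h0 := S.size_large
  have hz := S.size_le_growth
  have hb := S.large.base_le
  have hK := S.large.const_le
  have ht := S.t_le
  have hz9 := S.size_pow_le_growth (k := 2) (by norm_num)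
  have hn := n_eq_sq L imax n
  have hsize : 0 ≤ size L imax n := by linarith
  have hrho : (inst imax L n Δ).rho = ((inst imax L n Δ).t : ℝ) ^ (1 / (imax : ℝ)) := rfl
  have hshr : (inst imax L n Δ).shrink =
    7 * ((invEps L imax : ℝ) + 1) * ((inst imax L n Δ).base : ℝ) ^ 2 := rfl
  change 200000 * (tauMax L imax : ℝ) ^ 2 * ((invEps L imax : ℝ) + 1) ^ 4 ≤ _ at hK
  have himax : (1 : ℝ) ≤ imax := by exact_mod_cast S.imax_pos
  have hpos : (inst imax L n Δ).overhead = ((inst imax L n Δ).shrink ^ imax) ^ 2 *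
    (inst imax L n Δ).rho * (8 * (inst imax L n Δ).growth ^ 100 ^ (imax + 1)) ^ imax := rfl
  rw [hpos]
  set z := (inst imax L n Δ).growth
  set y := size L imax n
  set Y := y ^ (100 * invEps L imax)
  have hY0 : 0 ≤ Y := by positivity
  have h1 : (inst imax L n Δ).shrink ≤ z ^ 3 := by
    have hE1 : (1 : ℝ) ≤ (invEps L imax : ℝ) + 1 := by simp
    have hT : (1 : ℝ) ≤ (tauMax L imax : ℝ) ^ 2 :=
      one_le_pow₀ (by exact_mod_cast Inst.tauMax_pos _ _)
    have hE4 : (invEps L imax : ℝ) + 1 ≤ ((invEps L imax : ℝ) + 1) ^ 4 :=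
      le_self_pow₀ hE1 (by norm_num)
    have h2 : 28 * ((invEps L imax : ℝ) + 1) ≤ z := by
      refine le_trans ?_ hK
      calc _ ≤ 200000 * 1 * ((invEps L imax : ℝ) + 1) ^ 4 := by linarith
        _ ≤ _ := by gcongr
    rw [hshr]
    calc _ ≤ 7 * ((invEps L imax : ℝ) + 1) * (2 * z) ^ 2 := by gcongr
      _ = 28 * ((invEps L imax : ℝ) + 1) * z ^ 2 := by ring
      _ ≤ z * z ^ 2 := by gcongr
      _ = _ := by ring
  have hsh0 : 0 ≤ (inst imax L n Δ).shrink := by rw [hshr]; positivity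
  have h2 : (inst imax L n Δ).rho ≤ (n : ℝ) ^ (1 / (2 * (imax : ℝ))) * z := by
    have h3 : ((inst imax L n Δ).t : ℝ) ≤ Y * z := by
      refine ht.trans ?_
      have : 9 * y ≤ z := by nlinarith
      nlinarith
    have h4 : Y ^ (1 / (imax : ℝ)) = (n : ℝ) ^ (1 / (2 * (imax : ℝ))) := by
      rw [hn, ← Real.rpow_natCast Y 2, ← Real.rpow_mul hY0]
      congr 1
      push_cast
      field_simp
    rw [hrho]
    calc _ ≤ (Y * z) ^ (1 / (imax : ℝ)) := Real.rpow_le_rpow (Nat.cast_nonneg _) h3 (by positivity)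
      _ = Y ^ (1 / (imax : ℝ)) * z ^ (1 / (imax : ℝ)) := Real.mul_rpow hY0 (by linarith)
      _ ≤ Y ^ (1 / (imax : ℝ)) * z := by
          gcongr
          refine (Real.rpow_le_rpow_of_exponent_le (by linarith) ?_).trans (Real.rpow_one z).le
          rw [div_le_one (by linarith)]
          exact himax
      _ = _ := by rw [h4]
  have hz0 : 0 ≤ z := by linarith
  have hn0 : 0 ≤ (n : ℝ) ^ (1 / (2 * (imax : ℝ))) := by positivity
  have hrho0 : 0 ≤ (inst imax L n Δ).rho := by rw [hrho]; positivity
  have h8 : 8 ≤ z := by linarith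
  calc _ ≤ ((z ^ 3) ^ imax) ^ 2 * ((n : ℝ) ^ (1 / (2 * (imax : ℝ))) * z) *
        (z * z ^ 100 ^ (imax + 1)) ^ imax := by
        gcongr
    _ = _ := by ring

/-- Powers of `t ^ ε` are small. -/
lemma growth_pow_le : (inst imax L n Δ).growth ^ (5 + imax * (7 + 100 ^ (imax + 1))) ≤
    (n : ℝ) ^ (3 / (2 * (imax : ℝ))) := by
  have h0 := S.size_large
  have himax : (1 : ℝ) ≤ imax := by exact_mod_cast S.imax_pos
  have h1 := S.exponent_le
  set k := 5 + imax * (7 + 100 ^ (imax + 1))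
  calc _ ≤ (size L imax n ^ 101) ^ k := pow_le_pow_left₀ growth_nonneg S.growth_le _
    _ = size L imax n ^ ((101 * k : ℕ) : ℝ) := by rw [Real.rpow_natCast, pow_mul]
    _ ≤ size L imax n ^ (((200 * invEps L imax : ℕ) : ℝ) * (3 / (2 * (imax : ℝ)))) := by
        refine Real.rpow_le_rpow_of_exponent_le (by linarith) ?_
        rw [mul_div_assoc', le_div_iff₀ (by positivity)]
        exact_mod_cast (by nlinarith : 101 * k * (2 * imax) ≤ 200 * invEps L imax * 3)
    _ = _ := by rw [Real.rpow_mul (by linarith), Real.rpow_natCast, size_pow]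

lemma overhead_mul_le : (inst imax L n Δ).growth ^ 4 * (inst imax L n Δ).overhead ≤
    (n : ℝ) ^ (2 / (imax : ℝ)) := by
  have h0 := S.size_large
  have hn : (0 : ℝ) < n := by exact_mod_cast S.n_pos
  have himax : (1 : ℝ) ≤ imax := by exact_mod_cast S.imax_pos
  have hg : 0 ≤ (inst imax L n Δ).growth := growth_nonneg
  calc _ ≤ (inst imax L n Δ).growth ^ 4 * ((n : ℝ) ^ (1 / (2 * (imax : ℝ))) *
      (inst imax L n Δ).growth ^ (1 + imax * (7 + 100 ^ (imax + 1)))) := by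
        gcongr; exact S.overhead_le
    _ = (n : ℝ) ^ (1 / (2 * (imax : ℝ))) *
      (inst imax L n Δ).growth ^ (5 + imax * (7 + 100 ^ (imax + 1))) := by ring
    _ ≤ (n : ℝ) ^ (1 / (2 * (imax : ℝ))) * (n : ℝ) ^ (3 / (2 * (imax : ℝ))) := by
        gcongr; exact S.growth_pow_le
    _ = _ := by
        rw [← Real.rpow_add hn]
        congr 1
        field_simp
        norm_num

lemma queries_le : ((inst imax L n Δ).thresholds.length : ℝ) *
    ((inst imax L n Δ).t * (inst imax L n Δ).overhead) ≤ (n : ℝ) ^ (1 / 2 + 2 / (imax : ℝ)) := by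
  have h0 := S.size_large
  have hn : (0 : ℝ) < n := by exact_mod_cast S.n_pos
  have hz := S.size_pow_le_growth (k := 4) (by norm_num)
  have hO := S.large.one_le_overhead
  have hO' := S.overhead_mul_le
  have ht := S.t_le
  have hthr := S.thresholds_length_le
  have hnn : (n : ℝ) ^ (1 / 2 : ℝ) = size L imax n ^ (100 * invEps L imax) := by
    conv_lhs => rw [n_eq_sq L imax n]
    rw [← Real.rpow_natCast _ 2, ← Real.rpow_mul (by positivity)]
    norm_num
  rw [Real.rpow_add hn, hnn]
  set z := (inst imax L n Δ).growth
  set y := size L imax n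
  set Y := y ^ (100 * invEps L imax)
  have hY0 : 0 ≤ Y := by positivity
  have hz1 : 1 ≤ z := le_trans (one_le_pow₀ (by linarith)) hz
  calc _ ≤ y ^ 2 * ((9 * y * Y) * (inst imax L n Δ).overhead) := by gcongr
    _ = Y * ((9 * y ^ 3) * (inst imax L n Δ).overhead) := by ring
    _ ≤ Y * (z ^ 4 * (inst imax L n Δ).overhead) := by
        gcongr
        calc 9 * y ^ 3 ≤ y * y ^ 3 := by gcongr; linarith
          _ = y ^ 4 := by ring
          _ ≤ z := hz
          _ ≤ _ := le_self_pow₀ hz1 (by norm_num)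
    _ ≤ _ := by gcongr

lemma steps_le : ((inst imax L n Δ).t : ℝ) ^ 2 * ((inst imax L n Δ).thresholds.length *
    ((inst imax L n Δ).pairCost + 3) * (inst imax L n Δ).overhead +
      (invEps L imax + ((inst imax L n Δ).d / (inst imax L n Δ).γ : ℕ) + 8)) ≤
    (n : ℝ) ^ (1 + 2 / (imax : ℝ)) := by
  have h0 := S.size_large
  have hn : (0 : ℝ) < n := by exact_mod_cast S.n_pos
  have hz := S.size_pow_le_growth (k := 8) (by norm_num)
  have hz1 := S.size_le_growth
  have hO := S.large.one_le_overhead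
  have hO' := S.overhead_mul_le
  have ht := S.t_le
  have hthr := S.thresholds_length_le
  have hE := S.size_ge
  have hE1 : (8000000 : ℝ) ≤ invEps L imax := by exact_mod_cast S.invEps_ge
  have hdγ : ((((inst imax L n Δ).d / (inst imax L n Δ).γ : ℕ)) : ℝ) ≤ 2 * size L imax n := by
    refine Nat.cast_div_le.trans ?_
    rw [div_le_iff₀ (by exact_mod_cast inst_γ_pos imax L n Δ)]
    exact S.d_le_γ
  have hpc : (inst imax L n Δ).pairCost + 3 ≤ size L imax n := by
    have h1 : (inst imax L n Δ).pairCost =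
        1000 * (invEps L imax : ℝ) ^ 2 + 20 * invEps L imax + 60 := by
      unfold Inst.pairCost
      change ((tauMax L imax : ℕ) : ℝ) + 20 * (invEps L imax : ℝ) + 60 = _
      unfold tauMax
      push_cast
      rfl
    rw [h1]
    refine le_trans ?_ hE
    set E : ℝ := (invEps L imax : ℝ)
    have h2 : E ^ 2 ≤ E ^ 10 := pow_le_pow_right₀ (by linarith) (by norm_num)
    have h3 : (200 * E) ^ 10 = 200 ^ 10 * E ^ 10 := mul_pow _ _ _
    rw [h3]
    nlinarith
  have hE2 := S.invEps_le_size
  rw [Real.rpow_add hn, Real.rpow_one]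
  have hsq := n_eq_sq L imax n
  set z := (inst imax L n Δ).growth
  set y := size L imax n
  set Y := y ^ (100 * invEps L imax)
  set O := (inst imax L n Δ).overhead
  have hpc0 := (inst imax L n Δ).pairCost_nonneg
  have hY0 : 0 ≤ Y := by positivity
  have h1 : (inst imax L n Δ).thresholds.length *
    ((inst imax L n Δ).pairCost + 3) * O +
      (invEps L imax + ((inst imax L n Δ).d / (inst imax L n Δ).γ : ℕ) + 8) ≤ y ^ 4 * O := by
    calc _ ≤ y ^ 2 * y * O + 4 * y * O := by
          gcongr
          refine le_trans ?_ (le_mul_of_one_le_right (by linarith) hO)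
          linarith
      _ = (y ^ 3 + 4 * y) * O := by ring
      _ ≤ y ^ 4 * O := by
          gcongr
          have h2 : y ≤ y ^ 3 := le_self_pow₀ (by linarith) (by norm_num)
          have h3 : 5 * y ^ 3 ≤ y * y ^ 3 := by gcongr; linarith
          nlinarith
  calc _ ≤ (9 * y * Y) ^ 2 * (y ^ 4 * O) := by gcongr
    _ = Y ^ 2 * ((81 * y ^ 6) * O) := by ring
    _ ≤ Y ^ 2 * (z ^ 4 * O) := by
        gcongr
        calc 81 * y ^ 6 ≤ y ^ 2 * y ^ 6 := by gcongr; nlinarith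
          _ = y ^ 8 := by ring
          _ ≤ z := hz
          _ ≤ _ := le_self_pow₀ (by linarith) (by norm_num)
    _ ≤ n * (n : ℝ) ^ (2 / (imax : ℝ)) := by rw [← hsq]; gcongr

/-! ### Failure probabilities -/

/-- The probability that some query misses too many edges. -/
lemma failure_le : ((inst imax L n Δ).thresholds.length : ℝ≥0∞) *
    2⁻¹ ^ ⌈(inst imax L n Δ).growth ^ 2⌉₊ ≤
      ENNReal.ofReal (Real.exp (-(2 * (inst imax L n Δ).growth))) := by
  have h0 := S.size_large
  have hz := S.size_pow_le_growth (k := 2) (by norm_num)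
  have hz1 := S.size_le_growth
  have hthr := S.thresholds_length_le
  set z := (inst imax L n Δ).growth
  have h2 : (2⁻¹ : ℝ≥0∞) = ENNReal.ofReal (2⁻¹ : ℝ) := by
    rw [ENNReal.ofReal_inv_of_pos (by norm_num)]
    norm_num
  rw [h2, ← ENNReal.ofReal_pow (by norm_num), ← ENNReal.ofReal_natCast,
    ← ENNReal.ofReal_mul (Nat.cast_nonneg _)]
  refine ENNReal.ofReal_le_ofReal ?_
  have h3 : (2⁻¹ : ℝ) ^ ⌈z ^ 2⌉₊ ≤ Real.exp (-(z ^ 2 / 2)) := by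
    have h4 : (2⁻¹ : ℝ) ≤ Real.exp (-(1 / 2)) := by
      have := Real.add_one_le_exp (-(1 / 2 : ℝ))
      linarith
    calc (2⁻¹ : ℝ) ^ ⌈z ^ 2⌉₊ ≤ Real.exp (-(1 / 2)) ^ ⌈z ^ 2⌉₊ :=
          pow_le_pow_left₀ (by norm_num) h4 _
      _ = Real.exp (-(⌈z ^ 2⌉₊ / 2)) := by rw [← Real.exp_nat_mul]; ring_nf
      _ ≤ _ := by
          refine Real.exp_le_exp.2 ?_
          have := Nat.le_ceil (z ^ 2)
          linarith
  have h5 : ((inst imax L n Δ).thresholds.length : ℝ) ≤ Real.exp z := by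
    have := Real.add_one_le_exp z
    linarith
  calc _ ≤ Real.exp z * Real.exp (-(z ^ 2 / 2)) := by gcongr
    _ = Real.exp (z + -(z ^ 2 / 2)) := by rw [Real.exp_add]
    _ ≤ _ := Real.exp_le_exp.2 (by nlinarith)

omit S in
lemma t_rpow_le_growth : ((inst imax L n Δ).t : ℝ) ^ eps' L imax ≤ (inst imax L n Δ).growth := by
  have ht : (1 : ℝ) ≤ (inst imax L n Δ).t := by exact_mod_cast Inst.t_pos
  refine Real.rpow_le_rpow_of_exponent_le ht ?_
  change eps' L imax ≤ eps L imax
  rw [eps'_eq, eps_eq]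
  have hE : (0 : ℝ) < invEps L imax := by exact_mod_cast Inst.invEps_pos L imax
  refine one_div_le_one_div_of_le hE ?_
  push_cast
  linarith

lemma t_rpow_le_size :
    ((inst imax L n Δ).t : ℝ) ^ (eps' L imax / 2) ≤ size L imax n := by
  have h0 := S.size_large
  have hE := S.invEps_ge
  have hR : (0 : ℝ) < ((200 * invEps L imax : ℕ) : ℝ) := by
    have : 0 < 200 * invEps L imax := by omega
    exact_mod_cast this
  have h1 : ((inst imax L n Δ).t : ℝ) ≤ size L imax n ^ (2 * (200 * invEps L imax)) := by
    refine S.t_le.trans ?_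
    calc _ ≤ size L imax n * size L imax n * size L imax n ^ (100 * invEps L imax) := by
          gcongr; linarith
      _ = size L imax n ^ (100 * invEps L imax + 2) := by ring
      _ ≤ _ := pow_le_pow_right₀ (by linarith) (by omega)
  have hR2 : ((2 * (200 * invEps L imax) : ℕ) : ℝ) ≠ 0 := by
    have : 2 * (200 * invEps L imax) ≠ 0 := by omega
    exact_mod_cast this
  calc _ ≤ (size L imax n ^ (2 * (200 * invEps L imax))) ^ (eps' L imax / 2) :=
        Real.rpow_le_rpow (Nat.cast_nonneg _) h1 (by rw [eps'_eq]; positivity)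
    _ = size L imax n ^ (((2 * (200 * invEps L imax) : ℕ) : ℝ) * (eps' L imax / 2)) := by
        rw [Real.rpow_mul (by linarith), Real.rpow_natCast]
    _ = size L imax n := by
        rw [eps'_eq]
        conv_rhs => rw [← Real.rpow_one (size L imax n)]
        congr 1
        push_cast at hR2 ⊢
        field_simp

/-! ### The recursive calls -/

/-- The parameters of the next lower level. -/
lemma next {D : ℕ} (hL : 2 ≤ L) (hD : D ∈ (inst imax L n Δ).thresholds) :
    Setting imax (L - 1) (Nat.sqrt n) D := by
  have h0 := S.size_large
  have hE := S.invEps_ge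
  have hinv : 200 * invEps (L - 1) imax = invEps L imax := by
    unfold invEps
    rw [← pow_succ']
    congr 1
    omega
  have hd := S.d_ge
  have hdpos : (0 : ℝ) < Nat.sqrt n := by linarith [S.d_pos]
  refine ⟨S.imax_pos, by omega, ?_, ?_, ?_⟩
  · refine le_trans ?_ hd
    rw [nMin_eq, hinv, show L - 1 + 2 = L + 1 by omega]
    have h1 := le_size S.nMin_le
    have hE1 : (1 : ℝ) ≤ invEps L imax := by exact_mod_cast Inst.invEps_pos L imax
    have h2 : (1 : ℝ) ≤ 1000 * ((200 * invEps L imax : ℕ) : ℝ) ^ 10 := by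
      have : (1 : ℝ) ≤ ((200 * invEps L imax : ℕ) : ℝ) ^ 10 :=
        one_le_pow₀ (by push_cast; linarith)
      linarith
    calc (1000 * (invEps L imax : ℝ) ^ 10) ^ (4 ^ (L + 1) * invEps L imax ^ 2)
        ≤ (1000 * ((200 * invEps L imax : ℕ) : ℝ) ^ 10) ^ (4 ^ (L + 1) * invEps L imax ^ 2) := by
          gcongr
          linarith
      _ ≤ (1000 * ((200 * invEps L imax : ℕ) : ℝ) ^ 10) ^
          (4 ^ (L + 2) * (200 * invEps L imax) * (100 * invEps L imax - 1)) := by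
          refine pow_le_pow_right₀ h2 ?_
          have h3 : 4 ^ (L + 2) = 4 * 4 ^ (L + 1) := pow_succ' 4 (L + 1)
          have h4 : invEps L imax ≤ 100 * invEps L imax - 1 := by omega
          calc 4 ^ (L + 1) * invEps L imax ^ 2 =
                4 ^ (L + 1) * invEps L imax * invEps L imax := by ring
            _ ≤ 4 ^ (L + 2) * (200 * invEps L imax) * (100 * invEps L imax - 1) := by
                refine Nat.mul_le_mul (Nat.mul_le_mul ?_ ?_) h4
                · omega
                · omega
      _ = ((1000 * ((200 * invEps L imax : ℕ) : ℝ) ^ 10) ^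
          (4 ^ (L + 2) * (200 * invEps L imax))) ^ (100 * invEps L imax - 1) := by
          rw [← pow_mul]
      _ ≤ _ := pow_le_pow_left₀ (by positivity) h1 _
  · have h1 : (Nat.sqrt n : ℝ) ^ (1 - eps' (L - 1) imax) ≤ (inst imax L n Δ).γ := by
      have hdγ := S.d_le_γ
      have h2 : 2 * size L imax n ≤ (Nat.sqrt n : ℝ) ^ eps' (L - 1) imax := by
        rw [eps'_eq, hinv, one_div]
        have hE0 : invEps L imax ≠ 0 := by omega
        rw [Real.le_rpow_inv_iff_of_pos (by linarith) hdpos.le (by exact_mod_cast (by omega)),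
          Real.rpow_natCast]
        refine le_trans ?_ hd
        calc (2 * size L imax n) ^ invEps L imax
            ≤ (size L imax n * size L imax n) ^ invEps L imax := by gcongr; linarith
          _ = size L imax n ^ (2 * invEps L imax) := by ring
          _ ≤ _ := pow_le_pow_right₀ (by linarith) (by omega)
      have h3 : 0 < (Nat.sqrt n : ℝ) ^ eps' (L - 1) imax := by linarith
      rw [Real.rpow_sub hdpos, Real.rpow_one, div_le_iff₀ h3]
      have h4 : (0 : ℝ) ≤ (inst imax L n Δ).γ := Nat.cast_nonneg _
      nlinarith
    refine h1.trans ?_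
    have h2 := S.γ_le_d
    unfold Inst.thresholds at hD
    obtain ⟨k, -, rfl⟩ := List.mem_map.1 hD
    norm_cast
    refine le_min (Nat.le_mul_of_pos_left _ (by positivity)) h2
  · unfold Inst.thresholds at hD
    obtain ⟨k, -, rfl⟩ := List.mem_map.1 hD
    norm_cast
    exact min_le_right _ _

/-- The recursive calls fail with a much smaller probability. -/
lemma le_next_t_rpow {D : ℕ} (S' : Setting imax (L - 1) (Nat.sqrt n) D) :
    size L imax n ^ 16 ≤
      ((inst imax (L - 1) (Nat.sqrt n) D).t : ℝ) ^ (eps' (L - 1) imax / 2) := by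
  have h0 := S.size_large
  have hE := S.invEps_ge
  have hL : 1 ≤ L := S.L_pos
  have hL' := S'.L_pos
  have hinv : 200 * invEps (L - 1) imax = invEps L imax := by
    unfold invEps
    rw [← pow_succ']
    congr 1
    omega
  set t' : ℝ := ((inst imax (L - 1) (Nat.sqrt n) D).t : ℝ) with ht'
  have h1 : (Nat.sqrt n : ℝ) ≤ t' ^ 2 := by
    rw [n_eq_sq (L - 1) imax (Nat.sqrt n)]
    exact pow_le_pow_left₀ (by unfold size; positivity) S'.t_ge 2
  have ht0 : 0 ≤ t' := Nat.cast_nonneg _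
  have hE0 : (0 : ℝ) < invEps L imax := by exact_mod_cast Inst.invEps_pos L imax
  have h2 : size L imax n ^ (64 * invEps L imax) ≤ t' ^ 2 := by
    refine le_trans (pow_le_pow_right₀ (by linarith) (by omega)) (S.d_ge.trans h1)
  have h3 : size L imax n ^ (32 * invEps L imax) ≤ t' := by
    rw [← pow_le_pow_iff_left₀ (by positivity) ht0 two_ne_zero, ← pow_mul]
    refine le_trans (le_of_eq ?_) h2
    ring
  have hexp : eps' (L - 1) imax / 2 = (2 * (invEps L imax : ℝ))⁻¹ := by
    rw [eps'_eq, hinv]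
    field_simp
  rw [hexp, Real.le_rpow_inv_iff_of_pos (by positivity) ht0 (by positivity)]
  have h4 : (2 * (invEps L imax : ℝ)) = ((2 * invEps L imax : ℕ) : ℝ) := by push_cast; rfl
  rw [h4, Real.rpow_natCast, ← pow_mul]
  refine le_trans (le_of_eq ?_) h3
  ring

/-- All failure probabilities together. -/
lemma total_failure_le :
    (n : ℝ) ^ (1 / 2 + 2 / (imax : ℝ)) * Real.exp (-(size L imax n ^ 16)) +
      Real.exp (-(2 * (inst imax L n Δ).growth)) ≤
    Real.exp (-(((inst imax L n Δ).t : ℝ) ^ (eps' L imax / 2))) := by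
  have h0 := S.size_large
  have hz := S.size_le_growth
  have ht := S.t_rpow_le_size
  have hE := S.invEps_le_size
  have himax : (1 : ℝ) ≤ imax := by exact_mod_cast S.imax_pos
  have hn1 : (1 : ℝ) ≤ n := by exact_mod_cast S.n_pos
  have hpow := size_pow L imax n
  set y := size L imax n with hy
  have h1 : (n : ℝ) ^ (1 / 2 + 2 / (imax : ℝ)) ≤ Real.exp (y ^ 2) := by
    calc _ ≤ (n : ℝ) ^ (3 : ℝ) := by
          refine Real.rpow_le_rpow_of_exponent_le hn1 ?_
          have : 2 / (imax : ℝ) ≤ 2 := div_le_self (by norm_num) himax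
          linarith
      _ = y ^ (200 * invEps L imax * 3) := by
          rw [pow_mul, hpow]; norm_cast
      _ ≤ (Real.exp y) ^ (200 * invEps L imax * 3) := by
          refine pow_le_pow_left₀ (by linarith) ?_ _
          have := Real.add_one_le_exp y
          linarith
      _ = Real.exp ((200 * invEps L imax * 3 : ℕ) * y) := (Real.exp_nat_mul _ _).symm
      _ ≤ _ := by
          refine Real.exp_le_exp.2 ?_
          push_cast
          nlinarith
  have h2 : Real.exp (y ^ 2) * Real.exp (-(y ^ 16)) ≤ Real.exp (-(2 * y)) := by
    rw [← Real.exp_add]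
    refine Real.exp_le_exp.2 ?_
    have h3 : y ^ 2 * y ^ 2 ≤ y ^ 16 := by
      rw [← pow_add]
      exact pow_le_pow_right₀ (by linarith) (by norm_num)
    have h4 : y ≤ y ^ 2 := le_self_pow₀ (by linarith) (by norm_num)
    nlinarith
  have h3 : Real.exp (-(2 * (inst imax L n Δ).growth)) ≤ Real.exp (-(2 * y)) :=
    Real.exp_le_exp.2 (by linarith)
  have h4 : 2 * Real.exp (-(2 * y)) ≤ Real.exp (-y) := by
    have h5 : Real.exp (-(2 * y)) = Real.exp (-y) * Real.exp (-y) := by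
      rw [← Real.exp_add]; ring_nf
    have h6 : Real.exp (-y) ≤ 1 / 2 := by
      rw [Real.exp_neg, ← one_div]
      refine one_div_le_one_div_of_le (by norm_num) ?_
      have := Real.add_one_le_exp y
      linarith
    rw [h5]
    nlinarith [Real.exp_pos (-y)]
  calc _ ≤ Real.exp (y ^ 2) * Real.exp (-(y ^ 16)) + Real.exp (-(2 * y)) := by gcongr
    _ ≤ 2 * Real.exp (-(2 * y)) := by linarith
    _ ≤ _ := h4
    _ ≤ _ := Real.exp_le_exp.2 (by linarith)

end Setting

/-! ### Correctness of one level -/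

section Correctness

variable {α : Type*}

/-- The edit distance of two windows. -/
noncomputable def Inst.windowDist (X : Inst) (A B : List α) (x y : Win) : ℕ :=
  editDist (X.word A B x) (X.word A B y)

lemma Inst.closeMatching_empty (X : Inst) (A B : List α) (D : ℕ) (m : ℕ → ℕ) :
    CloseMatching X (X.windowDist A B) D m ∅ :=
  ⟨fun _ => editDist_self _, fun _ _ => editDist_comm _ _, fun _ _ _ => editDist_triangle _ _ _,
    by simp, by simp, by simp [StrictMonoOn], by simp⟩

lemma Inst.Matching.closeMatching {X : Inst} {A B : List α} (M : X.Matching A B) (D : ℕ) :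
    CloseMatching X (X.windowDist A B) D M.m
      (M.S.filter fun k => X.windowDist A B (Sum.inl k) (Sum.inr (M.m k)) ≤ D) :=
  ⟨fun _ => editDist_self _, fun _ _ => editDist_comm _ _, fun _ _ _ => editDist_triangle _ _ _,
    fun k hk => M.lt_numA k (Finset.mem_filter.1 hk).1,
    fun k hk => M.lt_numB k (Finset.mem_filter.1 hk).1,
    M.strictMono.mono fun _ hk => (Finset.mem_filter.1 (Finset.mem_coe.1 hk)).1,
    fun _ hk => (Finset.mem_filter.1 hk).2⟩

lemma Inst.windowDist_le {X : Inst} {A B : List α} (hA : A.length = X.n) (hB : B.length = X.n) :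
    ∀ k < X.numA, ∀ j < X.numB, X.windowDist A B (Sum.inl k) (Sum.inr j) ≤ X.d := by
  intro k hk j hj
  have h1 := X.word_length A B hA hB (X.mem_windows.2 (Or.inl ⟨k, hk, rfl⟩))
  have h2 := X.word_length A B hA hB (X.mem_windows.2 (Or.inr ⟨j, hj, rfl⟩))
  exact (editDist_le_length _ _ (h1.trans h2.symm)).trans h1.le

/-- The answer `v` approximates the distance of `A` and `B` as level `L` promises. -/
def Approximates (imax L : ℕ) (Δ : ℝ) (A B : List α) (v : ℕ) : Prop :=
  editDist A B ≤ v ∧ (v : ℝ) ≤ alpha L imax * (editDist A B + Δ)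

lemma Inst.CallSucceeds.ok {X : Inst} {A B : List α} {e : Query × Reply}
    (h : X.CallSucceeds A B e) (q : Query) (hq : Query.Same q e.1) :
    X.Ok (X.windowDist A B) q e.2.value := by
  obtain ⟨h1, h2⟩ := h
  obtain ⟨hΔ, ⟨hx, hy⟩ | ⟨hx, hy⟩⟩ := hq
  · rw [hx, hy] at h1 h2
    rw [hΔ] at h2
    exact ⟨h1, h2⟩
  · rw [hx, hy, editDist_comm] at h1 h2
    rw [hΔ] at h2
    exact ⟨h1, h2⟩

namespace Setting

variable {imax L n : ℕ} {Δ : ℝ} (S : Setting imax L n Δ) {A B : List α}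

include S

lemma le_alpha : (64 * beta L imax : ℝ) ≤ alpha L imax := by
  exact_mod_cast Inst.beta_mul_le (X := inst imax L n Δ) S.L_pos

omit S in
lemma one_le_beta (L imax : ℕ) : (1 : ℝ) ≤ beta L imax := by
  have h : 0 < expansion L imax := Nat.mul_pos (by norm_num) (Inst.alpha_pos _ _)
  exact_mod_cast Nat.one_le_pow _ _ h

/-- If few estimates are wrong, the distance computed from them is small. -/
lemma edOf_le_of_few_wrong (M : (inst imax L n Δ).Matching A B) {E : ℕ → ℕ → ℕ}
    (hE : (inst imax L n Δ).Bounds ((inst imax L n Δ).windowDist A B) E)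
    (hw : ∀ D ∈ (inst imax L n Δ).thresholds,
      ((inst imax L n Δ).wrong M.m (M.S.filter fun k =>
        (inst imax L n Δ).windowDist A B (Sum.inl k) (Sum.inr (M.m k)) ≤ D) D E : ℝ) ≤
        (inst imax L n Δ).t / (inst imax L n Δ).growth) :
    ((inst imax L n Δ).edOf E : ℝ) ≤ alpha L imax * (editDist A B + Δ) := by
  have hα := S.le_alpha
  have hβ := one_le_beta L imax
  have hnγ := S.numA_mul_γ_le
  have hwt := S.wrong_total_le
  have hdΔ := S.d_le_Δ
  have hd1 := S.d_pos
  set w := ⌊((inst imax L n Δ).t : ℝ) / (inst imax L n Δ).growth⌋₊ with hwdef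
  have hg : 0 ≤ (inst imax L n Δ).growth := growth_nonneg
  have h1 := Inst.sum_estimates_le (inst_γ_pos imax L n Δ) M hE w
    (fun D hD => Nat.le_floor (hw D hD))
  have h2 := (inst imax L n Δ).edOf_le_of_matching M E _ h1
  have h3 : ((inst imax L n Δ).d : ℝ) * ((inst imax L n Δ).thresholds.length * w) ≤ Δ := by
    refine le_trans ?_ hwt
    have h4 : (w : ℝ) ≤ (inst imax L n Δ).t / (inst imax L n Δ).growth :=
      Nat.floor_le (by positivity)
    change (Nat.sqrt n : ℝ) * _ ≤ _
    gcongr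
  have h4 : ((n % (inst imax L n Δ).d : ℕ) : ℝ) ≤ Δ := by
    refine le_trans ?_ hdΔ
    have h5 : 0 < Nat.sqrt n := by exact_mod_cast (by linarith : (0 : ℝ) < Nat.sqrt n)
    exact_mod_cast (Nat.mod_lt n h5).le
  have h5 : ((inst imax L n Δ).edOf E : ℝ) ≤
      2 * (beta L imax * (5 * ((inst imax L n Δ).numA * (inst imax L n Δ).γ) +
        8 * editDist A B) + (inst imax L n Δ).d * ((inst imax L n Δ).thresholds.length * w)) +
      28 * editDist A B + 4 * ((inst imax L n Δ).numA * (inst imax L n Δ).γ) +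
        2 * (n % (inst imax L n Δ).d : ℕ) := by exact_mod_cast h2
  have hED : (0 : ℝ) ≤ editDist A B := Nat.cast_nonneg _
  set β : ℝ := (beta L imax : ℝ)
  set e : ℝ := (editDist A B : ℝ)
  have h6 : β * (5 * ((inst imax L n Δ).numA * (inst imax L n Δ).γ) + 8 * e) ≤
    β * (5 * Δ + 8 * e) := by gcongr
  have h7 : Δ ≤ β * Δ := le_mul_of_one_le_left (by linarith) hβ
  have h8 : e ≤ β * e := le_mul_of_one_le_left hED hβ
  calc _ ≤ 64 * β * (e + Δ) := by nlinarith
    _ ≤ _ := by gcongr; linarith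

/-- If the spacing is large, the additive error allows for the trivial answer. -/
lemma edOf_le_of_lt (h : (inst imax L n Δ).d < 2 * (inst imax L n Δ).γ) (E : ℕ → ℕ → ℕ) :
    ((inst imax L n Δ).edOf E : ℝ) ≤ alpha L imax * (editDist A B + Δ) := by
  have hα := S.le_alpha
  have hβ := one_le_beta L imax
  have hγ := S.γ_le
  have hd := S.size_le_d
  have h0 := S.size_large
  have hn : (0 : ℝ) < n := by exact_mod_cast S.n_pos
  have h1 : (Nat.sqrt n : ℝ) < 2 * (inst imax L n Δ).γ := by exact_mod_cast h
  have h2 : (n : ℝ) ≤ 2 * Δ := by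
    rcases le_total (Δ * Nat.sqrt n / n) 1 with h3 | h3
    · rw [max_eq_left h3] at hγ
      linarith
    · rw [max_eq_right h3, le_div_iff₀ hn] at hγ
      nlinarith
  have h3 : ((inst imax L n Δ).edOf E : ℝ) ≤ 2 * n := by
    exact_mod_cast (inst imax L n Δ).edOf_le_trivial E
  have hED : (0 : ℝ) ≤ editDist A B := Nat.cast_nonneg _
  have hΔ := S.Δ_pos
  nlinarith

omit S in
lemma yields_bounds (hA : A.length = n) (hB : B.length = n) :
    Prog.Yields ((inst imax L n Δ).Ok ((inst imax L n Δ).windowDist A B))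
      ((inst imax L n Δ).Bounds ((inst imax L n Δ).windowDist A B))
      ((inst imax L n Δ).aggregateEstimates (inst imax L n Δ).intervals) :=
  Inst.yields_aggregateEstimates (m := id) (fun D => Inst.closeMatching_empty _ A B D id)
    (Inst.windowDist_le hA hB)

open scoped Classical in
/-- As long as all calls succeed, the estimates are good enough with high probability. -/
lemma worst_not_approximates_le (hA : A.length = n) (hB : B.length = n) :
    Prog.worst ((inst imax L n Δ).Ok ((inst imax L n Δ).windowDist A B))
      (fun E => if Approximates imax L Δ A B ((inst imax L n Δ).edOf E) then 0 else 1)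
      ((inst imax L n Δ).aggregateEstimates (inst imax L n Δ).intervals) ≤
    ENNReal.ofReal (Real.exp (-(2 * (inst imax L n Δ).growth))) := by
  have hlow : ∀ E, (inst imax L n Δ).Bounds ((inst imax L n Δ).windowDist A B) E →
      editDist A B ≤ (inst imax L n Δ).edOf E := fun E hE =>
    (inst imax L n Δ).editDist_le_edOf (inst_γ_pos _ _ _ _) hA hB hE.1
  -- the matching is available only for `2 γ ≤ d`; otherwise `Δ` is at least `n / 2`
  by_cases hγ : 2 * (inst imax L n Δ).γ ≤ (inst imax L n Δ).d
  · obtain ⟨M⟩ := (inst imax L n Δ).nonempty_matching (inst_γ_pos _ _ _ _) hγ hA hB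
    refine le_trans ?_ S.failure_le
    set X := inst imax L n Δ with hX
    set S₀ : ℕ → Finset ℕ := fun D =>
      M.S.filter fun k => X.windowDist A B (Sum.inl k) (Sum.inr (M.m k)) ≤ D with hS₀
    calc _ ≤ Prog.worst (X.Ok (X.windowDist A B)) (fun E => ∑ D ∈ X.thresholds.toFinset,
          if (X.t : ℝ) / X.growth < X.wrong M.m (S₀ D) D E then 1 else 0)
          (X.aggregateEstimates X.intervals) := by
          refine Prog.worst_mono_of_yields (fun E hE => ?_) _ (yields_bounds hA hB)
          by_cases hgood : ∀ D ∈ X.thresholds,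
              (X.wrong M.m (S₀ D) D E : ℝ) ≤ X.t / X.growth
          · have : Approximates imax L Δ A B (X.edOf E) :=
              ⟨hlow E hE, S.edOf_le_of_few_wrong M hE hgood⟩
            simp [this]
          · push Not at hgood
            obtain ⟨D, hD, hlt⟩ := hgood
            refine le_trans ?_ (Finset.single_le_sum (fun _ _ => zero_le)
              (List.mem_toFinset.2 hD))
            rw [if_pos hlt]
            split_ifs <;> simp
      _ ≤ ∑ D ∈ X.thresholds.toFinset, 2⁻¹ ^ ⌈X.growth ^ 2⌉₊ := by
          refine (Prog.worst_sum_le _ _ _).trans (Finset.sum_le_sum fun D hD => ?_)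
          exact Inst.worst_wrong_le (M.closeMatching D) S.large S.imax_pos
            (List.mem_toFinset.1 hD)
      _ ≤ _ := by
          rw [Finset.sum_const, nsmul_eq_mul]
          gcongr
          exact_mod_cast X.thresholds.toFinset_card_le
  · refine (Prog.worst_le_of_yields (c := 0) (fun E hE => ?_) (yields_bounds hA hB)).trans
      (zero_le)
    have : Approximates imax L Δ A B ((inst imax L n Δ).edOf E) :=
      ⟨hlow E hE, S.edOf_le_of_lt (by omega) E⟩
    simp [this]

open scoped Classical in
lemma worst_mainProg_le (hA : A.length = n) (hB : B.length = n) :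
    Prog.worst ((inst imax L n Δ).Ok ((inst imax L n Δ).windowDist A B))
      (fun v => if Approximates imax L Δ A B v then 0 else 1) (inst imax L n Δ).mainProg ≤
    ENNReal.ofReal (Real.exp (-(2 * (inst imax L n Δ).growth))) := by
  refine le_trans ?_ (S.worst_not_approximates_le hA hB)
  unfold Inst.mainProg
  simp only [Prog.bind_eq, Prog.worst_bind, Prog.worst_spend]
  refine Prog.worst_mono (fun E => ?_) _
  exact Prog.worst_le_of_yields
    (Q := fun v => v = (inst imax L n Δ).edOf E) (fun v hv => by rw [hv])
    ((inst imax L n Δ).runs_edFromEstimates E (P := fun _ => True) (inst_γ_pos _ _ _ _)).yields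

/-! ### Aggregating estimates from arbitrary answers -/

lemma runs_aggregate : ((inst imax L n Δ).aggregateEstimates (inst imax L n Δ).intervals).Runs
    (inst imax L n Δ).Legal (fun _ => True) ((n : ℝ) ^ (1 + 2 / (imax : ℝ)))
    ((n : ℝ) ^ (1 / 2 + 2 / (imax : ℝ))) := by
  refine (Inst.runs_aggregateEstimates S.large S.imax_pos).mono (fun _ h => h) ?_ S.queries_le
  refine le_trans ?_ S.steps_le
  have h : (0 : ℝ) ≤ invEps L imax +
    ((inst imax L n Δ).d / (inst imax L n Δ).γ : ℕ) + 8 := by positivity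
  nlinarith [mul_nonneg (sq_nonneg ((inst imax L n Δ).t : ℝ)) h]

/-- Queries answered in an arbitrary way: with high probability some call fails, or the distance
computed from the estimates is a good approximation. -/
lemma aggregate_succeeds (hA : A.length = n) (hB : B.length = n) (K : Query → PMF Reply) :
    ENNReal.ofReal (1 - Real.exp (-(((inst imax L n Δ).t : ℝ) ^ eps' L imax))) ≤
      (exec K ((inst imax L n Δ).aggregateEstimates
        (inst imax L n Δ).intervals) []).toOuterMeasure
        {r | (∀ e ∈ r.log, (inst imax L n Δ).CallSucceeds A B e) →
          Approximates imax L Δ A B ((inst imax L n Δ).edOf r.value)} := by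
  classical
  refine le_toOuterMeasure _ _ _ (Real.exp_pos _).le ?_
  have h1 := mean_exec_le_worst (good := (inst imax L n Δ).CallSucceeds A B)
    (fun e he q hq => Inst.CallSucceeds.ok he q hq) K
    (fun E => if Approximates imax L Δ A B ((inst imax L n Δ).edOf E) then 0 else 1)
    ((inst imax L n Δ).aggregateEstimates (inst imax L n Δ).intervals) []
  refine le_trans (mean_mono _ fun r _ => ?_)
    (h1.trans ((S.worst_not_approximates_le hA hB).trans (ENNReal.ofReal_le_ofReal ?_)))
  · simp only [Set.mem_ofPred_eq]
    split_ifs with h1 h2 h3 h4 <;> first | exact le_rfl | exact zero_le | tauto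
  · have h2 := t_rpow_le_growth (imax := imax) (L := L) (n := n) (Δ := Δ)
    have h3 : 0 ≤ (inst imax L n Δ).growth := growth_nonneg
    exact Real.exp_le_exp.2 (by linarith)

end Setting

/-! ### The recursion -/

variable [DecidableEq α]

/-- What a recursive call of level `L` has to do: return a good estimate, efficiently. -/
def GoodCall (imax L n : ℕ) (Δ : ℝ) (A B : List α) (e : Query × Reply) : Prop :=
  (inst imax L n Δ).CallSucceeds A B e ∧
    (if L = 1 then e.2.steps ≤ 5 * Nat.sqrt n ^ 2 ∧ e.2.queries = 0
      else RunsEfficiently imax (Nat.sqrt n) e.2.steps e.2.queries)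

/-- What level `L` promises: all recursive calls are good, and the answer is. -/
def GoodOutcome (imax L n : ℕ) (Δ : ℝ) (A B : List α) (r : Outcome ℕ) : Prop :=
  (∀ e ∈ r.log, GoodCall imax L n Δ A B e) ∧ Approximates imax L Δ A B r.value

open scoped Classical in
lemma mean_if_eq_zero {β : Type*} (p : PMF β) (P : β → Prop) (h : ∀ b ∈ p.support, P b) :
    mean p (fun b => if P b then 0 else 1) = 0 := by
  refine le_antisymm ((mean_mono p (ψ := fun _ => 0) fun b hb => ?_).trans
    (mean_const p 0).le) (zero_le)
  simp [h b hb]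

/-- The law of the replies to the queries of level `L + 1`. -/
noncomputable def replyLaw (imax L : ℕ) (X : Inst) (A B : List α) (q : Query) : PMF Reply :=
  (mainAlg imax L (X.word A B q.x) (X.word A B q.y) (q.Δ : ℝ)).map Outcome.reply

lemma mainAlg_succ (imax L : ℕ) (A B : List α) (Δ : ℝ) : mainAlg imax (L + 1) A B Δ =
    exec (replyLaw imax L (inst imax (L + 1) A.length Δ) A B)
      (inst imax (L + 1) A.length Δ).mainProg [] := rfl

lemma Setting.runs_main {imax L n : ℕ} {Δ : ℝ} (S : Setting imax L n Δ) :
    (inst imax L n Δ).mainProg.Runs (inst imax L n Δ).Legal (fun _ => True)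
      ((n : ℝ) ^ (1 + 2 / (imax : ℝ))) ((n : ℝ) ^ (1 / 2 + 2 / (imax : ℝ))) :=
  (Inst.runs_mainProg S.large S.imax_pos (inst_γ_pos _ _ _ _)).mono (fun _ h => h)
    S.steps_le S.queries_le

lemma Setting.main_efficient {imax L n : ℕ} {Δ : ℝ} (S : Setting imax L n Δ) {A B : List α}
    (hA : A.length = n) (r : Outcome ℕ) (hr : r ∈ (mainAlg imax L A B Δ).support) :
    RunsEfficiently imax n r.steps r.queries := by
  obtain ⟨L, rfl⟩ : ∃ L', L = L' + 1 := ⟨L - 1, by have := S.L_pos; omega⟩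
  subst hA
  rw [mainAlg_succ] at hr
  obtain ⟨h1, h2, -⟩ := exec_of_runs _ _ S.runs_main _ r hr
  exact ⟨h2, h1⟩

open scoped Classical in
/-- One level of the recursion: if each recursive call is good except with tiny probability, then
so is the outcome. -/
lemma Setting.mean_main_le {imax L n : ℕ} {Δ : ℝ} (S : Setting imax (L + 1) n Δ) {A B : List α}
    (hA : A.length = n) (hB : B.length = n)
    (hK : ∀ q, (inst imax (L + 1) n Δ).Legal q →
      mean (replyLaw imax L (inst imax (L + 1) n Δ) A B q)
        (fun r => if GoodCall imax (L + 1) n Δ A B (q, r) then 0 else 1) ≤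
      ENNReal.ofReal (Real.exp (-(size (L + 1) imax n ^ 16)))) :
    mean (mainAlg imax (L + 1) A B Δ)
      (fun r => if GoodOutcome imax (L + 1) n Δ A B r then 0 else 1) ≤
    ENNReal.ofReal (Real.exp
      (-(((inst imax (L + 1) n Δ).t : ℝ) ^ (eps' (L + 1) imax / 2)))) := by
  rw [mainAlg_succ, hA]
  have h1 := mean_exec_bad_call_le _ (GoodCall imax (L + 1) n Δ A B) _ (Real.exp_pos _).le hK _
    S.runs_main [] (by simp)
  have h2 := (mean_exec_le_worst (good := GoodCall imax (L + 1) n Δ A B)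
    (fun e he q hq => he.1.ok q hq) (replyLaw imax L (inst imax (L + 1) n Δ) A B)
    (fun v => if Approximates imax (L + 1) Δ A B v then 0 else 1) _ []).trans
    (S.worst_mainProg_le hA hB)
  refine le_trans (mean_mono _ fun r _ => ?_) (((mean_add _ _ _).le.trans
    (add_le_add h1 h2)).trans ?_)
  · by_cases h3 : ∀ e ∈ r.log, GoodCall imax (L + 1) n Δ A B e
    · by_cases h4 : Approximates imax (L + 1) Δ A B r.value
      · rw [if_pos (show GoodOutcome imax (L + 1) n Δ A B r from ⟨h3, h4⟩)]
        exact zero_le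
      · simp only [if_pos h3, if_neg h4]
        split_ifs <;> simp
    · simp only [if_neg h3]
      split_ifs <;> simp
  · rw [← ENNReal.ofReal_add (by positivity) (by positivity)]
    exact ENNReal.ofReal_le_ofReal S.total_failure_le

open scoped Classical in
lemma mainAlg_mean_le (imax L : ℕ) : ∀ {n : ℕ} {Δ : ℝ}, Setting imax L n Δ → ∀ {A B : List α},
    A.length = n → B.length = n →
    mean (mainAlg imax L A B Δ) (fun r => if GoodOutcome imax L n Δ A B r then 0 else 1) ≤
      ENNReal.ofReal (Real.exp (-(((inst imax L n Δ).t : ℝ) ^ (eps' L imax / 2)))) := by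
  induction L with
  | zero => intro n Δ S; exact absurd S.L_pos (by norm_num)
  | succ L ih =>
    intro n Δ S A B hA hB
    refine S.mean_main_le hA hB fun q ⟨hx, hy, hΔ⟩ => ?_
    have hx' := (inst imax (L + 1) n Δ).word_length A B hA hB hx
    have hy' := (inst imax (L + 1) n Δ).word_length A B hA hB hy
    change _ = Nat.sqrt n at hx' hy'
    -- below level `1` is the exact quadratic algorithm, whose calls are always good
    rcases Nat.eq_zero_or_pos L with rfl | hL
    · refine le_trans (le_of_eq (mean_if_eq_zero _ _ fun r hr => ?_)) (zero_le)
      rw [replyLaw, PMF.mem_support_map_iff] at hr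
      obtain ⟨r', hr', rfl⟩ := hr
      have hd : 1 ≤ Nat.sqrt n := by exact_mod_cast S.d_pos
      obtain ⟨h1, h2, h3⟩ := mainAlg_zero imax _ hd _ _ _ hx' hy' r' hr'
      refine ⟨⟨h1.ge, ?_⟩, ?_⟩
      · change r'.value ≤ alpha 0 imax * _
        rw [h1]
        exact (Nat.le_add_right _ _).trans (Nat.le_mul_of_pos_left _ (Inst.alpha_pos _ _))
      · rw [if_pos rfl]
        exact ⟨h2, h3⟩
    · have S' : Setting imax L (Nat.sqrt n) q.Δ := S.next (by omega) hΔ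
      have h1 := ih S' hx' hy'
      rw [replyLaw, mean_map]
      refine le_trans (mean_mono _ fun r hr => ?_) (h1.trans (ENNReal.ofReal_le_ofReal
        (Real.exp_le_exp.2 (neg_le_neg (S.le_next_t_rpow S')))))
      by_cases h2 : GoodOutcome imax L (Nat.sqrt n) q.Δ
          ((inst imax (L + 1) n Δ).word A B q.x) ((inst imax (L + 1) n Δ).word A B q.y) r
      · have h3 : GoodCall imax (L + 1) n Δ A B (q, r.reply) := by
          refine ⟨⟨h2.2.1, ?_⟩, ?_⟩
          · exact_mod_cast h2.2.2
          · rw [if_neg (by omega)]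
            exact S'.main_efficient hx' r hr
        simp [h3]
      · rw [if_neg h2]
        simp only [Function.comp]
        split_ifs <;> simp

end Correctness

end EditApprox

theorem lemma8 {α : Type*} [DecidableEq α] :
    ∃ C : ℕ, ∀ imax : ℕ, 1 ≤ imax →
      -- level 0 is exact and takes quadratic time
      (∀ n : ℕ, 1 ≤ n → ∀ (Δ : ℝ) (A B : List α), A.length = n → B.length = n →
        ∀ r ∈ (EditApprox.mainAlg imax 0 A B Δ).support,
          r.value = EditApprox.editDist A B ∧ r.steps ≤ C * n ^ 2 ∧ r.queries = 0) ∧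
      ∀ (L : ℕ), 1 ≤ L → ∀ n : ℕ, EditApprox.nMin L imax ≤ (n : ℝ) →
        ∀ Δ : ℝ, (n : ℝ) ^ (1 - EditApprox.eps' L imax) ≤ Δ → Δ ≤ (n : ℝ) →
        ∀ A B : List α, A.length = n → B.length = n →
        -- AggregateEstimates, whose queries are answered in an arbitrary way
        (∀ K : EditApprox.Query → PMF EditApprox.Reply,
          (∀ r ∈ (EditApprox.exec K ((EditApprox.inst imax L n Δ).aggregateEstimates
                (EditApprox.inst imax L n Δ).intervals) []).support,
              EditApprox.RunsEfficiently imax n r.steps r.queries) ∧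
          ENNReal.ofReal (1 - Real.exp
              (-(((EditApprox.inst imax L n Δ).t : ℝ) ^ EditApprox.eps' L imax))) ≤
            (EditApprox.exec K ((EditApprox.inst imax L n Δ).aggregateEstimates
                (EditApprox.inst imax L n Δ).intervals) []).toOuterMeasure
              {r | (∀ e ∈ r.log, (EditApprox.inst imax L n Δ).CallSucceeds A B e) →
                EditApprox.editDist A B ≤ (EditApprox.inst imax L n Δ).edOf r.value ∧
                ((EditApprox.inst imax L n Δ).edOf r.value : ℝ) ≤
                  EditApprox.alpha L imax * (EditApprox.editDist A B + Δ)}) ∧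
        -- Main, whose queries are answered by Main on level L - 1
        (∀ r ∈ (EditApprox.mainAlg imax L A B Δ).support,
            EditApprox.RunsEfficiently imax n r.steps r.queries) ∧
        ENNReal.ofReal (1 - Real.exp
            (-(((EditApprox.inst imax L n Δ).t : ℝ) ^ (EditApprox.eps' L imax / 2)))) ≤
          (EditApprox.mainAlg imax L A B Δ).toOuterMeasure
            {r | (∀ e ∈ r.log, (EditApprox.inst imax L n Δ).CallSucceeds A B e ∧
                  (if L = 1 then e.2.steps ≤ C * Nat.sqrt n ^ 2 ∧ e.2.queries = 0
                    else EditApprox.RunsEfficiently imax (Nat.sqrt n) e.2.steps e.2.queries)) ∧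
              EditApprox.editDist A B ≤ r.value ∧
              (r.value : ℝ) ≤ EditApprox.alpha L imax * (EditApprox.editDist A B + Δ)} := by
  refine ⟨5, fun imax himax => ⟨fun n hn Δ A B hA hB =>
    EditApprox.mainAlg_zero imax n hn Δ A B hA hB, fun L hL n hn Δ hΔ hΔn A B hA hB => ?_⟩⟩
  have S : EditApprox.Setting imax L n Δ := ⟨himax, hL, hn, hΔ, hΔn⟩
  refine ⟨fun K => ⟨fun r hr => ?_, S.aggregate_succeeds hA hB K⟩, S.main_efficient hA, ?_⟩
  · obtain ⟨h1, h2, -⟩ := EditApprox.exec_of_runs K _ S.runs_aggregate _ r hr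
    exact ⟨h2, h1⟩
  · exact EditApprox.le_toOuterMeasure _ _ _ (Real.exp_pos _).le
      (EditApprox.mainAlg_mean_le imax L S hA hB)
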